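/- Let $k$ be a field of characteristic $0$, let $\mathcal O$ be a smooth commutative $k$-algebra (the functions of a smooth affine variety), and let $\mathcal D$ be its ring of ($k$-linear, Grothendieck) differential operators. Let $\mathcal A$ be a differential non-negatively graded $\mathcal D$-algebra, i.e. a commutative monoid in the symmetric monoidal category $({\tt DG}\mathcal D{\tt M},\otimes_{\mathcal O})$ of non-negatively graded chain complexes of left $\mathcal D$-modules, and let ${\tt Mod}(\mathcal A)$ be the category of $\mathcal A$-modules in ${\tt DG}\mathcal D{\tt M}$, with its tensor product $\otimes_{\mathcal A}$ and its model structure: weak equivalences are the quasi-isomorphisms, fibrations are the morphisms that are surjective in all positive degrees, cofibrations are the morphisms with the left lifting property with respect to the trivial fibrations. Write $M\approx N$ if $M$ and $N$ are related by a zigzag of weak equivalences. Let $L:{\tt Mod}(\mathcal A)\to{\tt Ho}({\tt Mod}(\mathcal A))$ be the strict localization at the weak equivalences. For a functor $G:{\tt Mod}(\mathcal A)\times{\tt Mod}(\mathcal A)\to{\tt Ho}({\tt Mod}(\mathcal A))$ that sends all pairs of weak equivalences to isomorphisms, let ${\tt Ho}(G)$ be its unique on-the-nose factorization through the strict localization $L_2:{\tt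 Mod}(\mathcal A)\times{\tt Mod}(\mathcal A)\to{\tt Ho}({\tt Mod}(\mathcal A)\times{\tt Mod}(\mathcal A))$ at the pairs of weak equivalences. Fix a functorial factorization of the morphisms of ${\tt Mod}(\mathcal A)$ into a cofibration followed by a trivial fibration. Applied to the morphisms $0\to M$, it gives the cofibrant F-replacement functor $Q$ and the natural trivial fibration $q:Q\Rightarrow\mathrm{id}$. A local cofibrant replacement $C$ is a choice, for every $M$, of a cofibrant object $CM$ and a weak equivalence $c_M:CM\to M$. It is a local cofibrant F-replacement if every $c_M$ is moreover a fibration and $c_M=\mathrm{id}_M$ whenever $M$ is cofibrant. Theorem. (1) The functors $L\circ(Q-\otimes_{\mathcal A}Q-)$, $L\circ(-\otimes_{\mathcal A}Q-)$ and $L\circ(Q-\otimes_{\mathcal A}-)$ send pairs of weak equivalences to isomorphisms, so that their factorizations ${\tt Ho}(\cdot)$ exist. Set $-\otimes^{\mathbb L}_{\mathcal A}-:={\tt Ho}(L\circ(Q-\otimes_{\mathcal A}Q-))$. (2) The whiskered transformations $L\star\otimes_{\mathcal A}\star(q\times\mathrm{id}_Q):L\circ(Q-\otimes_{\mathcal A}Q-)\Rightarrow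 L\circ(-\otimes_{\mathcal A}Q-)$ and $L\star\otimes_{\mathcal A}\star(\mathrm{id}_Q\times q):L\circ(Q-\otimes_{\mathcal A}Q-)\Rightarrow L\circ(Q-\otimes_{\mathcal A}-)$ are natural isomorphisms, and they induce canonical natural isomorphisms $${\tt Ho}(L\circ(-\otimes_{\mathcal A}Q-))\;\cong\;-\otimes^{\mathbb L}_{\mathcal A}-\;\cong\;{\tt Ho}(L\circ(Q-\otimes_{\mathcal A}-)),$$ each of which is the unique isomorphism (out of $-\otimes^{\mathbb L}_{\mathcal A}-$) whose whiskering with $L_2$ is the respective whiskered transformation. (3) For all $M,N\in{\tt Mod}(\mathcal A)$, $$M\otimes^{\mathbb L}_{\mathcal A}N:=QM\otimes_{\mathcal A}QN\;\approx\;QM\otimes_{\mathcal A}N\;\approx\;M\otimes_{\mathcal A}QN .$$ (4) For all local cofibrant F-replacements $\tilde C,\tilde C'$, all local cofibrant replacements $C,C'$ and all $M,N\in{\tt Mod}(\mathcal A)$, $$M\otimes^{\mathbb L}_{\mathcal A}N\;\approx\;\tilde CM\otimes_{\mathcal A}\tilde C'N\;\approx\;CM\otimes_{\mathcal A}C'N\;\approx\;QM\otimes_{\mathcal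 A}C'N .$$ -/

import Mathlib

open CategoryTheory TensorProduct

universe v u

noncomputable section

namespace DGeom

/-! ## The ring of differential operators -/

section DiffOp

variable (k : Type v) (O : Type u) [Field k] [CommRing O] [Algebra k O]

/-- Multiplication by `f`, as a `k`-linear endomorphism of `O`. -/
abbrev mulEnd (f : O) : Module.End k O := LinearMap.mulLeft k f

variable {O}

/-- Grothendieck's differential operators: `IsDiffOpLT k n P` says that `P : O → O` is a
differential operator of order `< n` (only `0` has order `< 0`, and `P` has order `< n + 1`
iff all commutators `[P, f]`, `f ∈ O`, have order `< n`). -/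
def IsDiffOpLT : ℕ → Module.End k O → Prop
  | 0, P => P = 0
  | n + 1, P => ∀ f : O, IsDiffOpLT n (P * mulEnd k O f - mulEnd k O f * P)

variable {k}

lemma IsDiffOpLT.zero (n : ℕ) : IsDiffOpLT k n (0 : Module.End k O) := by
  induction n with
  | zero => rfl
  | succ n ih => intro f; simpa using ih

lemma IsDiffOpLT.add {n : ℕ} {P Q : Module.End k O} (hP : IsDiffOpLT k n P)
    (hQ : IsDiffOpLT k n Q) : IsDiffOpLT k n (P + Q) := by
  induction n generalizing P Q with
  | zero => simp only [IsDiffOpLT] at *; simp [hP, hQ]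
  | succ n ih =>
    intro f
    have := ih (hP f) (hQ f)
    convert this using 1
    noncomm_ring

lemma IsDiffOpLT.mulEnd_mul {n : ℕ} {P : Module.End k O} (hP : IsDiffOpLT k n P) (g : O) :
    IsDiffOpLT k n (mulEnd k O g * P) := by
  induction n generalizing P with
  | zero => simp only [IsDiffOpLT] at *; simp [hP]
  | succ n ih =>
    intro f
    convert ih (hP f) using 1
    ext x
    simp
    ring

lemma IsDiffOpLT.succ {n : ℕ} {P : Module.End k O} (hP : IsDiffOpLT k n P) :
    IsDiffOpLT k (n + 1) P := by
  induction n generalizing P with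
  | zero =>
    simp only [IsDiffOpLT] at hP
    subst hP
    exact IsDiffOpLT.zero _
  | succ n ih => exact fun f => ih (hP f)

lemma IsDiffOpLT.mono {m n : ℕ} (h : m ≤ n) {P : Module.End k O} (hP : IsDiffOpLT k m P) :
    IsDiffOpLT k n P := by
  induction h with
  | refl => exact hP
  | step _ ih => exact ih.succ

lemma IsDiffOpLT.mul {N m n : ℕ} (hN : m + n ≤ N) {P Q : Module.End k O}
    (hP : IsDiffOpLT k m P) (hQ : IsDiffOpLT k n Q) : IsDiffOpLT k N (P * Q) := by
  induction N generalizing m n P Q with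
  | zero =>
    obtain rfl : m = 0 := by omega
    simp only [IsDiffOpLT] at hP
    simp [hP, IsDiffOpLT]
  | succ N ih =>
    cases m with
    | zero =>
      simp only [IsDiffOpLT] at hP
      rw [hP, zero_mul]
      exact IsDiffOpLT.zero _
    | succ m =>
      cases n with
      | zero =>
        simp only [IsDiffOpLT] at hQ
        rw [hQ, mul_zero]
        exact IsDiffOpLT.zero _
      | succ n =>
        intro f
        have h1 := ih (by omega) (hP) (hQ f)
        have h2 := ih (by omega) (hP f) hQ
        convert h1.add h2 using 1
        simp only [mul_sub, sub_mul, mul_assoc]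
        abel

lemma IsDiffOpLT.mulEnd (f : O) : IsDiffOpLT k 1 (mulEnd k O f) := by
  intro g
  simp only [IsDiffOpLT]
  ext x
  simp
  ring

lemma IsDiffOpLT.derivation (θ : Derivation k O O) :
    IsDiffOpLT k 2 (θ : O →ₗ[k] O) := by
  intro g
  convert IsDiffOpLT.mulEnd (k := k) (θ g) using 1
  ext x
  simp
  ring

variable (k O)

/-- The differential operators form a `k`-subalgebra of the algebra of `k`-linear
endomorphisms of `O`. -/
def diffOpSubalgebra : Subalgebra k (Module.End k O) where
  carrier := {P | ∃ n, IsDiffOpLT k n P}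
  mul_mem' := by
    rintro P Q ⟨m, hP⟩ ⟨n, hQ⟩
    exact ⟨_, IsDiffOpLT.mul le_rfl hP hQ⟩
  add_mem' := by
    rintro P Q ⟨m, hP⟩ ⟨n, hQ⟩
    exact ⟨max m n, (hP.mono (le_max_left _ _)).add (hQ.mono (le_max_right _ _))⟩
  algebraMap_mem' c := by
    refine ⟨1, ?_⟩
    convert IsDiffOpLT.mulEnd (k := k) (algebraMap k O c) using 1
    ext x
    simp [Algebra.smul_def]

/-- The ring `𝒟` of differential operators of the affine scheme with ring of functions `O`. -/
def DiffOp : Type u := diffOpSubalgebra k O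

namespace DiffOp

instance : Ring (DiffOp k O) := inferInstanceAs (Ring (diffOpSubalgebra k O))

/-- The inclusion of `𝒟` into the ring of `k`-linear endomorphisms of `O`. -/
def toEnd : DiffOp k O →+* Module.End k O := (diffOpSubalgebra k O).val.toRingHom

variable {k O}

lemma toEnd_injective : Function.Injective (toEnd k O) := Subtype.val_injective

@[ext] lemma ext {P Q : DiffOp k O} (h : ∀ x, toEnd k O P x = toEnd k O Q x) : P = Q :=
  toEnd_injective (LinearMap.ext h)

lemma exists_order (P : DiffOp k O) : ∃ n, IsDiffOpLT k n (toEnd k O P) := P.2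

variable (k O)

/-- A function, as a differential operator. -/
def ofFun : O →+* DiffOp k O where
  toFun f := ⟨mulEnd k O f, 1, IsDiffOpLT.mulEnd f⟩
  map_one' := Subtype.ext (by ext; simp; rfl)
  map_mul' f g := Subtype.ext (by
    change _ = mulEnd k O f * mulEnd k O g
    ext x
    simp)
  map_zero' := Subtype.ext (by
    change _ = (0 : Module.End k O)
    ext; simp)
  map_add' f g := Subtype.ext (by
    change _ = mulEnd k O f + mulEnd k O g
    ext x
    simp [add_mul])

variable {k O}

/-- A derivation (vector field), as a differential operator. -/
def ofDer (θ : Derivation k O O) : DiffOp k O :=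
  ⟨(θ : O →ₗ[k] O), 2, IsDiffOpLT.derivation θ⟩

@[simp] lemma toEnd_ofFun (f x : O) : toEnd k O (ofFun k O f) x = f * x := rfl

@[simp] lemma toEnd_ofDer (θ : Derivation k O O) (x : O) :
    toEnd k O (ofDer θ) x = θ x := rfl

lemma ofDer_mul_ofFun (θ : Derivation k O O) (f : O) :
    ofDer θ * ofFun k O f = ofFun k O f * ofDer θ + ofFun k O (θ f) := by
  ext x
  simp
  ring

/-- Left multiplication by functions makes `𝒟` an `O`-module. -/
instance : Module O (DiffOp k O) := Module.compHom _ (ofFun k O)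

lemma smul_def (f : O) (P : DiffOp k O) : f • P = ofFun k O f * P := rfl

instance : IsScalarTower O (DiffOp k O) (DiffOp k O) :=
  ⟨fun f P Q => by simp only [smul_def, smul_eq_mul, mul_assoc]⟩

/-- `O` is a left `𝒟`-module. -/
instance : Module (DiffOp k O) O := Module.compHom O (toEnd k O)

lemma smul_fun_def (P : DiffOp k O) (f : O) : P • f = toEnd k O P f := rfl

instance : IsScalarTower O (DiffOp k O) O :=
  ⟨fun f P x => by
    change toEnd k O (ofFun k O f * P) x = f * toEnd k O P x
    simp⟩

section

variable {M : Type*} [AddCommGroup M] [Module O M] [Module (DiffOp k O) M]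
  [IsScalarTower O (DiffOp k O) M]

lemma ofFun_smul (f : O) (m : M) : ofFun k O f • m = f • m := by
  have := smul_assoc f (1 : DiffOp k O) m
  rwa [one_smul, smul_def, mul_one] at this

lemma ofDer_smul_smul (θ : Derivation k O O) (f : O) (m : M) :
    ofDer θ • f • m = f • ofDer θ • m + θ f • m := by
  rw [← ofFun_smul (k := k) f m, ← mul_smul, ofDer_mul_ofFun, add_smul, mul_smul, ofFun_smul,
    ofFun_smul]

end

/-! ### Dual bases of differentials and the structure of `𝒟` in the smooth case -/

section Smooth

variable (k O) in
lemma exists_dualBasis [Algebra.Smooth k O] : ∃ (s : Finset O) (D : O → Derivation k O O),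
    ∀ (θ : Derivation k O O) (g : O), θ g = ∑ i ∈ s, θ i * D i g := by
  classical
  have h := KaehlerDifferential.span_range_derivation k O
  have hfg : (Submodule.span O (Set.range (KaehlerDifferential.D k O))).FG := by
    rw [h]; exact Module.Finite.fg_top
  obtain ⟨t, ht, hspan⟩ := (Submodule.fg_span_iff_fg_span_finset_subset _).1 hfg
  rw [h] at hspan
  have ht' : ∀ x, x ∈ t → ∃ y, KaehlerDifferential.D k O y = x := fun x hx => ht hx
  choose! c hc using ht'
  let φ : (t →₀ O) →ₗ[O] Ω[O⁄k] := Finsupp.linearCombination O (fun x : t => (x : Ω[O⁄k]))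
  have hφ : Function.Surjective φ := by
    rw [← LinearMap.range_eq_top, Finsupp.range_linearCombination]
    refine Eq.trans ?_ hspan.symm
    congr 1
    exact Subtype.range_coe
  obtain ⟨σ, hσ⟩ := Module.projective_lifting_property φ LinearMap.id hφ
  let e : t → Derivation k O O := fun i =>
    ((Finsupp.lapply i).comp σ).compDer (KaehlerDifferential.D k O)
  have key : ∀ (θ : Derivation k O O) (g : O), θ g = ∑ i : t, θ (c i) * e i g := by
    intro θ g
    have h1 : φ (σ (KaehlerDifferential.D k O g)) = KaehlerDifferential.D k O g :=
      LinearMap.congr_fun hσ _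
    have h2 := congrArg θ.liftKaehlerDifferential h1
    rw [Derivation.liftKaehlerDifferential_comp_D] at h2
    rw [← h2]
    simp only [φ, Finsupp.linearCombination_apply]
    rw [Finsupp.sum_fintype _ _ (by simp), map_sum]
    refine Finset.sum_congr rfl fun i _ => ?_
    have h3 : ((i : Ω[O⁄k])) = KaehlerDifferential.D k O (c i) := (hc i i.2).symm
    rw [map_smul]
    conv_lhs => rw [h3]
    rw [Derivation.liftKaehlerDifferential_comp_D, smul_eq_mul, mul_comm]
    rfl
  have hinj : Function.Injective (fun i : t => c i) := by
    intro i j hij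
    apply Subtype.ext
    rw [← hc i i.2, ← hc j j.2]
    exact congrArg _ hij
  let D : O → Derivation k O O := fun x => if hx : ∃ i : t, c i = x then e hx.choose else 0
  have hD : ∀ i : t, D (c i) = e i := by
    intro i
    have hx : ∃ j : t, c j = c i := ⟨i, rfl⟩
    simp only [D, dif_pos hx]
    congr 1
    exact hinj hx.choose_spec
  refine ⟨Finset.univ.image (fun i : t => c i), D, fun θ g => ?_⟩
  rw [Finset.sum_image (fun i _ j _ h => hinj h), key θ g]
  exact Finset.sum_congr rfl fun i _ => by rw [hD]

/-- The commutator of a differential operator with a function. -/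
def comm (P : DiffOp k O) (f : O) : DiffOp k O := P * ofFun k O f - ofFun k O f * P

lemma comm_comm (P : DiffOp k O) (f g : O) : comm (comm P f) g = comm (comm P g) f := by
  have h : ofFun k O f * ofFun k O g = ofFun k O g * ofFun k O f := by
    rw [← map_mul, ← map_mul, mul_comm]
  simp only [comm, sub_mul, mul_sub, mul_assoc, h]
  simp only [← mul_assoc, h]
  abel

variable (k O) in
/-- `P` has order `< n`. -/
def LT (n : ℕ) (P : DiffOp k O) : Prop := IsDiffOpLT k n (toEnd k O P)

lemma LT.comm {n : ℕ} {P : DiffOp k O} (h : LT k O (n + 1) P) (f : O) :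
    LT k O n (comm P f) := h f

lemma lt_succ {n : ℕ} {P : DiffOp k O} (h : ∀ f, LT k O n (DiffOp.comm P f)) :
    LT k O (n + 1) P := h

lemma lt_zero {P : DiffOp k O} : LT k O 0 P ↔ P = 0 := by
  constructor
  · intro h
    apply toEnd_injective
    rw [map_zero]
    exact h
  · rintro rfl
    change toEnd k O 0 = 0
    rw [map_zero]

lemma lt_one {P : DiffOp k O} (h : LT k O 1 P) : P = ofFun k O (toEnd k O P 1) := by
  ext x
  have h1 : DiffOp.comm P x = 0 := lt_zero.1 (h.comm x)
  have := congrArg (fun Q => toEnd k O Q 1) h1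
  simp only [DiffOp.comm, map_sub, map_mul, LinearMap.sub_apply, Module.End.mul_apply,
    toEnd_ofFun, mul_one, map_zero, LinearMap.zero_apply, sub_eq_zero] at this
  rw [toEnd_ofFun, this, mul_comm]

variable {s : Finset O} {D : O → Derivation k O O}

lemma comm_mul_ofFun (Q : DiffOp k O) (a f : O) :
    comm (Q * ofFun k O a) f = comm Q f * ofFun k O a := by
  have h : ofFun k O a * ofFun k O f = ofFun k O f * ofFun k O a := by
    rw [← map_mul, ← map_mul, mul_comm]
  simp only [comm, sub_mul, mul_assoc, h]

lemma euler_aux (hs : ∀ (θ : Derivation k O O) (g : O), θ g = ∑ i ∈ s, θ i * D i g)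
    (g : O) (n : ℕ) (P : DiffOp k O) (hP : LT k O (n + 2) P) :
    LT k O n (∑ i ∈ s, DiffOp.comm P i * ofFun k O (D i g) - DiffOp.comm P g) := by
  induction n generalizing P with
  | zero =>
    have h1 : ∀ f, DiffOp.comm P f = ofFun k O (toEnd k O (DiffOp.comm P f) 1) :=
      fun f => lt_one (hP.comm f)
    let θ : Derivation k O O := Derivation.mk'
      { toFun := fun f => toEnd k O (DiffOp.comm P f) 1
        map_add' := fun f g => by
          simp [DiffOp.comm]
          ring
        map_smul' := fun c f => by
          simp [DiffOp.comm, smul_sub] } (by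
          intro a b
          have ha := congrArg (fun Q => toEnd k O Q b) (h1 a)
          simp [DiffOp.comm] at ha ⊢
          linear_combination ha)
    rw [lt_zero, h1 g, sub_eq_zero]
    have := congrArg (ofFun k O) (hs θ g)
    rw [map_sum] at this
    refine (this.trans (Finset.sum_congr rfl fun i _ => ?_)).symm
    rw [map_mul, h1 i]
    rfl
  | succ n ih =>
    refine lt_succ fun f => ?_
    convert ih (DiffOp.comm P f) (hP.comm f) using 1
    have : ∀ i, DiffOp.comm (DiffOp.comm P i * ofFun k O (D i g)) f =
        DiffOp.comm (DiffOp.comm P f) i * ofFun k O (D i g) := by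
      intro i
      rw [comm_comm P f i, comm_mul_ofFun]
    rw [comm_comm P f g, ← Finset.sum_congr rfl fun i _ => this i]
    simp only [DiffOp.comm, sub_mul, mul_sub, Finset.sum_mul, Finset.mul_sum,
      Finset.sum_sub_distrib]
    abel

lemma euler (hs : ∀ (θ : Derivation k O O) (g : O), θ g = ∑ i ∈ s, θ i * D i g)
    (n : ℕ) (P : DiffOp k O) (hP : LT k O (n + 1) P) :
    LT k O n (∑ i ∈ s, DiffOp.comm P i * ofDer (D i) - n • P) := by
  induction n generalizing P with
  | zero =>
    have h1 : ∀ f, DiffOp.comm P f = 0 := fun f => lt_zero.1 (hP.comm f)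
    simp [h1, lt_zero]
  | succ n ih =>
    refine lt_succ fun f => ?_
    have h1 := ih (DiffOp.comm P f) (hP.comm f)
    have h2 := euler_aux hs f n P hP
    have h3 : LT k O n ((∑ i ∈ s, DiffOp.comm (DiffOp.comm P f) i * ofDer (D i)
        - n • DiffOp.comm P f) + (∑ i ∈ s, DiffOp.comm P i * ofFun k O (D i f)
        - DiffOp.comm P f)) := by
      unfold LT
      rw [map_add]
      exact IsDiffOpLT.add h1 h2
    convert h3 using 1
    have : ∀ i, DiffOp.comm (DiffOp.comm P i * ofDer (D i)) f =
        DiffOp.comm (DiffOp.comm P f) i * ofDer (D i)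
          + DiffOp.comm P i * ofFun k O (D i f) := by
      intro i
      rw [comm_comm P f i]
      simp only [DiffOp.comm, sub_mul, mul_sub, mul_assoc, ofDer_mul_ofFun, mul_add]
      abel
    have h4 : DiffOp.comm (∑ i ∈ s, DiffOp.comm P i * ofDer (D i)) f =
        ∑ i ∈ s, DiffOp.comm (DiffOp.comm P i * ofDer (D i)) f := by
      simp only [DiffOp.comm, Finset.sum_mul, Finset.mul_sum, Finset.sum_sub_distrib]
    have h5 : ∀ Q R : DiffOp k O, DiffOp.comm (Q - R) f = DiffOp.comm Q f - DiffOp.comm R f := by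
      intro Q R
      simp only [DiffOp.comm, sub_mul, mul_sub]
      abel
    have h6 : DiffOp.comm ((n + 1) • P) f = (n + 1) • DiffOp.comm P f := by
      simp only [DiffOp.comm, smul_mul_assoc, mul_smul_comm, smul_sub]
    rw [h5, h4, Finset.sum_congr rfl fun i _ => this i, h6, Finset.sum_add_distrib, add_smul,
      one_smul]
    abel

variable (k) in
/-- Evaluation of a differential operator at a function. -/
def ev (b : O) : DiffOp k O →ₗ[O] O where
  toFun P := toEnd k O P b
  map_add' P Q := by simp
  map_smul' f P := by simp [smul_def]

variable (k) in
/-- The commutator with a function, as an `O`-linear map. -/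
def commₗ (f : O) : DiffOp k O →ₗ[O] DiffOp k O where
  toFun P := DiffOp.comm P f
  map_add' P Q := by simp only [DiffOp.comm, add_mul, mul_add]; abel
  map_smul' g P := by
    have h : ofFun k O f * ofFun k O g = ofFun k O g * ofFun k O f := by
      rw [← map_mul, ← map_mul, mul_comm]
    simp only [DiffOp.comm, smul_def, mul_sub, RingHom.id_apply]
    rw [← mul_assoc (ofFun k O f), h, mul_assoc, mul_assoc]

/-- Right multiplication, as an `O`-linear map. -/
def mulRightₗ (Q : DiffOp k O) : DiffOp k O →ₗ[O] DiffOp k O where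
  toFun P := P * Q
  map_add' P P' := add_mul _ _ _
  map_smul' g P := by simp only [smul_def, mul_assoc, RingHom.id_apply]

lemma ev_comp_commₗ (b f : O) : ev k b ∘ₗ commₗ k f = ev k (f * b) - f • ev k b := by
  ext P
  simp [ev, commₗ, DiffOp.comm]

lemma ev_comp_mulRightₗ (b : O) (θ : Derivation k O O) :
    ev k b ∘ₗ mulRightₗ (ofDer θ) = ev k (θ b) := by
  ext P
  simp [ev, mulRightₗ]

variable [CharZero k] [Algebra.Smooth k O]

/-- In the smooth case in characteristic zero, a set of differential operators that contains the
functions and is stable under sums and under right multiplication by derivations and under left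
multiplication by functions is everything. -/
lemma order_induction {p : DiffOp k O → Prop} (hfun : ∀ f, p (ofFun k O f))
    (hadd : ∀ P Q, p P → p Q → p (P + Q))
    (hsmul : ∀ (f : O) P, p P → p (f • P))
    (hder : ∀ P θ, p P → p (P * ofDer θ)) (P : DiffOp k O) : p P := by
  obtain ⟨s, D, hs⟩ := exists_dualBasis k O
  have h0 : p 0 := by simpa using hfun 0
  have main : ∀ n P, LT k O n P → p P := by
    intro n
    induction n with
    | zero => intro P hP; rw [lt_zero.1 hP]; exact h0
    | succ n ih =>
      intro P hP
      cases n with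
      | zero => rw [lt_one hP]; exact hfun _
      | succ n =>
        have hE := ih _ (euler hs (n + 1) P hP)
        have hS : p (∑ i ∈ s, DiffOp.comm P i * ofDer (D i)) :=
          Finset.sum_induction _ p (fun a b => hadd a b) h0
            (fun i _ => hder _ _ (ih _ (hP.comm i)))
        have hc : ((n + 1 : ℕ) : k) ≠ 0 := by exact_mod_cast Nat.succ_ne_zero n
        let c : O := algebraMap k O ((n + 1 : ℕ) : k)⁻¹
        have hc' : c * ((n + 1 : ℕ) : O) = 1 := by
          simp only [c]
          rw [← map_natCast (algebraMap k O), ← map_mul, inv_mul_cancel₀ hc, map_one]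
        have hcP : c • ((n + 1) • P) = P := by
          rw [← Nat.cast_smul_eq_nsmul O (n + 1) P, ← mul_smul, hc', one_smul]
        have := hsmul c _ (hadd _ _ hS (hsmul (-1) _ hE))
        convert this using 1
        rw [neg_smul, one_smul, neg_sub, add_sub_cancel, hcP]
  obtain ⟨n, hn⟩ := exists_order P
  exact main n P hn

/-! ### An element of `𝒟 ⊗ 𝒟` that annihilates all pairs of functions vanishes -/

section

variable {N : Type*} [AddCommGroup N] [Module O N]

lemma tensor_eq_zero_aux (n : ℕ) (T : DiffOp k O ⊗[O] N)
    (hT : T ∈ Submodule.span O {t | ∃ P x, LT k O n P ∧ P ⊗ₜ[O] x = t})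
    (h : ∀ b : O, (ev k b).rTensor N T = 0) : T = 0 := by
  obtain ⟨s, D, hs⟩ := exists_dualBasis k O
  have hmap : ∀ {m n : ℕ} (φ : DiffOp k O →ₗ[O] DiffOp k O)
      (_ : ∀ P, LT k O m P → LT k O n (φ P)) (T : DiffOp k O ⊗[O] N)
      (_ : T ∈ Submodule.span O {t | ∃ P x, LT k O m P ∧ P ⊗ₜ[O] x = t}),
      φ.rTensor N T ∈ Submodule.span O {t | ∃ P x, LT k O n P ∧ P ⊗ₜ[O] x = t} := by
    intro m n φ hφ T hT
    have : Submodule.span O {t | ∃ P x, LT k O m P ∧ P ⊗ₜ[O] x = t} ≤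
        (Submodule.span O {t : DiffOp k O ⊗[O] N | ∃ P x, LT k O n P ∧ P ⊗ₜ[O] x = t}).comap
          (φ.rTensor N) := by
      rw [Submodule.span_le]
      rintro _ ⟨P, x, hP, rfl⟩
      exact Submodule.subset_span ⟨φ P, x, hφ P hP, rfl⟩
    exact this hT
  have hcomp : ∀ (φ ψ : DiffOp k O →ₗ[O] DiffOp k O) (T : DiffOp k O ⊗[O] N),
      (φ ∘ₗ ψ).rTensor N T = φ.rTensor N (ψ.rTensor N T) := fun φ ψ T => by
    rw [LinearMap.rTensor_comp]; rfl
  induction n generalizing T with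
  | zero =>
    have : {t : DiffOp k O ⊗[O] N | ∃ P x, LT k O 0 P ∧ P ⊗ₜ[O] x = t} ⊆ {0} := by
      rintro _ ⟨P, x, hP, rfl⟩
      rw [lt_zero.1 hP, TensorProduct.zero_tmul]
      rfl
    simpa using Submodule.span_mono this hT
  | succ n ih =>
    have hev : ∀ (b : O) (φ : DiffOp k O →ₗ[O] DiffOp k O),
        (ev k b).rTensor N (φ.rTensor N T) = (ev k b ∘ₗ φ).rTensor N T := fun b φ => by
      rw [LinearMap.rTensor_comp]; rfl
    cases n with
    | zero =>
      let φ : DiffOp k O →ₗ[O] DiffOp k O := (ev k 1).smulRight 1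
      have h1 : Submodule.span O {t | ∃ P x, LT k O 1 P ∧ P ⊗ₜ[O] x = t} ≤
          LinearMap.eqLocus (φ.rTensor N) LinearMap.id := by
        rw [Submodule.span_le]
        rintro _ ⟨P, x, hP, rfl⟩
        change φ P ⊗ₜ[O] x = P ⊗ₜ[O] x
        congr 1
        conv_rhs => rw [lt_one hP]
        simp [φ, ev, smul_def]
      have h2 : φ.rTensor N T = T := h1 hT
      have h3 : φ = LinearMap.toSpanSingleton O (DiffOp k O) 1 ∘ₗ ev k 1 := by
        ext P; simp [φ]
      rw [← h2, h3, LinearMap.rTensor_comp, LinearMap.comp_apply, h, map_zero]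
    | succ n =>
      have hκ : ∀ f : O, (commₗ k f).rTensor N T = 0 := by
        intro f
        refine ih _ (hmap _ (fun P hP => hP.comm f) T hT) fun b => ?_
        rw [hev, ev_comp_commₗ, LinearMap.rTensor_sub, LinearMap.sub_apply, h,
          LinearMap.rTensor_smul, LinearMap.smul_apply, h, smul_zero, sub_zero]
      let S : DiffOp k O →ₗ[O] DiffOp k O := ∑ i ∈ s, mulRightₗ (ofDer (D i)) ∘ₗ commₗ k i
      have hS : S.rTensor N T = 0 := by
        have : S.rTensor N = ∑ i ∈ s, (mulRightₗ (ofDer (D i)) ∘ₗ commₗ k i).rTensor N :=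
          map_sum (LinearMap.rTensorHom N) _ _
        rw [this, LinearMap.sum_apply]
        refine Finset.sum_eq_zero fun i _ => ?_
        rw [hcomp, hκ, map_zero]
      have hE := ih ((S - ((n + 1 : ℕ) : O) • LinearMap.id).rTensor N T)
        (hmap _ (fun P hP => by
          have := euler hs (n + 1) P hP
          convert this using 1
          simp only [S, LinearMap.sub_apply, LinearMap.sum_apply, LinearMap.smul_apply,
            LinearMap.id_apply, Nat.cast_smul_eq_nsmul]
          rfl) T hT) (fun b => by
          rw [LinearMap.rTensor_sub, LinearMap.sub_apply, hS, LinearMap.rTensor_smul,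
            LinearMap.rTensor_id, LinearMap.smul_apply, LinearMap.id_apply, zero_sub, map_neg,
            map_smul, h, smul_zero, neg_zero])
      rw [LinearMap.rTensor_sub, LinearMap.sub_apply, hS, LinearMap.rTensor_smul,
            LinearMap.rTensor_id, LinearMap.smul_apply, LinearMap.id_apply, zero_sub,
            neg_eq_zero] at hE
      have hc : ((n + 1 : ℕ) : k) ≠ 0 := by exact_mod_cast Nat.succ_ne_zero n
      have hc' : algebraMap k O ((n + 1 : ℕ) : k)⁻¹ * ((n + 1 : ℕ) : O) = 1 := by
        rw [← map_natCast (algebraMap k O), ← map_mul, inv_mul_cancel₀ hc, map_one]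
      rw [← one_smul O T, ← hc', mul_smul, hE, smul_zero]

lemma tensor_eq_zero (T : DiffOp k O ⊗[O] N) (h : ∀ b : O, (ev k b).rTensor N T = 0) :
    T = 0 := by
  have : ∃ n, T ∈ Submodule.span O {t | ∃ P x, LT k O n P ∧ P ⊗ₜ[O] x = t} := by
    clear h
    have hmono : ∀ {m n : ℕ}, m ≤ n →
        Submodule.span O {t : DiffOp k O ⊗[O] N | ∃ P x, LT k O m P ∧ P ⊗ₜ[O] x = t} ≤
        Submodule.span O {t | ∃ P x, LT k O n P ∧ P ⊗ₜ[O] x = t} := by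
      intro m n hmn
      refine Submodule.span_mono ?_
      rintro _ ⟨P, x, hP, rfl⟩
      exact ⟨P, x, IsDiffOpLT.mono hmn hP, rfl⟩
    induction T using TensorProduct.induction_on with
    | zero => exact ⟨0, zero_mem _⟩
    | tmul P x =>
      obtain ⟨n, hn⟩ := exists_order P
      exact ⟨n, Submodule.subset_span ⟨P, x, hn, rfl⟩⟩
    | add x y hx hy =>
      obtain ⟨m, hm⟩ := hx
      obtain ⟨n, hn⟩ := hy
      exact ⟨max m n, add_mem (hmono (le_max_left _ _) hm) (hmono (le_max_right _ _) hn)⟩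
  obtain ⟨n, hn⟩ := this
  exact tensor_eq_zero_aux n T hn h

end

lemma tensor_diffOp_eq_zero (T : DiffOp k O ⊗[O] DiffOp k O)
    (h : ∀ a b : O, TensorProduct.lift
      ((LinearMap.mul O O).compl₁₂ (ev k a) (ev k b)) T = 0) : T = 0 := by
  refine tensor_eq_zero T fun a => ?_
  have h1 : TensorProduct.lid O (DiffOp k O) ((ev k a).rTensor _ T) = 0 := by
    ext b
    have h2 : ev k b ∘ₗ (TensorProduct.lid O (DiffOp k O)).toLinearMap ∘ₗ
        (ev k a).rTensor (DiffOp k O) =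
        TensorProduct.lift ((LinearMap.mul O O).compl₁₂ (ev k a) (ev k b)) := by
      refine TensorProduct.ext' fun P Q => ?_
      simp [ev, smul_def]
    rw [map_zero, LinearMap.zero_apply, ← h a b, ← h2]
    rfl
  simpa using h1

end Smooth

end DiffOp

end DiffOp


/-! ## The tensor product over `O` of two `𝒟`-modules -/

namespace DTensor

open DiffOp

variable {k : Type v} {O : Type u} [Field k] [CommRing O] [Algebra k O]

variable (k O) in
/-- Noncommutative polynomials in functions and derivations. -/
abbrev Words : Type u := FreeAlgebra ℤ (O ⊕ Derivation k O O)

variable (k O) in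
/-- The differential operator described by a noncommutative polynomial. -/
def toDiffOp : Words k O →ₐ[ℤ] DiffOp k O :=
  FreeAlgebra.lift ℤ (Sum.elim (ofFun k O) ofDer)

lemma toDiffOp_surjective [CharZero k] [Algebra.Smooth k O] :
    Function.Surjective (toDiffOp k O) := by
  intro P
  change P ∈ (toDiffOp k O).range
  have hf : ∀ f, ofFun k O f ∈ (toDiffOp k O).range := fun f =>
    ⟨FreeAlgebra.ι ℤ (Sum.inl f), by simp [toDiffOp]⟩
  have hd : ∀ θ : Derivation k O O, ofDer θ ∈ (toDiffOp k O).range := fun θ =>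
    ⟨FreeAlgebra.ι ℤ (Sum.inr θ), by simp [toDiffOp]⟩
  refine order_induction (p := (· ∈ (toDiffOp k O).range)) hf (fun _ _ => add_mem)
    (fun f P hP => ?_) (fun P θ hP => mul_mem hP (hd θ)) P
  rw [smul_def]
  exact mul_mem (hf f) hP

section

variable (M N : Type*) [AddCommGroup M] [Module O M] [Module (DiffOp k O) M]
  [IsScalarTower O (DiffOp k O) M] [AddCommGroup N] [Module O N] [Module (DiffOp k O) N]
  [IsScalarTower O (DiffOp k O) N]

variable {M N} in
/-- The Leibniz action `m ⊗ n ↦ θ m ⊗ n + m ⊗ θ n` of a derivation on a tensor product. -/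
def derAct (θ : Derivation k O O) : M ⊗[O] N →+ M ⊗[O] N :=
  TensorProduct.liftAddHom
    { toFun := fun m =>
        { toFun := fun n => (ofDer θ • m) ⊗ₜ[O] n + m ⊗ₜ[O] (ofDer θ • n)
          map_zero' := by simp
          map_add' := fun x y => by simp only [smul_add, TensorProduct.tmul_add]; abel }
      map_zero' := by ext; simp
      map_add' := fun x y => by
        ext n
        simp only [smul_add, TensorProduct.add_tmul, AddMonoidHom.coe_mk, ZeroHom.coe_mk,
          AddMonoidHom.add_apply]
        abel }
    (fun r m n => by
      simp only [AddMonoidHom.coe_mk, ZeroHom.coe_mk, ofDer_smul_smul, TensorProduct.add_tmul,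
        TensorProduct.tmul_add, TensorProduct.smul_tmul]
      abel)

@[simp] lemma derAct_tmul (θ : Derivation k O O) (m : M) (n : N) :
    derAct θ (m ⊗ₜ[O] n) = (ofDer θ • m) ⊗ₜ[O] n + m ⊗ₜ[O] (ofDer θ • n) := rfl

/-- The action of noncommutative polynomials in functions and derivations on a tensor product. -/
def wordAct : Words k O →ₐ[ℤ] Module.End ℤ (M ⊗[O] N) :=
  FreeAlgebra.lift ℤ (Sum.elim
    (fun f => (DistribSMul.toAddMonoidHom (M ⊗[O] N) f).toIntLinearMap)
    (fun θ => (derAct θ).toIntLinearMap))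

lemma wordAct_fun (f : O) (t : M ⊗[O] N) :
    wordAct M N (FreeAlgebra.ι ℤ (Sum.inl f) : Words k O) t = f • t := by
  simp [wordAct]

lemma wordAct_der (θ : Derivation k O O) (t : M ⊗[O] N) :
    wordAct M N (FreeAlgebra.ι ℤ (Sum.inr θ) : Words k O) t = derAct θ t := by
  simp [wordAct]

variable {M N} in
lemma wordAct_equivariant {X : Type*} [AddCommGroup X] (ψ : Words k O →ₐ[ℤ] Module.End ℤ X)
    (Φ : M ⊗[O] N →+ X) (hf : ∀ f t, Φ (f • t) = ψ (FreeAlgebra.ι ℤ (Sum.inl f)) (Φ t))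
    (hd : ∀ θ t, Φ (derAct θ t) = ψ (FreeAlgebra.ι ℤ (Sum.inr θ)) (Φ t))
    (w : Words k O) (t : M ⊗[O] N) : Φ (wordAct M N w t) = ψ w (Φ t) := by
  induction w using FreeAlgebra.induction generalizing t with
  | grade0 r =>
    rw [AlgHom.commutes, AlgHom.commutes]
    simp
  | grade1 x =>
    cases x with
    | inl f => rw [wordAct_fun, hf]
    | inr θ => rw [wordAct_der, hd]
  | mul a b ha hb =>
    rw [map_mul, map_mul, Module.End.mul_apply, Module.End.mul_apply, ha, hb]
  | add a b ha hb =>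
    rw [map_add, map_add, LinearMap.add_apply, LinearMap.add_apply, map_add, ha, hb]

variable [CharZero k] [Algebra.Smooth k O]

lemma wordAct_eq_zero (w : Words k O) (hw : toDiffOp k O w = 0) : wordAct M N w = 0 := by
  have h1 : wordAct (DiffOp k O) (DiffOp k O) w (1 ⊗ₜ 1) = 0 := by
    refine tensor_diffOp_eq_zero _ fun a b => ?_
    have h2 := wordAct_equivariant
      ((Module.toModuleEnd ℤ (S := DiffOp k O) O).toIntAlgHom.comp (toDiffOp k O))
      (TensorProduct.lift ((LinearMap.mul O O).compl₁₂ (ev k a) (ev k b))).toAddMonoidHom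
      (fun f t => by
        simp [toDiffOp, smul_fun_def])
      (fun θ t => by
        induction t using TensorProduct.induction_on with
        | zero => simp
        | add x y hx hy =>
          rw [map_add, map_add, hx, hy, map_add, map_add]
        | tmul P Q =>
          simp [toDiffOp, smul_fun_def, ev]
          ring) w (1 ⊗ₜ 1)
    refine h2.trans ?_
    simp [hw]
  ext t
  rw [LinearMap.zero_apply]
  induction t using TensorProduct.induction_on with
  | zero => simp
  | add x y hx hy => rw [map_add, hx, hy, add_zero]
  | tmul m n =>
    have h3 := wordAct_equivariant (wordAct M N (k := k))
      (TensorProduct.map ((LinearMap.toSpanSingleton (DiffOp k O) M m).restrictScalars O)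
        ((LinearMap.toSpanSingleton (DiffOp k O) N n).restrictScalars O)).toAddMonoidHom
      (fun f t => by simp [wordAct_fun])
      (fun θ t => by
        rw [wordAct_der]
        induction t using TensorProduct.induction_on with
        | zero => simp
        | add x y hx hy => rw [map_add, map_add, hx, hy, map_add, map_add]
        | tmul P Q => simp [mul_smul]) w (1 ⊗ₜ 1)
    rw [h1, map_zero] at h3
    simpa using h3.symm

lemma wordAct_congr {w w' : Words k O} (h : toDiffOp k O w = toDiffOp k O w') :
    wordAct M N w = wordAct M N w' := by
  rw [← sub_eq_zero, ← map_sub]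
  exact wordAct_eq_zero M N _ (by rw [map_sub, h, sub_self])

/-- A choice of a noncommutative polynomial that describes a given differential operator. -/
def word (P : DiffOp k O) : Words k O := Function.surjInv toDiffOp_surjective P

@[simp] lemma toDiffOp_word (P : DiffOp k O) : toDiffOp k O (word P) = P :=
  Function.surjInv_eq toDiffOp_surjective P

/-- The tensor product over `O` of two `𝒟`-modules is a `𝒟`-module: functions act in the
obvious way and derivations by the Leibniz rule, see `ofDer_smul_tmul`. -/
instance : Module (DiffOp k O) (M ⊗[O] N) where
  smul P t := wordAct M N (word P) t
  one_smul t := by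
    change wordAct M N (word 1) t = t
    rw [wordAct_congr M N (w' := 1) (by simp), map_one, Module.End.one_apply]
  mul_smul P Q t := by
    change wordAct M N (word (P * Q)) t = wordAct M N (word P) (wordAct M N (word Q) t)
    rw [wordAct_congr M N (w' := word P * word Q) (by simp), map_mul, Module.End.mul_apply]
  smul_zero P := map_zero _
  smul_add P x y := map_add _ _ _
  add_smul P Q t := by
    change wordAct M N (word (P + Q)) t = wordAct M N (word P) t + wordAct M N (word Q) t
    rw [wordAct_congr M N (w' := word P + word Q) (by simp), map_add, LinearMap.add_apply]
  zero_smul t := by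
    change wordAct M N (word 0) t = 0
    rw [wordAct_congr M N (w' := 0) (by simp), map_zero, LinearMap.zero_apply]

variable {M N}

lemma toDiffOp_smul (w : Words k O) (t : M ⊗[O] N) : toDiffOp k O w • t = wordAct M N w t :=
  LinearMap.congr_fun (wordAct_congr M N (by simp)) t

lemma ofFun_smul' (f : O) (t : M ⊗[O] N) : ofFun k O f • t = f • t := by
  rw [← wordAct_fun (k := k) M N f t, ← toDiffOp_smul]
  simp [toDiffOp]

lemma ofDer_smul (θ : Derivation k O O) (t : M ⊗[O] N) : ofDer θ • t = derAct θ t := by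
  rw [← wordAct_der M N θ t, ← toDiffOp_smul]
  simp [toDiffOp]

lemma ofDer_smul_tmul (θ : Derivation k O O) (m : M) (n : N) :
    ofDer θ • (m ⊗ₜ[O] n) = (ofDer θ • m) ⊗ₜ[O] n + m ⊗ₜ[O] (ofDer θ • n) := by
  rw [ofDer_smul, derAct_tmul]

instance : IsScalarTower O (DiffOp k O) (M ⊗[O] N) :=
  ⟨fun f P t => by rw [smul_def, mul_smul, ofFun_smul']⟩

end

section

variable [CharZero k] [Algebra.Smooth k O]

/-- An additive map between `𝒟`-modules that commutes with functions and derivations is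
`𝒟`-linear. -/
def mkLinear {M N : Type*} [AddCommGroup M] [Module O M] [Module (DiffOp k O) M]
    [IsScalarTower O (DiffOp k O) M] [AddCommGroup N] [Module O N] [Module (DiffOp k O) N]
    [IsScalarTower O (DiffOp k O) N] (φ : M →+ N) (hf : ∀ (f : O) m, φ (f • m) = f • φ m)
    (hd : ∀ (θ : Derivation k O O) m, φ (ofDer θ • m) = ofDer θ • φ m) :
    M →ₗ[DiffOp k O] N where
  toFun := φ
  map_add' := map_add φ
  map_smul' P m := by
    simp only [RingHom.id_apply]
    refine order_induction (p := fun P => ∀ m, φ (P • m) = P • φ m) (fun f m => ?_)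
      (fun P Q hP hQ m => ?_) (fun f P hP m => ?_) (fun P θ hP m => ?_) P m
    · rw [ofFun_smul, ofFun_smul, hf]
    · rw [add_smul, add_smul, map_add, hP, hQ]
    · rw [smul_assoc, smul_assoc, hf, hP]
    · rw [mul_smul, mul_smul, hP, hd]

variable {M N M' N' : Type*} [AddCommGroup M] [Module O M] [Module (DiffOp k O) M]
  [IsScalarTower O (DiffOp k O) M] [AddCommGroup N] [Module O N] [Module (DiffOp k O) N]
  [IsScalarTower O (DiffOp k O) N] [AddCommGroup M'] [Module O M'] [Module (DiffOp k O) M']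
  [IsScalarTower O (DiffOp k O) M'] [AddCommGroup N'] [Module O N'] [Module (DiffOp k O) N']
  [IsScalarTower O (DiffOp k O) N']

/-- A `𝒟`-linear map is `O`-linear. -/
def toO (f : M →ₗ[DiffOp k O] N) : M →ₗ[O] N where
  toFun := f
  map_add' := map_add f
  map_smul' r m := by
    rw [← ofFun_smul (k := k) r m, map_smul, ofFun_smul, RingHom.id_apply]

/-- The tensor product over `O` of two `𝒟`-linear maps. -/
def map (f : M →ₗ[DiffOp k O] M') (g : N →ₗ[DiffOp k O] N') :
    M ⊗[O] N →ₗ[DiffOp k O] M' ⊗[O] N' :=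
  mkLinear (TensorProduct.map (toO f) (toO g)).toAddMonoidHom
    (fun r t => map_smul (TensorProduct.map (toO f) (toO g)) r t)
    (fun θ t => by
      change TensorProduct.map (toO f) (toO g) _ = _ • TensorProduct.map (toO f) (toO g) _
      induction t using TensorProduct.induction_on with
      | zero => simp
      | add x y hx hy => rw [smul_add, map_add, map_add, smul_add, hx, hy]
      | tmul m n =>
        rw [ofDer_smul_tmul, map_add, TensorProduct.map_tmul, TensorProduct.map_tmul,
          TensorProduct.map_tmul, ofDer_smul_tmul]
        simp only [toO, LinearMap.coe_mk, AddHom.coe_mk, map_smul])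

@[simp] lemma map_tmul (f : M →ₗ[DiffOp k O] M') (g : N →ₗ[DiffOp k O] N') (m : M) (n : N) :
    map f g (m ⊗ₜ[O] n) = f m ⊗ₜ[O] g n := rfl

lemma hom_ext {X : Type*} [AddCommGroup X] [Module (DiffOp k O) X]
    {f g : M ⊗[O] N →ₗ[DiffOp k O] X} (h : ∀ m n, f (m ⊗ₜ[O] n) = g (m ⊗ₜ[O] n)) : f = g := by
  ext t
  induction t using TensorProduct.induction_on with
  | zero => simp
  | add x y hx hy => rw [map_add, map_add, hx, hy]
  | tmul m n => exact h m n

end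

end DTensor


/-! ## Gradings -/

section Grading

variable {R : Type*} {X : Type*} [Ring R] [AddCommGroup X] [Module R X] {G : ℕ → Submodule R X}

/-- The inverse of the canonical map from the direct sum of the components of a grading. -/
def decompose (h : DirectSum.IsInternal G) : X →ₗ[R] DirectSum ℕ fun i => G i :=
  (LinearEquiv.ofBijective (DirectSum.coeLinearMap G) h).symm.toLinearMap

lemma decompose_of_mem (h : DirectSum.IsInternal G) {i : ℕ} {x : X} (hx : x ∈ G i) :
    decompose h x = DirectSum.lof R ℕ (fun i => G i) i ⟨x, hx⟩ := by
  exact (LinearEquiv.symm_apply_eq (LinearEquiv.ofBijective (DirectSum.coeLinearMap G) h)).2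
    (DirectSum.coeLinearMap_lof G i ⟨x, hx⟩).symm

/-- The projection onto the component of degree `n` of a graded module. -/
def gproj (h : DirectSum.IsInternal G) (n : ℕ) : X →ₗ[R] X :=
  (G n).subtype ∘ₗ DirectSum.component R ℕ (fun i => G i) n ∘ₗ decompose h

lemma gproj_of_mem (h : DirectSum.IsInternal G) {i : ℕ} {x : X} (hx : x ∈ G i) (n : ℕ) :
    gproj h n x = if i = n then x else 0 := by
  simp only [gproj, LinearMap.comp_apply, decompose_of_mem h hx]
  split_ifs with hi
  · subst hi
    rw [DirectSum.component.lof_self]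
    rfl
  · rw [DirectSum.component.of, dif_neg hi]
    rfl

/-- The linear map that multiplies elements of degree `n` by `(-1) ^ n`. -/
def gsign (h : DirectSum.IsInternal G) : X →ₗ[R] X :=
  DirectSum.toModule R ℕ X (fun i => (-1 : ℤ) ^ i • (G i).subtype) ∘ₗ decompose h

lemma gsign_of_mem (h : DirectSum.IsInternal G) {i : ℕ} {x : X} (hx : x ∈ G i) :
    gsign h x = (-1 : ℤ) ^ i • x := by
  simp [gsign, decompose_of_mem h hx]

lemma grading_induction (h : DirectSum.IsInternal G) {p : X → Prop}
    (hmem : ∀ i, ∀ x ∈ G i, p x) (hadd : ∀ x y, p x → p y → p (x + y)) (x : X) : p x := by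
  have hx : x ∈ iSup G := by rw [h.submodule_iSup_eq_top]; trivial
  exact Submodule.iSup_induction G (motive := p) hx hmem (hmem 0 0 (zero_mem _)) hadd

lemma isInternal_of_proj (π : ℕ → X →ₗ[R] X)
    (hπ : ∀ i, ∀ x ∈ G i, ∀ n, π n x = if i = n then x else 0) (htop : iSup G = ⊤) :
    DirectSum.IsInternal G := by
  refine DirectSum.isInternal_submodule_of_iSupIndep_of_iSup_eq_top ?_ htop
  intro n
  rw [Submodule.disjoint_def]
  intro x hx hx'
  have h1 : π n x = x := by rw [hπ n x hx, if_pos rfl]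
  have h2 : (⨆ j, ⨆ (_ : j ≠ n), G j) ≤ LinearMap.ker (π n) := by
    refine iSup₂_le fun j hj y hy => ?_
    rw [LinearMap.mem_ker, hπ j y hy, if_neg hj]
  rw [← h1]
  exact h2 hx'

end Grading

/-! ## Differential graded `𝒟`-algebras and their modules -/

section DG

variable (k : Type v) (O : Type u) [Field k] [CommRing O] [Algebra k O]

/-- A differential non-negatively graded `𝒟`-algebra: a (graded) commutative monoid in the
symmetric monoidal category of non-negatively graded chain complexes of `𝒟`-modules (with the
tensor product over `O`). -/
structure DGAlg : Type (max (u + 1) v) where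
  /-- the total underlying module -/
  carrier : Type u
  [ring : Ring carrier]
  [algebra : Algebra O carrier]
  [dmodule : Module (DiffOp k O) carrier]
  [tower : IsScalarTower O (DiffOp k O) carrier]
  /-- the homogeneous components, which are `𝒟`-submodules -/
  gr : ℕ → Submodule (DiffOp k O) carrier
  isInternal : DirectSum.IsInternal gr
  one_mem : (1 : carrier) ∈ gr 0
  mul_mem : ∀ {i j : ℕ} {a b : carrier}, a ∈ gr i → b ∈ gr j → a * b ∈ gr (i + j)
  mul_comm : ∀ {i j : ℕ} {a b : carrier}, a ∈ gr i → b ∈ gr j →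
    b * a = (-1 : ℤ) ^ (i * j) • (a * b)
  der_mul : ∀ (θ : Derivation k O O) (a b : carrier),
    DiffOp.ofDer θ • (a * b) = (DiffOp.ofDer θ • a) * b + a * (DiffOp.ofDer θ • b)
  /-- the differential -/
  d : carrier →ₗ[DiffOp k O] carrier
  d_mem : ∀ {i : ℕ} {a : carrier}, a ∈ gr (i + 1) → d a ∈ gr i
  d_zero : ∀ {a : carrier}, a ∈ gr 0 → d a = 0
  d_d : ∀ a, d (d a) = 0
  d_mul : ∀ {i : ℕ} {a : carrier}, a ∈ gr i → ∀ b, d (a * b) = d a * b + (-1 : ℤ) ^ i • (a * d b)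

attribute [instance] DGAlg.ring DGAlg.algebra DGAlg.dmodule DGAlg.tower

variable {k O}

/-- A module over the differential graded `𝒟`-algebra `A` in the category of non-negatively graded
chain complexes of `𝒟`-modules. -/
structure DGMod (A : DGAlg k O) : Type (u + 1) where
  /-- the total underlying module -/
  carrier : Type u
  [addCommGroup : AddCommGroup carrier]
  [omodule : Module O carrier]
  [dmodule : Module (DiffOp k O) carrier]
  [dtower : IsScalarTower O (DiffOp k O) carrier]
  [amodule : Module A.carrier carrier]
  [atower : IsScalarTower O A.carrier carrier]
  /-- the homogeneous components, which are `𝒟`-submodules -/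
  gr : ℕ → Submodule (DiffOp k O) carrier
  isInternal : DirectSum.IsInternal gr
  smul_mem : ∀ {i j : ℕ} {a : A.carrier} {m : carrier}, a ∈ A.gr i → m ∈ gr j →
    a • m ∈ gr (i + j)
  der_smul : ∀ (θ : Derivation k O O) (a : A.carrier) (m : carrier),
    DiffOp.ofDer θ • (a • m) = (DiffOp.ofDer θ • a) • m + a • (DiffOp.ofDer θ • m)
  /-- the differential -/
  d : carrier →ₗ[DiffOp k O] carrier
  d_mem : ∀ {i : ℕ} {m : carrier}, m ∈ gr (i + 1) → d m ∈ gr i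
  d_zero : ∀ {m : carrier}, m ∈ gr 0 → d m = 0
  d_d : ∀ m, d (d m) = 0
  d_smul : ∀ {i : ℕ} {a : A.carrier}, a ∈ A.gr i → ∀ m,
    d (a • m) = A.d a • m + (-1 : ℤ) ^ i • (a • d m)

attribute [instance] DGMod.addCommGroup DGMod.omodule DGMod.dmodule DGMod.dtower DGMod.amodule
  DGMod.atower

namespace DGMod

variable {A : DGAlg k O}

/-- A morphism of `A`-modules: a `𝒟`-linear and `A`-linear chain map of degree zero. -/
@[ext]
structure Hom (M N : DGMod A) where
  /-- the underlying `𝒟`-linear map -/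
  lin : M.carrier →ₗ[DiffOp k O] N.carrier
  map_smul : ∀ (a : A.carrier) m, lin (a • m) = a • lin m
  map_mem : ∀ {i : ℕ} {m : M.carrier}, m ∈ M.gr i → lin m ∈ N.gr i
  map_d : ∀ m, lin (M.d m) = N.d (lin m)

instance : Category (DGMod A) where
  Hom := Hom
  id M := ⟨LinearMap.id, fun _ _ => rfl, fun h => h, fun _ => rfl⟩
  comp f g := ⟨g.lin ∘ₗ f.lin, fun a m => by simp [f.map_smul, g.map_smul],
    fun h => g.map_mem (f.map_mem h), fun m => by simp [f.map_d, g.map_d]⟩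

@[ext] lemma hom_ext {M N : DGMod A} {f g : M ⟶ N} (h : f.lin = g.lin) : f = g := Hom.ext h

@[simp] lemma id_lin (M : DGMod A) : Hom.lin (𝟙 M) = LinearMap.id := rfl

@[simp] lemma comp_lin {M N P : DGMod A} (f : M ⟶ N) (g : N ⟶ P) :
    Hom.lin (f ≫ g) = g.lin ∘ₗ f.lin := rfl

/-! ### The zero module -/

variable (A) in
/-- The zero module. -/
def zero : DGMod A where
  carrier := PUnit
  gr _ := ⊥
  isInternal := isInternal_of_proj (fun _ => 0) (fun _ _ _ _ => Subsingleton.elim _ _)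
    (Subsingleton.elim _ _)
  smul_mem _ _ := Subsingleton.elim _ _
  der_smul _ _ _ := Subsingleton.elim _ _
  d := 0
  d_mem _ := Subsingleton.elim _ _
  d_zero _ := Subsingleton.elim _ _
  d_d _ := Subsingleton.elim _ _
  d_smul _ _ := Subsingleton.elim _ _

variable (A) in
/-- The zero module is initial. -/
def isInitialZero : Limits.IsInitial (zero A) :=
  Limits.IsInitial.ofUniqueHom
    (fun M => ⟨0, fun _ _ => by simp, fun _ => by simp, fun _ => by simp⟩)
    (fun M f => by
      ext m
      obtain rfl : m = 0 := Subsingleton.elim (α := PUnit) _ _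
      rw [map_zero, map_zero])

instance : Limits.HasInitial (DGMod A) := (isInitialZero A).hasInitial

/-! ### The tensor product over `A` -/

section Tensor

variable [CharZero k] [Algebra.Smooth k O] (M N : DGMod A)

/-- The `𝒟`-submodule of `M ⊗ N` generated by the relations `m a ⊗ n = m ⊗ a n` for homogeneous
elements, where `m a = (-1) ^ (|a| |m|) a m` is the right action on `M`. -/
def rel : Submodule (DiffOp k O) (M.carrier ⊗[O] N.carrier) :=
  Submodule.span _ {t | ∃ (p i j : ℕ) (a : A.carrier) (m : M.carrier) (n : N.carrier),
    a ∈ A.gr p ∧ m ∈ M.gr i ∧ n ∈ N.gr j ∧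
    t = ((-1 : ℤ) ^ (p * i) • (a • m)) ⊗ₜ[O] n - m ⊗ₜ[O] (a • n)}

/-- The `𝒟`-module underlying `M ⊗_A N`. -/
def TensorCarrier : Type u := (M.carrier ⊗[O] N.carrier) ⧸ rel M N

namespace TensorCarrier

instance : AddCommGroup (TensorCarrier M N) :=
  inferInstanceAs (AddCommGroup ((M.carrier ⊗[O] N.carrier) ⧸ rel M N))

instance : Module O (TensorCarrier M N) :=
  inferInstanceAs (Module O ((M.carrier ⊗[O] N.carrier) ⧸ rel M N))

instance : Module (DiffOp k O) (TensorCarrier M N) :=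
  inferInstanceAs (Module (DiffOp k O) ((M.carrier ⊗[O] N.carrier) ⧸ rel M N))

instance : IsScalarTower O (DiffOp k O) (TensorCarrier M N) :=
  inferInstanceAs (IsScalarTower O (DiffOp k O) ((M.carrier ⊗[O] N.carrier) ⧸ rel M N))

/-- The projection `M ⊗ N → M ⊗_A N`. -/
def mk : M.carrier ⊗[O] N.carrier →ₗ[DiffOp k O] TensorCarrier M N := (rel M N).mkQ

lemma mk_surjective : Function.Surjective (mk M N) := Submodule.mkQ_surjective _

variable {M N}

lemma mk_eq_zero {t : M.carrier ⊗[O] N.carrier} : mk M N t = 0 ↔ t ∈ rel M N :=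
  Submodule.Quotient.mk_eq_zero _

lemma mk_osmul (f : O) (t : M.carrier ⊗[O] N.carrier) : mk M N (f • t) = f • mk M N t := rfl

/-- The class of `m ⊗ n`. -/
def tmul (m : M.carrier) (n : N.carrier) : TensorCarrier M N := mk M N (m ⊗ₜ[O] n)

lemma smul_tmul {p i j : ℕ} {a : A.carrier} {m : M.carrier} {n : N.carrier} (ha : a ∈ A.gr p)
    (hm : m ∈ M.gr i) (hn : n ∈ N.gr j) :
    (-1 : ℤ) ^ (p * i) • tmul (a • m) n = tmul m (a • n) := by
  rw [tmul, tmul, ← sub_eq_zero, ← map_zsmul, ← map_sub, mk_eq_zero]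
  exact Submodule.subset_span ⟨p, i, j, a, m, n, ha, hm, hn, by
    rw [TensorProduct.smul_tmul']⟩

lemma hom_induction {p : TensorCarrier M N → Prop}
    (hmem : ∀ (i j : ℕ) (m : M.carrier) (n : N.carrier), m ∈ M.gr i → n ∈ N.gr j → p (tmul m n))
    (hadd : ∀ x y, p x → p y → p (x + y)) (x : TensorCarrier M N) : p x := by
  obtain ⟨t, rfl⟩ := mk_surjective M N x
  induction t using TensorProduct.induction_on with
  | zero =>
    rw [map_zero, ← map_zero (mk M N), ← TensorProduct.zero_tmul _ (0 : N.carrier)]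
    exact hmem 0 0 0 0 (zero_mem _) (zero_mem _)
  | add x y hx hy => rw [map_add]; exact hadd _ _ hx hy
  | tmul m n =>
    induction m using grading_induction M.isInternal with
    | hadd x y hx hy => rw [TensorProduct.add_tmul, map_add]; exact hadd _ _ hx hy
    | hmem i m hm =>
      induction n using grading_induction N.isInternal with
      | hadd x y hx hy => rw [TensorProduct.tmul_add, map_add]; exact hadd _ _ hx hy
      | hmem j n hn => exact hmem i j m n hm hn

variable (M N)

lemma smul_mem_rel (a : A.carrier) {t : M.carrier ⊗[O] N.carrier} (ht : t ∈ rel M N) :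
    a • t ∈ rel M N := by
  have hθ : ∀ (θ : Derivation k O O) (a : A.carrier) (t : M.carrier ⊗[O] N.carrier),
      a • (DiffOp.ofDer θ • t) = DiffOp.ofDer θ • (a • t) - (DiffOp.ofDer θ • a) • t := by
    intro θ a t
    induction t using TensorProduct.induction_on with
    | zero => simp
    | add x y hx hy => simp only [smul_add, hx, hy]; abel
    | tmul m n =>
      simp only [DTensor.ofDer_smul_tmul, smul_add, TensorProduct.smul_tmul', M.der_smul,
        TensorProduct.add_tmul]
      abel
  let K : Submodule (DiffOp k O) (M.carrier ⊗[O] N.carrier) :=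
    { carrier := {t | ∀ a : A.carrier, a • t ∈ rel M N}
      zero_mem' := fun a => by rw [smul_zero]; exact zero_mem _
      add_mem' := fun hx hy a => by rw [smul_add]; exact add_mem (hx a) (hy a)
      smul_mem' := fun P => by
        refine DiffOp.order_induction (p := fun P => ∀ t, (∀ a : A.carrier, a • t ∈ rel M N) →
          ∀ a : A.carrier, a • (P • t) ∈ rel M N) (fun f t ht a => ?_) (fun P Q hP hQ t ht a => ?_)
          (fun f P hP t ht a => ?_) (fun P θ hP t ht a => ?_) P _
        · rw [DiffOp.ofFun_smul, smul_comm, ← DiffOp.ofFun_smul (k := k)]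
          exact Submodule.smul_mem _ _ (ht a)
        · rw [add_smul, smul_add]
          exact add_mem (hP t ht a) (hQ t ht a)
        · rw [smul_assoc, smul_comm, ← DiffOp.ofFun_smul (k := k)]
          exact Submodule.smul_mem _ _ (hP t ht a)
        · rw [mul_smul]
          refine hP _ (fun b => ?_) a
          rw [hθ]
          exact sub_mem (Submodule.smul_mem _ _ (ht b)) (ht _) }
  have hle : rel M N ≤ K := by
    refine Submodule.span_le.2 ?_
    rintro _ ⟨p, i, j, a, m, n, ha, hm, hn, rfl⟩ b
    induction b using grading_induction A.isInternal with
    | hadd x y hx hy => rw [add_smul]; exact add_mem hx hy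
    | hmem q b hb =>
      have h1 := smul_tmul (M := M) (N := N) ha (M.smul_mem hb hm) hn
      have h2 : b • a • m = (-1 : ℤ) ^ (p * q) • a • b • m := by
        rw [← mul_smul, A.mul_comm ha hb, smul_assoc, mul_smul]
      rw [← mk_eq_zero, smul_sub, map_sub, TensorProduct.smul_tmul', TensorProduct.smul_tmul',
        sub_eq_zero]
      refine Eq.trans ?_ h1
      rw [smul_comm b, h2, ← TensorProduct.smul_tmul', ← TensorProduct.smul_tmul', map_zsmul,
        map_zsmul, smul_smul, ← pow_add, mul_add, add_comm]
      rfl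
  exact hle ht a

/-- `A` acts on `M ⊗_A N` by `a (m ⊗ n) = (a m) ⊗ n`. -/
instance : SMul A.carrier (TensorCarrier M N) where
  smul a := QuotientAddGroup.map (rel M N).toAddSubgroup (rel M N).toAddSubgroup
    (DistribSMul.toAddMonoidHom (M.carrier ⊗[O] N.carrier) a)
    (fun _ ht => smul_mem_rel M N a ht)

variable {M N} in
lemma mk_smul (a : A.carrier) (t : M.carrier ⊗[O] N.carrier) : mk M N (a • t) = a • mk M N t := rfl

instance : Module A.carrier (TensorCarrier M N) :=
  Function.Surjective.module A.carrier (mk M N).toAddMonoidHom (mk_surjective M N) mk_smul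

instance : IsScalarTower O A.carrier (TensorCarrier M N) :=
  ⟨fun f a x => by
    obtain ⟨t, rfl⟩ := mk_surjective M N x
    rw [← mk_smul, ← mk_smul, ← mk_osmul, smul_assoc]⟩

variable {M N}

lemma smul_tmul' (a : A.carrier) (m : M.carrier) (n : N.carrier) :
    a • tmul m n = tmul (a • m) n := rfl

lemma ofDer_smul_tmul (θ : Derivation k O O) (m : M.carrier) (n : N.carrier) :
    DiffOp.ofDer θ • tmul m n = tmul (DiffOp.ofDer θ • m) n + tmul m (DiffOp.ofDer θ • n) := by
  simp only [tmul, ← map_smul, DTensor.ofDer_smul_tmul, map_add]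

lemma add_tmul (m m' : M.carrier) (n : N.carrier) :
    tmul (m + m') n = tmul m n + tmul m' n := by
  simp only [tmul, TensorProduct.add_tmul, map_add]

lemma tmul_add (m : M.carrier) (n n' : N.carrier) :
    tmul m (n + n') = tmul m n + tmul m n' := by
  simp only [tmul, TensorProduct.tmul_add, map_add]

lemma zero_tmul (n : N.carrier) : tmul (0 : M.carrier) n = 0 := by
  simp only [tmul, TensorProduct.zero_tmul, map_zero]

lemma tmul_zero (m : M.carrier) : tmul m (0 : N.carrier) = 0 := by
  simp only [tmul, TensorProduct.tmul_zero, map_zero]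

lemma zsmul_tmul (c : ℤ) (m : M.carrier) (n : N.carrier) :
    tmul (c • m) n = c • tmul m n := by
  simp only [tmul, ← TensorProduct.smul_tmul', map_zsmul]

lemma tmul_zsmul (c : ℤ) (m : M.carrier) (n : N.carrier) :
    tmul m (c • n) = c • tmul m n := by
  simp only [tmul, TensorProduct.tmul_smul, map_zsmul]

/-- A `𝒟`-linear map out of `M ⊗ N` that respects the relations descends to `M ⊗_A N`. -/
def desc {X : Type*} [AddCommGroup X] [Module (DiffOp k O) X]
    (φ : M.carrier ⊗[O] N.carrier →ₗ[DiffOp k O] X)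
    (hφ : ∀ (p i j : ℕ) (a : A.carrier) (m : M.carrier) (n : N.carrier),
      a ∈ A.gr p → m ∈ M.gr i → n ∈ N.gr j →
      (-1 : ℤ) ^ (p * i) • φ ((a • m) ⊗ₜ[O] n) = φ (m ⊗ₜ[O] (a • n))) :
    TensorCarrier M N →ₗ[DiffOp k O] X :=
  (rel M N).liftQ φ (Submodule.span_le.2 (by
    rintro _ ⟨p, i, j, a, m, n, ha, hm, hn, rfl⟩
    rw [SetLike.mem_coe, LinearMap.mem_ker, map_sub, ← TensorProduct.smul_tmul', map_zsmul,
      hφ p i j a m n ha hm hn, sub_self]))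

@[simp] lemma desc_tmul {X : Type*} [AddCommGroup X] [Module (DiffOp k O) X]
    (φ : M.carrier ⊗[O] N.carrier →ₗ[DiffOp k O] X) (hφ) (m : M.carrier) (n : N.carrier) :
    desc φ hφ (tmul m n) = φ (m ⊗ₜ[O] n) := rfl

variable (M N)

/-- The component of degree `n` of `M ⊗_A N` is generated by the elements `m ⊗ n` with
`|m| + |n| = n`. -/
def gr (n : ℕ) : Submodule (DiffOp k O) (TensorCarrier M N) :=
  Submodule.span _ {t | ∃ (i j : ℕ) (x : M.carrier) (y : N.carrier), x ∈ M.gr i ∧ y ∈ N.gr j ∧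
    i + j = n ∧ t = tmul x y}

variable {M N} in
lemma tmul_mem {i j n : ℕ} {x : M.carrier} {y : N.carrier} (hx : x ∈ M.gr i) (hy : y ∈ N.gr j)
    (h : i + j = n) : tmul x y ∈ gr M N n :=
  Submodule.subset_span ⟨i, j, x, y, hx, hy, h, rfl⟩

/-- The projection of `M ⊗ N` onto the component of degree `n`. -/
def preProj (n : ℕ) : M.carrier ⊗[O] N.carrier →ₗ[DiffOp k O] M.carrier ⊗[O] N.carrier :=
  ∑ p ∈ Finset.HasAntidiagonal.antidiagonal n, DTensor.map (gproj M.isInternal p.1) (gproj N.isInternal p.2)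

variable {M N} in
lemma preProj_tmul {i j : ℕ} {x : M.carrier} {y : N.carrier} (hx : x ∈ M.gr i)
    (hy : y ∈ N.gr j) (n : ℕ) :
    preProj M N n (x ⊗ₜ[O] y) = if i + j = n then x ⊗ₜ[O] y else 0 := by
  rw [preProj, LinearMap.sum_apply]
  have : ∀ p ∈ Finset.HasAntidiagonal.antidiagonal n,
      DTensor.map (gproj M.isInternal p.1) (gproj N.isInternal p.2) (x ⊗ₜ[O] y) =
      if p = (i, j) then x ⊗ₜ[O] y else 0 := by
    rintro ⟨a, b⟩ -
    rw [DTensor.map_tmul, gproj_of_mem _ hx, gproj_of_mem _ hy]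
    by_cases h1 : i = a <;> by_cases h2 : j = b <;>
      simp [h1, h2, Prod.ext_iff, eq_comm]
  rw [Finset.sum_congr rfl this, Finset.sum_ite_eq']
  simp [Finset.HasAntidiagonal.mem_antidiagonal]

/-- The projection of `M ⊗_A N` onto the component of degree `n`. -/
def proj (n : ℕ) : TensorCarrier M N →ₗ[DiffOp k O] TensorCarrier M N :=
  desc (mk M N ∘ₗ preProj M N n) (fun p i j a m x ha hm hx => by
    rw [LinearMap.comp_apply, LinearMap.comp_apply, preProj_tmul (M.smul_mem ha hm) hx, preProj_tmul hm (N.smul_mem ha hx)]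
    have h : p + i + j = i + (p + j) := by ring
    rw [h]
    split_ifs
    · exact smul_tmul ha hm hx
    · simp)

variable {M N} in
lemma proj_tmul {i j : ℕ} {x : M.carrier} {y : N.carrier} (hx : x ∈ M.gr i)
    (hy : y ∈ N.gr j) (n : ℕ) :
    proj M N n (tmul x y) = if i + j = n then tmul x y else 0 := by
  change mk M N (preProj M N n (x ⊗ₜ[O] y)) = _
  rw [preProj_tmul hx hy]
  split_ifs <;> simp [tmul]

lemma proj_of_mem (i : ℕ) (x : TensorCarrier M N) (hx : x ∈ gr M N i) (n : ℕ) :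
    proj M N n x = if i = n then x else 0 := by
  have h : gr M N i ≤ LinearMap.eqLocus (proj M N n)
      (if i = n then LinearMap.id else 0) := by
    refine Submodule.span_le.2 ?_
    rintro _ ⟨a, b, x, y, hx', hy, rfl, rfl⟩
    change proj M N n (tmul x y) = _
    rw [proj_tmul hx' hy]
    split_ifs <;> rfl
  have h' : proj M N n x = (if i = n then LinearMap.id else 0 :
    TensorCarrier M N →ₗ[DiffOp k O] TensorCarrier M N) x := h hx
  rw [h']
  split_ifs <;> rfl

lemma isInternal : DirectSum.IsInternal (gr M N) := by
  refine isInternal_of_proj (proj M N) (proj_of_mem M N) ?_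
  rw [eq_top_iff]
  rintro x -
  induction x using hom_induction with
  | hmem i j m n hm hn => exact Submodule.mem_iSup_of_mem (i + j) (tmul_mem hm hn rfl)
  | hadd x y hx hy => exact add_mem hx hy

variable {M N}

@[elab_as_elim]
lemma gr_induction {p : TensorCarrier M N → Prop} {n : ℕ}
    (hmem : ∀ (i j : ℕ) (x : M.carrier) (y : N.carrier), x ∈ M.gr i → y ∈ N.gr j → i + j = n →
      p (tmul x y)) (hadd : ∀ x y, p x → p y → p (x + y)) (x : TensorCarrier M N)
    (hx : x ∈ gr M N n) : p x := by
  have h0 : p 0 := by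
    rw [← zero_tmul (0 : N.carrier)]
    exact hmem 0 n 0 0 (zero_mem _) (zero_mem _) (zero_add _)
  have h : ∀ x, p (proj M N n x) := by
    intro x
    induction x using hom_induction with
    | hadd x y hx hy => rw [map_add]; exact hadd _ _ hx hy
    | hmem i j x y hx hy =>
      rw [proj_tmul hx hy]
      split_ifs with h
      · exact hmem i j x y hx hy h
      · exact h0
  have := h x
  rwa [proj_of_mem M N n x hx, if_pos rfl] at this

lemma smul_mem {p i : ℕ} {a : A.carrier} {x : TensorCarrier M N} (ha : a ∈ A.gr p)
    (hx : x ∈ gr M N i) : a • x ∈ gr M N (p + i) := by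
  refine gr_induction (fun r s x y hx hy h => ?_) (fun x y hx hy => ?_) x hx
  · exact tmul_mem (M.smul_mem ha hx) hy (by omega)
  · rw [smul_add]; exact add_mem hx hy

/-- The differential `m ⊗ n ↦ d m ⊗ n + (-1) ^ |m| m ⊗ d n` of `M ⊗ N`. -/
def preD : M.carrier ⊗[O] N.carrier →ₗ[DiffOp k O] M.carrier ⊗[O] N.carrier :=
  DTensor.map M.d LinearMap.id + DTensor.map (gsign M.isInternal) N.d

lemma mk_preD_tmul {i : ℕ} {x : M.carrier} (hx : x ∈ M.gr i) (y : N.carrier) :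
    mk M N (preD (x ⊗ₜ[O] y)) = tmul (M.d x) y + (-1 : ℤ) ^ i • tmul x (N.d y) := by
  rw [preD, LinearMap.add_apply, DTensor.map_tmul, DTensor.map_tmul, gsign_of_mem _ hx, map_add,
    ← zsmul_tmul]
  rfl

/-- The differential of `M ⊗_A N`. -/
def d : TensorCarrier M N →ₗ[DiffOp k O] TensorCarrier M N :=
  desc (mk M N ∘ₗ preD) (fun p i j a x y ha hx hy => by
    rw [LinearMap.comp_apply, LinearMap.comp_apply, mk_preD_tmul (M.smul_mem ha hx),
      mk_preD_tmul hx, M.d_smul ha, N.d_smul ha, add_tmul, tmul_add, zsmul_tmul, tmul_zsmul]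
    have h1 : (-1 : ℤ) ^ (p * i) • tmul (A.d a • x) y = (-1 : ℤ) ^ i • tmul x (A.d a • y) := by
      cases p with
      | zero => rw [A.d_zero ha, zero_smul, zero_smul, zero_tmul, tmul_zero, smul_zero, smul_zero]
      | succ p =>
        rw [← smul_tmul (A.d_mem ha) hx hy, smul_smul, ← pow_add]
        congr 2
        ring
    have h2 : ((-1 : ℤ) ^ (p * i) * (-1 : ℤ) ^ p) • tmul (a • M.d x) y =
        tmul (M.d x) (a • y) := by
      cases i with
      | zero => rw [M.d_zero hx, smul_zero, zero_tmul, zero_tmul, smul_zero]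
      | succ i =>
        rw [← smul_tmul ha (M.d_mem hx) hy, ← pow_add]
        congr 1
        rw [mul_add, mul_one, add_assoc, ← two_mul, pow_add, pow_mul _ 2, neg_one_sq, one_pow,
          mul_one]
    have h3 : (-1 : ℤ) ^ (p * i) • tmul (a • x) (N.d y) = tmul x (a • N.d y) := by
      cases j with
      | zero => rw [N.d_zero hy, smul_zero, tmul_zero, tmul_zero, smul_zero]
      | succ j => rw [smul_tmul ha hx (N.d_mem hy)]
    rw [smul_add, smul_add, smul_smul, smul_smul, smul_add, h1, h2, mul_comm, mul_smul, h3,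
      smul_smul, pow_add, mul_comm ((-1 : ℤ) ^ p)]
    abel)

lemma d_tmul {i : ℕ} {x : M.carrier} (hx : x ∈ M.gr i) (y : N.carrier) :
    d (tmul x y) = tmul (M.d x) y + (-1 : ℤ) ^ i • tmul x (N.d y) :=
  mk_preD_tmul hx y

lemma d_mem {i : ℕ} {x : TensorCarrier M N} (hx : x ∈ gr M N (i + 1)) : d x ∈ gr M N i := by
  refine gr_induction (fun r s x y hx hy h => ?_) (fun x y hx hy => ?_) x hx
  · rw [d_tmul hx]
    refine add_mem ?_ (zsmul_mem ?_ _)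
    · cases r with
      | zero => rw [M.d_zero hx, zero_tmul]; exact zero_mem _
      | succ r => exact tmul_mem (M.d_mem hx) hy (by omega)
    · cases s with
      | zero => rw [N.d_zero hy, tmul_zero]; exact zero_mem _
      | succ s => exact tmul_mem hx (N.d_mem hy) (by omega)
  · rw [map_add]; exact add_mem hx hy

lemma d_zero {x : TensorCarrier M N} (hx : x ∈ gr M N 0) : d x = 0 := by
  refine gr_induction (fun r s x y hx hy h => ?_) (fun x y hx hy => ?_) x hx
  · obtain rfl : r = 0 := by omega
    obtain rfl : s = 0 := by omega
    rw [d_tmul hx, M.d_zero hx, N.d_zero hy, zero_tmul, tmul_zero, smul_zero, add_zero]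
  · rw [map_add, hx, hy, add_zero]

lemma d_d (x : TensorCarrier M N) : d (d x) = 0 := by
  induction x using hom_induction with
  | hadd x y hx hy => rw [map_add, map_add, hx, hy, add_zero]
  | hmem i j x y hx hy =>
    rw [d_tmul hx, map_add, map_zsmul, d_tmul hx, N.d_d, tmul_zero, smul_zero, add_zero]
    cases i with
    | zero =>
      rw [M.d_zero hx, zero_tmul, zero_tmul, map_zero, smul_zero, add_zero]
    | succ i =>
      rw [d_tmul (M.d_mem hx), M.d_d, zero_tmul, zero_add, ← add_smul, pow_succ]
      simp

lemma d_smul {p : ℕ} {a : A.carrier} (ha : a ∈ A.gr p) (x : TensorCarrier M N) :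
    d (a • x) = A.d a • x + (-1 : ℤ) ^ p • (a • d x) := by
  induction x using hom_induction with
  | hadd x y hx hy => simp only [map_add, smul_add, hx, hy]; abel
  | hmem i j x y hx hy =>
    rw [smul_tmul', d_tmul (M.smul_mem ha hx), M.d_smul ha, add_tmul, zsmul_tmul, d_tmul hx,
      smul_add, smul_comm a ((-1 : ℤ) ^ i), smul_tmul', smul_tmul', smul_tmul', smul_add,
      smul_smul, pow_add]
    abel

lemma der_smul (θ : Derivation k O O) (a : A.carrier) (x : TensorCarrier M N) :
    DiffOp.ofDer θ • (a • x) = (DiffOp.ofDer θ • a) • x + a • (DiffOp.ofDer θ • x) := by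
  induction x using hom_induction with
  | hadd x y hx hy => simp only [smul_add, hx, hy]; abel
  | hmem i j x y hx hy =>
    simp only [smul_tmul', ofDer_smul_tmul, M.der_smul, add_tmul, smul_add]
    abel

end TensorCarrier

/-- The tensor product `M ⊗_A N` of two `A`-modules. -/
def tensorObj : DGMod A where
  carrier := TensorCarrier M N
  gr := TensorCarrier.gr M N
  isInternal := TensorCarrier.isInternal M N
  smul_mem := TensorCarrier.smul_mem
  der_smul := TensorCarrier.der_smul
  d := TensorCarrier.d
  d_mem := TensorCarrier.d_mem
  d_zero := TensorCarrier.d_zero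
  d_d := TensorCarrier.d_d
  d_smul := TensorCarrier.d_smul

variable {M N} {M' N' : DGMod A}

/-- The underlying `𝒟`-linear map of the tensor product `f ⊗_A g` of two morphisms. -/
def tensorMapLin (f : M ⟶ M') (g : N ⟶ N') : TensorCarrier M N →ₗ[DiffOp k O] TensorCarrier M' N' :=
  TensorCarrier.desc (TensorCarrier.mk M' N' ∘ₗ DTensor.map (Hom.lin f) (Hom.lin g))
    (fun p i j a m n ha hm hn => by
      simp only [LinearMap.comp_apply, DTensor.map_tmul, Hom.map_smul]
      exact TensorCarrier.smul_tmul ha (Hom.map_mem f hm) (Hom.map_mem g hn))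

open TensorCarrier in
@[simp] lemma tensorMapLin_tmul (f : M ⟶ M') (g : N ⟶ N') (m : M.carrier) (n : N.carrier) :
    tensorMapLin f g (tmul m n) = tmul (Hom.lin f m) (Hom.lin g n) := rfl

open TensorCarrier in
lemma tensorMapLin_smul (f : M ⟶ M') (g : N ⟶ N') (a : A.carrier) (x : TensorCarrier M N) :
    tensorMapLin f g (a • x) = a • tensorMapLin f g x := by
  induction x using hom_induction with
  | hadd x y hx hy => simp only [smul_add, map_add, hx, hy]
  | hmem i j x y hx hy =>
    rw [TensorCarrier.smul_tmul', tensorMapLin_tmul, tensorMapLin_tmul, TensorCarrier.smul_tmul',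
      Hom.map_smul]

open TensorCarrier in
lemma tensorMapLin_mem (f : M ⟶ M') (g : N ⟶ N') {i : ℕ} {x : TensorCarrier M N}
    (hx : x ∈ TensorCarrier.gr M N i) : tensorMapLin f g x ∈ TensorCarrier.gr M' N' i := by
  refine gr_induction (fun r s x y hx hy h => ?_) (fun x y hx hy => ?_) x hx
  · exact tmul_mem (Hom.map_mem f hx) (Hom.map_mem g hy) h
  · rw [map_add]; exact add_mem hx hy

open TensorCarrier in
lemma tensorMapLin_d (f : M ⟶ M') (g : N ⟶ N') (x : TensorCarrier M N) :
    tensorMapLin f g (TensorCarrier.d x) = TensorCarrier.d (tensorMapLin f g x) := by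
  induction x using hom_induction with
  | hadd x y hx hy => simp only [map_add, hx, hy]
  | hmem i j x y hx hy =>
    rw [d_tmul hx, map_add, map_zsmul, tensorMapLin_tmul, tensorMapLin_tmul, tensorMapLin_tmul,
      d_tmul (Hom.map_mem f hx), Hom.map_d, Hom.map_d]

/-- The tensor product `f ⊗_A g` of two morphisms, `m ⊗ n ↦ f m ⊗ g n`. -/
def tensorMap (f : M ⟶ M') (g : N ⟶ N') : tensorObj M N ⟶ tensorObj M' N' where
  lin := tensorMapLin f g
  map_smul := tensorMapLin_smul f g
  map_mem := tensorMapLin_mem f g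
  map_d := tensorMapLin_d f g

variable (A) in
open TensorCarrier in
/-- The tensor product over `A`, as a functor in two variables. -/
def tensor : DGMod A × DGMod A ⥤ DGMod A where
  obj X := tensorObj X.1 X.2
  map f := tensorMap f.1 f.2
  map_id X := by
    ext x
    change tensorMapLin (𝟙 X.1) (𝟙 X.2) x = x
    induction x using hom_induction with
    | hadd x y hx hy => rw [map_add, hx, hy]
    | hmem i j x y hx hy => rfl
  map_comp f g := by
    ext x
    change tensorMapLin (f.1 ≫ g.1) (f.2 ≫ g.2) x =
      tensorMapLin g.1 g.2 (tensorMapLin f.1 f.2 x)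
    induction x using hom_induction with
    | hadd x y hx hy => rw [map_add, map_add, map_add, hx, hy]
    | hmem i j x y hx hy => rfl

end Tensor

/-! ### Homology and the model structure -/

section Model

/-- The cycles of degree `n`. -/
def cycles (M : DGMod A) (n : ℕ) : Submodule (DiffOp k O) M.carrier :=
  LinearMap.ker M.d ⊓ M.gr n

/-- The boundaries of degree `n`. -/
def boundaries (M : DGMod A) (n : ℕ) : Submodule (DiffOp k O) M.carrier :=
  (M.gr (n + 1)).map M.d

/-- The homology `𝒟`-module `H_n(M)`. -/
abbrev homology (M : DGMod A) (n : ℕ) : Type u :=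
  M.cycles n ⧸ (M.boundaries n).submoduleOf (M.cycles n)

/-- The map induced on cycles by a morphism. -/
def cyclesMap {M N : DGMod A} (f : M ⟶ N) (n : ℕ) : M.cycles n →ₗ[DiffOp k O] N.cycles n :=
  (Hom.lin f).restrict fun m hm => ⟨by
    change N.d (Hom.lin f m) = 0
    rw [← Hom.map_d, LinearMap.mem_ker.1 hm.1, map_zero],
    Hom.map_mem f hm.2⟩

/-- The map induced in homology by a morphism. -/
def homologyMap {M N : DGMod A} (f : M ⟶ N) (n : ℕ) : M.homology n →ₗ[DiffOp k O] N.homology n :=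
  Submodule.mapQ _ _ (cyclesMap f n) (by
    rintro ⟨m, hm⟩ ⟨x, hx, rfl⟩
    exact ⟨Hom.lin f x, Hom.map_mem f hx, (Hom.map_d f x).symm⟩)

variable (A)

/-- The weak equivalences of `Mod(A)` are the quasi-isomorphisms. -/
def weakEquivalences : MorphismProperty (DGMod A) :=
  fun _ _ f => ∀ n, Function.Bijective (homologyMap f n)

/-- The fibrations of `Mod(A)` are the morphisms that are surjective in all degrees `n > 0`. -/
def fibrations : MorphismProperty (DGMod A) :=
  fun M N f => ∀ n, 0 < n → ∀ y ∈ N.gr n, ∃ x ∈ M.gr n, Hom.lin f x = y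

/-- The trivial fibrations of `Mod(A)`. -/
def trivialFibrations : MorphismProperty (DGMod A) :=
  fibrations A ⊓ weakEquivalences A

/-- The cofibrations of `Mod(A)` are the morphisms that have the left lifting property with
respect to all trivial fibrations. -/
def cofibrations : MorphismProperty (DGMod A) := (trivialFibrations A).llp

variable {A}

/-- `M` is cofibrant if the morphism from the initial object to `M` is a cofibration. -/
def IsCofibrant (M : DGMod A) : Prop := cofibrations A (Limits.initial.to M)

/-- `M ≈ N`: there is a zigzag of weak equivalences between `M` and `N`. -/
def WeakZigzag : DGMod A → DGMod A → Prop :=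
  Relation.EqvGen fun M N => ∃ f : M ⟶ N, weakEquivalences A f

/-- A local cofibrant replacement: an objectwise choice of a cofibrant object `C M` together with a
weak equivalence `c_M : C M → M`. -/
structure LocalCofibrantReplacement (A : DGAlg k O) where
  /-- the replacement of an object -/
  obj : DGMod A → DGMod A
  /-- the weak equivalence to the object -/
  map (M : DGMod A) : obj M ⟶ M
  isCofibrant (M : DGMod A) : (obj M).IsCofibrant
  weakEquivalence (M : DGMod A) : weakEquivalences A (map M)

/-- A local cofibrant F-replacement: a local cofibrant replacement for which every `c_M` is
a (trivial) fibration and `c_M` is the identity of `M` whenever `M` is cofibrant. -/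
structure LocalCofibrantFReplacement (A : DGAlg k O) extends LocalCofibrantReplacement A where
  fibration (M : DGMod A) : fibrations A (map M)
  obj_eq (M : DGMod A) : M.IsCofibrant → obj M = M
  map_eq (M : DGMod A) (h : M.IsCofibrant) : map M = eqToHom (obj_eq M h)

/-- A functorial factorization of all morphisms of `Mod(A)` into a cofibration followed by a
trivial fibration. -/
abbrev CofTrivFibFactorization (A : DGAlg k O) :=
  MorphismProperty.FunctorialFactorizationData (cofibrations A) (trivialFibrations A)

namespace CofTrivFibFactorization

variable (F : CofTrivFibFactorization A)

/-- The functor that sends `M` to the morphism `0 → M` from the initial object. -/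
def fromInitial (A : DGAlg k O) : DGMod A ⥤ Arrow (DGMod A) where
  obj M := Arrow.mk (Limits.initial.to M)
  map f := Arrow.homMk (𝟙 _) f (by simp)

/-- The cofibrant F-replacement functor `Q`, which sends `M` to the middle object of the
factorization of `0 → M`. -/
def Q : DGMod A ⥤ DGMod A := fromInitial A ⋙ F.Z

/-- The natural trivial fibration `q : Q ⟹ id`. -/
def q : F.Q ⟶ 𝟭 (DGMod A) where
  app M := F.p.app ((fromInitial A).obj M)
  naturality _ _ f := F.p.naturality ((fromInitial A).map f)

end CofTrivFibFactorization

variable (A)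

/-- The homotopy category `Ho(Mod(A))`: the strict localization at the weak equivalences. -/
abbrev Ho : Type _ := (weakEquivalences A).Localization

/-- The localization functor `L : Mod(A) ⥤ Ho(Mod(A))`. -/
abbrev L : DGMod A ⥤ Ho A := (weakEquivalences A).Q

/-- The weak equivalences of `Mod(A) × Mod(A)`: pairs of weak equivalences. -/
abbrev weakEquivalences₂ : MorphismProperty (DGMod A × DGMod A) :=
  (weakEquivalences A).prod (weakEquivalences A)

/-- The homotopy category `Ho(Mod(A) × Mod(A))`. -/
abbrev Ho₂ : Type _ := (weakEquivalences₂ A).Localization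

/-- The localization functor of `Mod(A) × Mod(A)`. -/
abbrev L₂ : DGMod A × DGMod A ⥤ Ho₂ A := (weakEquivalences₂ A).Q

variable {A}

/-- The unique factorization `Ho(G) : Ho(Mod(A) × Mod(A)) ⥤ Ho(Mod(A))` through the localization
functor of a functor `G` that inverts weak equivalences; it satisfies `L₂ ⋙ Ho(G) = G`. -/
abbrev HoLift (G : DGMod A × DGMod A ⥤ Ho A) (hG : (weakEquivalences₂ A).IsInvertedBy G) :
    Ho₂ A ⥤ Ho A :=
  Localization.Construction.lift G hG

variable [CharZero k] [Algebra.Smooth k O]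

/-- The functor `L ∘ (F₁ - ⊗_A F₂ -)`. -/
abbrev tensorL (F₁ F₂ : DGMod A ⥤ DGMod A) : DGMod A × DGMod A ⥤ Ho A :=
  F₁.prod F₂ ⋙ tensor A ⋙ L A

/-- The composite `L ⋆ ⊗_A ⋆ (α × β)`, where `⋆` denotes whiskering. -/
abbrev tensorLMap {F₁ F₂ G₁ G₂ : DGMod A ⥤ DGMod A} (α : F₁ ⟶ G₁) (β : F₂ ⟶ G₂) :
    tensorL F₁ F₂ ⟶ tensorL (A := A) G₁ G₂ :=
  Functor.whiskerRight (NatTrans.prod α β) (tensor A ⋙ L A)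

end Model

end DGMod

end DG

end DGeom

end

/-!
The heart of the matter is that a cofibrant module `P` is flat in the derived sense: tensoring with
`P` preserves quasi-isomorphisms. Everything else follows formally, by two-out-of-three arguments
and the universal property of the strict localization.

The flatness is proved directly from the lifting property of `P`, without a description of the
cofibrations as retracts of cellular maps. The cone of a quasi-isomorphism `f` is acyclic, and
`cone f ⊗ P` is the cone of `f ⊗ P`
(`DGeom.DGMod.weakEquivalences_tensorMap_of_acyclic_cone`), so it suffices to show that `K ⊗_A P` is
acyclic if `K` is acyclic and `P` is cofibrant (`DGeom.DGMod.Acyclic.tensor_cofibrant`). Functionals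
on `(K ⊗_A P)_n` that vanish on boundaries, with values in the injective cogenerator `ℚ / ℤ` of
abelian groups, correspond to morphisms from `P` to a dual module `dual K n`, which consists of the
functionals on `K ⊗_A F` for the free module `F = A ⊗_O 𝒟` (`DGeom.DGMod.curry`,
`DGeom.DGMod.uncurry`). Two facts about the dual make it useful.

* If `K` is acyclic, so is `dual K n`. Indeed `K ⊗_A F ≅ K ⊗_O 𝒟` is acyclic because `𝒟` is flat
  over `O`: it is the union of its submodules of operators of bounded order, which are projective
  by an Euler identity (`DGeom.DiffOp.projective_orderLT`). The functor of functionals is exact.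
* Functionals extend from `K` to the cone of `𝟙 K`, hence `dual (cone (𝟙 K)) n ⟶ dual K n` is
  a fibration, and if `K` is acyclic it is a trivial fibration between acyclic modules.

Suppose now that a cycle `z` of `K ⊗_A P` is not a boundary. Some functional `χ` vanishes on
boundaries but not at `z`. As `P` is cofibrant, the corresponding morphism `P ⟶ dual K n` lifts to
`dual (cone (𝟙 K)) n`, which means that `χ` extends to a functional on `cone (𝟙 K) ⊗_A P` that
vanishes on boundaries. But `cone (𝟙 K) ⊗_A P` is contractible, so the image of `z` in it is
a boundary and `χ z = 0`, a contradiction.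
-/

noncomputable section

namespace DGeom

/-! ### Flatness of the ring of differential operators -/

namespace DiffOp

variable (k : Type v) (O : Type u) [Field k] [CommRing O] [Algebra k O]

/-- The left `O`-module of differential operators of order `< n`. -/
def orderLT (n : ℕ) : Submodule O (DiffOp k O) where
  carrier := {P | LT k O n P}
  zero_mem' := by
    change IsDiffOpLT k n (toEnd k O 0)
    rw [map_zero]
    exact IsDiffOpLT.zero n
  add_mem' {P Q} hP hQ := by
    change IsDiffOpLT k n (toEnd k O (P + Q))
    rw [map_add]
    exact IsDiffOpLT.add hP hQ
  smul_mem' f P hP := IsDiffOpLT.mulEnd_mul (P := toEnd k O P) hP f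

variable {k O}

lemma mem_orderLT {n : ℕ} {P : DiffOp k O} : P ∈ orderLT k O n ↔ LT k O n P := Iff.rfl

lemma mul_ofFun_mem_orderLT {n : ℕ} {P : DiffOp k O} (hP : P ∈ orderLT k O n) (g : O) :
    P * ofFun k O g ∈ orderLT k O n := by
  induction n generalizing P with
  | zero =>
    rw [mem_orderLT, lt_zero] at hP
    rw [hP, zero_mul]
    exact zero_mem _
  | succ n ih =>
    refine lt_succ fun f => ?_
    rw [comm_mul_ofFun]
    exact ih (LT.comm hP f)

lemma mul_ofDer_mem_orderLT {n : ℕ} {P : DiffOp k O} (hP : P ∈ orderLT k O n)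
    (θ : Derivation k O O) : P * ofDer θ ∈ orderLT k O (n + 1) := by
  induction n generalizing P with
  | zero =>
    rw [mem_orderLT, lt_zero] at hP
    rw [hP, zero_mul]
    exact zero_mem _
  | succ n ih =>
    refine lt_succ fun f => ?_
    have h1 : comm (P * ofDer θ) f = comm P f * ofDer θ + P * ofFun k O (θ f) := by
      simp only [comm, sub_mul, mul_assoc, ofDer_mul_ofFun, mul_add]
      abel
    rw [h1]
    exact (orderLT k O (n + 1)).add_mem (ih (LT.comm hP f)) (mul_ofFun_mem_orderLT hP _)

variable [CharZero k] [Algebra.Smooth k O]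

/-- By the Euler identity, `P ↦ (([P, xᵢ])ᵢ, ∑ᵢ [P, xᵢ] ∂ᵢ - n P)` embeds the operators of order
`< n + 1` as a direct summand into a finite sum of copies of the operators of order `< n`. -/
lemma projective_orderLT (n : ℕ) : Module.Projective O (orderLT k O n) := by
  induction n with
  | zero =>
    have : Subsingleton (orderLT k O 0) :=
      ⟨fun P Q => Subtype.ext ((lt_zero.1 P.2).trans (lt_zero.1 Q.2).symm)⟩
    infer_instance
  | succ n ih =>
    cases n with
    | zero =>
      let i : orderLT k O 1 →ₗ[O] O := ev k 1 ∘ₗ (orderLT k O 1).subtype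
      let r : O →ₗ[O] orderLT k O 1 :=
        LinearMap.toSpanSingleton O _ ⟨1, by
          have h := IsDiffOpLT.mulEnd (k := k) (1 : O)
          have h1 : mulEnd k O 1 = toEnd k O 1 := by
            ext x
            simp
          rw [h1] at h
          exact h⟩
      refine Module.Projective.of_split i r (LinearMap.ext fun P => Subtype.ext ?_)
      have h := lt_one P.2
      conv_rhs => rw [LinearMap.id_apply, h]
      simp [i, r, ev, smul_def]
    | succ n =>
      obtain ⟨s, D, hs⟩ := exists_dualBasis k O
      let K : Submodule O (DiffOp k O) := orderLT k O (n + 1)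
      let E : DiffOp k O →ₗ[O] DiffOp k O :=
        (∑ i ∈ s, mulRightₗ (ofDer (D i)) ∘ₗ commₗ k i) - ((n + 1 : ℕ) : O) • LinearMap.id
      have hE : ∀ P ∈ orderLT k O (n + 1 + 1), E P ∈ K := fun P hP => by
        convert euler hs (n + 1) P hP using 1
        simp only [E, LinearMap.sub_apply, LinearMap.sum_apply, LinearMap.smul_apply,
          LinearMap.id_apply, Nat.cast_smul_eq_nsmul]
        rfl
      have hcomm : ∀ (x : O), ∀ P ∈ orderLT k O (n + 1 + 1), commₗ k x P ∈ K :=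
        fun x P hP => LT.comm hP x
      let i₁ : orderLT k O (n + 1 + 1) →ₗ[O] (s → K) :=
        LinearMap.pi fun x => (commₗ k x.1).restrict (hcomm x.1)
      let i₂ : orderLT k O (n + 1 + 1) →ₗ[O] K := E.restrict hE
      let i : orderLT k O (n + 1 + 1) →ₗ[O] (s → K) × K := i₁.prod i₂
      have hc : ((n + 1 : ℕ) : k) ≠ 0 := by exact_mod_cast Nat.succ_ne_zero n
      let c : O := algebraMap k O ((n + 1 : ℕ) : k)⁻¹
      have hc' : c * ((n + 1 : ℕ) : O) = 1 := by
        simp only [c]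
        rw [← map_natCast (algebraMap k O), ← map_mul, inv_mul_cancel₀ hc, map_one]
      have hmul : ∀ (x : O), ∀ P ∈ K, mulRightₗ (ofDer (D x)) P ∈ orderLT k O (n + 1 + 1) :=
        fun x P hP => mul_ofDer_mem_orderLT hP _
      let r₁ : (s → K) →ₗ[O] orderLT k O (n + 1 + 1) := ∑ x : s,
        (mulRightₗ (ofDer (D x.1))).restrict (hmul x.1) ∘ₗ LinearMap.proj x
      let r₂ : K →ₗ[O] orderLT k O (n + 1 + 1) :=
        Submodule.inclusion fun P hP => IsDiffOpLT.succ hP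
      let r : (s → K) × K →ₗ[O] orderLT k O (n + 1 + 1) := c • (r₁.coprod (-r₂))
      classical
      have : Module.Projective O (s → K) :=
        .of_equiv' (DFinsupp.linearEquivFunOnFintype (R := O) (ι := s) (M := fun _ => K))
      refine Module.Projective.of_split i r (LinearMap.ext fun P => Subtype.ext ?_)
      have h1 : ((r₁ (i P).1 : orderLT k O (n + 1 + 1)) : DiffOp k O) =
          ∑ x ∈ s, mulRightₗ (ofDer (D x)) (commₗ k x P.1) := by
        simp only [r₁, LinearMap.sum_apply, Submodule.coe_sum]
        rw [← Finset.sum_coe_sort s]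
        rfl
      have h2 : ((r (i P) : orderLT k O (n + 1 + 1)) : DiffOp k O) =
          c • ((r₁ (i P).1 : DiffOp k O) + -(E P.1)) := rfl
      rw [LinearMap.comp_apply, h2, h1]
      simp only [E, LinearMap.sub_apply, LinearMap.sum_apply, LinearMap.comp_apply,
        LinearMap.smul_apply, LinearMap.id_apply, neg_sub, add_sub_cancel]
      rw [← mul_smul, hc', one_smul]

/-- `𝒟` is the increasing union of the projective modules of operators of order `< n`. -/
instance flat : Module.Flat O (DiffOp k O) := by
  refine Module.Flat.of_forall_isTrivialRelation fun {l f x} hfx => ?_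
  choose n hn using fun i => exists_order (x i)
  let N := Finset.univ.sup n
  have hN : ∀ i, x i ∈ orderLT k O N := fun i =>
    IsDiffOpLT.mono (Finset.le_sup (Finset.mem_univ i)) (hn i)
  have := projective_orderLT (k := k) (O := O) N
  obtain ⟨m, a, y, h1, h2⟩ := Module.Flat.isTrivialRelation_of_sum_smul_eq_zero
    (f := f) (x := fun i => (⟨x i, hN i⟩ : orderLT k O N)) (Subtype.ext (by simpa using hfx))
  refine ⟨m, a, fun j => y j, fun i => ?_, h2⟩
  simpa using congrArg Subtype.val (h1 i)

end DiffOp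

/-! ### Homogeneous components -/

section Grading

variable {R : Type*} {X : Type*} [Ring R] [AddCommGroup X] [Module R X] {G : ℕ → Submodule R X}

lemma gproj_mem (h : DirectSum.IsInternal G) (n : ℕ) (x : X) : gproj h n x ∈ G n :=
  Subtype.property _

lemma gproj_self (h : DirectSum.IsInternal G) {n : ℕ} {x : X} (hx : x ∈ G n) :
    gproj h n x = x := by
  rw [gproj_of_mem h hx, if_pos rfl]

lemma mem_of_gproj_mem (h : DirectSum.IsInternal G) {S : Submodule R X} {x : X}
    (hx : ∀ n, gproj h n x ∈ S) : x ∈ S := by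
  classical
  have h1 : x = DirectSum.coeLinearMap G (decompose h x) :=
    ((LinearEquiv.ofBijective (DirectSum.coeLinearMap G) h).apply_symm_apply x).symm
  rw [h1, DirectSum.coeLinearMap_eq_dfinsuppSum, DFinsupp.sum]
  exact Submodule.sum_mem _ fun n _ => hx n

/-- Linear maps, or merely additive maps, that agree on homogeneous elements are equal. -/
lemma eq_of_eq_on_gr (h : DirectSum.IsInternal G) {Y F : Type*} [AddCommGroup Y]
    [FunLike F X Y] [AddMonoidHomClass F X Y] {f g : F}
    (hfg : ∀ i, ∀ x ∈ G i, f x = g x) (x : X) : f x = g x :=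
  grading_induction h (p := fun x => f x = g x) hfg
    (fun x y hx hy => by rw [map_add, map_add, hx, hy]) x

/-- A linear map of degree `0` commutes with the projections onto the components. -/
lemma gproj_comm {X' : Type*} [AddCommGroup X'] [Module R X'] {G' : ℕ → Submodule R X'}
    (h : DirectSum.IsInternal G) (h' : DirectSum.IsInternal G') (f : X →ₗ[R] X')
    (hf : ∀ i, ∀ x ∈ G i, f x ∈ G' i) (n : ℕ) (x : X) : gproj h' n (f x) = f (gproj h n x) := by
  refine eq_of_eq_on_gr h (f := gproj h' n ∘ₗ f) (g := f ∘ₗ gproj h n) (fun i x hx => ?_) x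
  rw [LinearMap.comp_apply, LinearMap.comp_apply, gproj_of_mem h hx, gproj_of_mem h' (hf i x hx)]
  split_ifs <;> simp

end Grading

namespace DGMod

variable {k : Type v} {O : Type u} [Field k] [CommRing O] [Algebra k O] {A : DGAlg k O}

/-! ### Quasi-isomorphisms without reference to degrees -/

lemma gproj_d (M : DGMod A) (n : ℕ) (x : M.carrier) :
    gproj M.isInternal n (M.d x) = M.d (gproj M.isInternal (n + 1) x) := by
  refine eq_of_eq_on_gr M.isInternal (f := gproj M.isInternal n ∘ₗ M.d)
    (g := M.d ∘ₗ gproj M.isInternal (n + 1)) (fun i x hx => ?_) x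
  rw [LinearMap.comp_apply, LinearMap.comp_apply, gproj_of_mem _ hx]
  cases i with
  | zero => simp [M.d_zero hx]
  | succ i =>
    rw [gproj_of_mem _ (M.d_mem hx)]
    simp only [add_left_inj]
    split_ifs <;> simp

lemma gproj_lin {M N : DGMod A} (f : M ⟶ N) (n : ℕ) (x : M.carrier) :
    gproj N.isInternal n (Hom.lin f x) = Hom.lin f (gproj M.isInternal n x) :=
  gproj_comm M.isInternal N.isInternal (Hom.lin f) (fun _ _ hx => Hom.map_mem f hx) n x

/-- `M` is acyclic: every cycle is a boundary. Degrees need not be mentioned, since the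
homogeneous components of a cycle are cycles. -/
def Acyclic (M : DGMod A) : Prop := ∀ x, M.d x = 0 → ∃ y, M.d y = x

lemma d_gproj_eq_zero {M : DGMod A} {x : M.carrier} (hx : M.d x = 0) (n : ℕ) :
    M.d (gproj M.isInternal n x) = 0 := by
  cases n with
  | zero => exact M.d_zero (gproj_mem _ _ _)
  | succ n => rw [← gproj_d, hx, map_zero]

/-- To prove acyclicity it suffices to consider homogeneous cycles. -/
lemma acyclic_of_homogeneous {M : DGMod A}
    (h : ∀ n, ∀ x ∈ M.gr n, M.d x = 0 → ∃ y, M.d y = x) : M.Acyclic := fun _ hx =>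
  mem_of_gproj_mem M.isInternal (S := LinearMap.range M.d) fun n =>
    h n _ (gproj_mem _ _ _) (d_gproj_eq_zero hx n)

variable {M N P : DGMod A}

lemma homologyMap_injective_iff (f : M ⟶ N) (n : ℕ) : Function.Injective (homologyMap f n) ↔
    ∀ x ∈ M.gr n, M.d x = 0 → Hom.lin f x ∈ N.boundaries n → x ∈ M.boundaries n := by
  rw [injective_iff_map_eq_zero]
  constructor
  · intro h x hx hd hb
    exact (Submodule.Quotient.mk_eq_zero ((M.boundaries n).submoduleOf (M.cycles n))).1
      (h (Submodule.Quotient.mk ⟨x, hd, hx⟩) ((Submodule.Quotient.mk_eq_zero _).2 hb))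
  · intro h x hx
    obtain ⟨⟨x, hd, hm⟩, rfl⟩ := Submodule.Quotient.mk_surjective _ x
    exact (Submodule.Quotient.mk_eq_zero _).2
      (h x hm hd
        ((Submodule.Quotient.mk_eq_zero ((N.boundaries n).submoduleOf (N.cycles n))).1 hx))

lemma homologyMap_surjective_iff (f : M ⟶ N) (n : ℕ) : Function.Surjective (homologyMap f n) ↔
    ∀ y ∈ N.gr n, N.d y = 0 → ∃ x ∈ M.gr n, M.d x = 0 ∧ Hom.lin f x - y ∈ N.boundaries n := by
  constructor
  · intro h y hy hd
    obtain ⟨x, hx⟩ := h (Submodule.Quotient.mk ⟨y, hd, hy⟩)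
    obtain ⟨⟨x, hd, hm⟩, rfl⟩ := Submodule.Quotient.mk_surjective _ x
    exact ⟨x, hm, hd, (Submodule.Quotient.eq ((N.boundaries n).submoduleOf (N.cycles n))).1 hx⟩
  · intro h y
    obtain ⟨⟨y, hd, hm⟩, rfl⟩ := Submodule.Quotient.mk_surjective _ y
    obtain ⟨x, hx, hxd, hb⟩ := h y hm hd
    exact ⟨Submodule.Quotient.mk ⟨x, hxd, hx⟩, (Submodule.Quotient.eq _).2 hb⟩

/-- `f` is a quasi-isomorphism if and only if, without reference to degrees, it is injective and
surjective on classes of cycles modulo boundaries. -/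
lemma weakEquivalences_iff (f : M ⟶ N) : weakEquivalences A f ↔
    (∀ x, M.d x = 0 → (∃ y, N.d y = Hom.lin f x) → ∃ x', M.d x' = x) ∧
      ∀ y, N.d y = 0 → ∃ x y', M.d x = 0 ∧ y = Hom.lin f x + N.d y' := by
  constructor
  · intro h
    constructor
    · rintro x hx ⟨y, hy⟩
      refine mem_of_gproj_mem M.isInternal (S := LinearMap.range M.d) fun n => ?_
      obtain ⟨x', -, hx'⟩ := (homologyMap_injective_iff f n).1 (h n).1 _
        (gproj_mem M.isInternal n x) (d_gproj_eq_zero hx n)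
        ⟨_, gproj_mem N.isInternal (n + 1) y, by rw [← gproj_d, hy, gproj_lin]⟩
      exact ⟨x', hx'⟩
    · intro y hy
      have h1 : y ∈ (LinearMap.ker M.d).map (Hom.lin f) ⊔ LinearMap.range N.d := by
        refine mem_of_gproj_mem N.isInternal fun n => ?_
        obtain ⟨x, -, hd, y', -, hy'⟩ := (homologyMap_surjective_iff f n).1 (h n).2 _
          (gproj_mem N.isInternal n y) (d_gproj_eq_zero hy n)
        rw [← sub_sub_self (Hom.lin f x) (gproj N.isInternal n y), ← hy']
        exact sub_mem (Submodule.mem_sup_left ⟨x, hd, rfl⟩) (Submodule.mem_sup_right ⟨y', rfl⟩)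
      obtain ⟨_, ⟨x, hx, rfl⟩, _, ⟨y', rfl⟩, h2⟩ := Submodule.mem_sup.1 h1
      exact ⟨x, y', hx, h2.symm⟩
  · rintro ⟨h1, h2⟩ n
    constructor
    · refine (homologyMap_injective_iff f n).2 ?_
      rintro x hx hd ⟨y, -, hy⟩
      obtain ⟨x', rfl⟩ := h1 x hd ⟨y, hy⟩
      exact ⟨_, gproj_mem M.isInternal (n + 1) x', by rw [← gproj_d, gproj_self _ hx]⟩
    · refine (homologyMap_surjective_iff f n).2 fun y hy hd => ?_
      obtain ⟨x, y', hx, h3⟩ := h2 y hd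
      refine ⟨_, gproj_mem M.isInternal n x, d_gproj_eq_zero hx n, _,
        gproj_mem N.isInternal (n + 1) (-y'), ?_⟩
      have h4 := gproj_self N.isInternal hy
      nth_rw 1 [h3] at h4
      rw [← gproj_d, ← gproj_lin, map_neg, map_neg, ← h4, map_add]
      abel

lemma homologyMap_id (n : ℕ) : homologyMap (𝟙 M) n = LinearMap.id := by
  refine LinearMap.ext fun x => ?_
  obtain ⟨x, rfl⟩ := Submodule.Quotient.mk_surjective _ x
  rfl

lemma homologyMap_comp (f : M ⟶ N) (g : N ⟶ P) (n : ℕ) :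
    homologyMap (f ≫ g) n = homologyMap g n ∘ₗ homologyMap f n := by
  refine LinearMap.ext fun x => ?_
  obtain ⟨x, rfl⟩ := Submodule.Quotient.mk_surjective _ x
  rfl

instance : (weakEquivalences A).HasTwoOutOfThreeProperty where
  comp_mem f g hf hg n := by
    rw [homologyMap_comp]
    exact (hg n).comp (hf n)
  of_postcomp f g hg hfg n := by
    have h := hfg n
    rw [homologyMap_comp] at h
    exact (Function.Bijective.of_comp_iff' (hg n) _).1 h
  of_precomp f g hf hfg n := by
    have h := hfg n
    rw [homologyMap_comp] at h
    exact (Function.Bijective.of_comp_iff _ (hf n)).1 h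

lemma weakEquivalences_of_isIso (f : M ⟶ N) [IsIso f] : weakEquivalences A f := by
  intro n
  have h1 := homologyMap_comp f (inv f) n
  have h2 := homologyMap_comp (inv f) f n
  rw [IsIso.hom_inv_id, homologyMap_id] at h1
  rw [IsIso.inv_hom_id, homologyMap_id] at h2
  exact Function.bijective_iff_has_inverse.2 ⟨homologyMap (inv f) n,
    fun x => (LinearMap.congr_fun h1 x).symm, fun x => (LinearMap.congr_fun h2 x).symm⟩

lemma weakEquivalences_of_acyclic (f : M ⟶ N) (hM : M.Acyclic) (hN : N.Acyclic) :
    weakEquivalences A f :=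
  (weakEquivalences_iff f).2 ⟨fun x hx _ => hM x hx, fun y hy => by
    obtain ⟨y', rfl⟩ := hN y hy
    exact ⟨0, y', map_zero _, by rw [map_zero, zero_add]⟩⟩

end DGMod

/-! ### Maps out of a tensor product over `A` -/

namespace DGMod

variable {k : Type v} {O : Type u} [Field k] [CommRing O] [Algebra k O] {A : DGAlg k O}
  [CharZero k] [Algebra.Smooth k O] {M N P : DGMod A}

namespace TensorCarrier

lemma smul_tmul_of_mem_left {p i : ℕ} {a : A.carrier} {m : M.carrier} (ha : a ∈ A.gr p)
    (hm : m ∈ M.gr i) (n : N.carrier) :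
    (-1 : ℤ) ^ (p * i) • tmul (a • m) n = tmul m (a • n) := by
  induction n using grading_induction N.isInternal with
  | hadd x y hx hy => rw [smul_add, tmul_add, tmul_add, smul_add, hx, hy]
  | hmem j n hn => exact smul_tmul ha hm hn

lemma smul_tmul_of_mem_zero (a : A.carrier) {m : M.carrier} (hm : m ∈ M.gr 0) (n : N.carrier) :
    tmul (a • m) n = tmul m (a • n) := by
  induction a using grading_induction A.isInternal with
  | hadd x y hx hy => rw [add_smul, add_smul, add_tmul, tmul_add, hx, hy]
  | hmem p a ha => simpa using smul_tmul_of_mem_left ha hm n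

/-- Additive maps that agree on tensors of homogeneous elements are equal. -/
lemma eq_of_eq_on_tmul {Y F : Type*} [AddCommGroup Y] [FunLike F (TensorCarrier M N) Y]
    [AddMonoidHomClass F (TensorCarrier M N) Y] {f g : F}
    (h : ∀ (i j : ℕ) (m : M.carrier) (n : N.carrier), m ∈ M.gr i → n ∈ N.gr j →
      f (tmul m n) = g (tmul m n)) (x : TensorCarrier M N) : f x = g x :=
  hom_induction (p := fun x => f x = g x) h (fun x y hx hy => by rw [map_add, map_add, hx, hy]) x

variable (M N) in
/-- The relations that define `M ⊗_A N`, as a set. -/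
def relSet : Set (M.carrier ⊗[O] N.carrier) :=
  {t | ∃ (p i j : ℕ) (a : A.carrier) (m : M.carrier) (n : N.carrier),
    a ∈ A.gr p ∧ m ∈ M.gr i ∧ n ∈ N.gr j ∧
    t = ((-1 : ℤ) ^ (p * i) • (a • m)) ⊗ₜ[O] n - m ⊗ₜ[O] (a • n)}

lemma osmul_mem_closure_relSet (f : O) {t : M.carrier ⊗[O] N.carrier}
    (ht : t ∈ AddSubgroup.closure (relSet M N)) : f • t ∈ AddSubgroup.closure (relSet M N) := by
  induction ht using AddSubgroup.closure_induction with
  | zero => rw [smul_zero]; exact zero_mem _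
  | add x y _ _ hx hy => rw [smul_add]; exact add_mem hx hy
  | neg x _ hx => rw [smul_neg]; exact neg_mem hx
  | mem x hx =>
    obtain ⟨p, i, j, a, m, n, ha, hm, hn, rfl⟩ := hx
    refine AddSubgroup.subset_closure ⟨p, i, j, a, m, f • n, ha, hm, ?_, ?_⟩
    · rw [← DiffOp.ofFun_smul (k := k)]
      exact Submodule.smul_mem _ _ hn
    · rw [smul_sub, smul_comm a f n, TensorProduct.tmul_smul f, TensorProduct.tmul_smul f]

lemma ofDer_smul_mem_closure_relSet (θ : Derivation k O O) {t : M.carrier ⊗[O] N.carrier}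
    (ht : t ∈ AddSubgroup.closure (relSet M N)) :
    DiffOp.ofDer θ • t ∈ AddSubgroup.closure (relSet M N) := by
  induction ht using AddSubgroup.closure_induction with
  | zero => rw [smul_zero]; exact zero_mem _
  | add x y _ _ hx hy => rw [smul_add]; exact add_mem hx hy
  | neg x _ hx => rw [smul_neg]; exact neg_mem hx
  | mem x hx =>
    obtain ⟨p, i, j, a, m, n, ha, hm, hn, rfl⟩ := hx
    have h1 : (((-1 : ℤ) ^ (p * i) • ((DiffOp.ofDer θ • a) • m)) ⊗ₜ[O] n -
        m ⊗ₜ[O] ((DiffOp.ofDer θ • a) • n)) ∈ AddSubgroup.closure (relSet M N) :=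
      AddSubgroup.subset_closure ⟨p, i, j, _, m, n, Submodule.smul_mem _ _ ha, hm, hn, rfl⟩
    have h2 : (((-1 : ℤ) ^ (p * i) • (a • (DiffOp.ofDer θ • m))) ⊗ₜ[O] n -
        (DiffOp.ofDer θ • m) ⊗ₜ[O] (a • n)) ∈ AddSubgroup.closure (relSet M N) :=
      AddSubgroup.subset_closure ⟨p, i, j, a, _, n, ha, Submodule.smul_mem _ _ hm, hn, rfl⟩
    have h3 : (((-1 : ℤ) ^ (p * i) • (a • m)) ⊗ₜ[O] (DiffOp.ofDer θ • n) -
        m ⊗ₜ[O] (a • (DiffOp.ofDer θ • n))) ∈ AddSubgroup.closure (relSet M N) :=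
      AddSubgroup.subset_closure ⟨p, i, j, a, m, _, ha, hm, Submodule.smul_mem _ _ hn, rfl⟩
    convert add_mem (add_mem h1 h2) h3 using 1
    rw [smul_sub, DTensor.ofDer_smul_tmul, DTensor.ofDer_smul_tmul, smul_comm (DiffOp.ofDer θ),
      M.der_smul, N.der_smul, smul_add, TensorProduct.add_tmul, TensorProduct.tmul_add]
    abel

/-- The `𝒟`-submodule `rel M N` is generated by the relations already as an additive group. -/
lemma mem_closure_of_mem_rel {t : M.carrier ⊗[O] N.carrier} (ht : t ∈ rel M N) :
    t ∈ AddSubgroup.closure (relSet M N) := by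
  induction ht using Submodule.span_induction with
  | zero => exact zero_mem _
  | add x y _ _ hx hy => exact add_mem hx hy
  | mem x hx => exact AddSubgroup.subset_closure hx
  | smul Q x _ hx =>
    refine DiffOp.order_induction (p := fun Q => ∀ t ∈ AddSubgroup.closure (relSet M N),
      Q • t ∈ AddSubgroup.closure (relSet M N)) (fun f t ht => ?_) (fun Q R hQ hR t ht => ?_)
      (fun f Q hQ t ht => ?_) (fun Q θ hQ t ht => ?_) Q x hx
    · rw [DiffOp.ofFun_smul]
      exact osmul_mem_closure_relSet f ht
    · rw [add_smul]
      exact add_mem (hQ t ht) (hR t ht)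
    · rw [smul_assoc]
      exact osmul_mem_closure_relSet f (hQ t ht)
    · rw [mul_smul]
      exact hQ _ (ofDer_smul_mem_closure_relSet θ ht)

/-- An additive map out of `M ⊗ N` that respects the relations descends to `M ⊗_A N`. -/
def descAdd {X : Type*} [AddCommGroup X] (φ : M.carrier ⊗[O] N.carrier →+ X)
    (hφ : ∀ (p i j : ℕ) (a : A.carrier) (m : M.carrier) (n : N.carrier),
      a ∈ A.gr p → m ∈ M.gr i → n ∈ N.gr j →
      (-1 : ℤ) ^ (p * i) • φ ((a • m) ⊗ₜ[O] n) = φ (m ⊗ₜ[O] (a • n))) :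
    TensorCarrier M N →+ X :=
  QuotientAddGroup.lift (rel M N).toAddSubgroup φ fun t ht => by
    have h : AddSubgroup.closure (relSet M N) ≤ φ.ker := by
      rw [AddSubgroup.closure_le]
      rintro _ ⟨p, i, j, a, m, n, ha, hm, hn, rfl⟩
      rw [SetLike.mem_coe, AddMonoidHom.mem_ker, map_sub, ← TensorProduct.smul_tmul', map_zsmul,
        hφ p i j a m n ha hm hn, sub_self]
    exact h (mem_closure_of_mem_rel ht)

variable (M) in
/-- The map `m ⊗ n ↦ m ⊗ g n`, for a `𝒟`- and `A`-linear map `g` that need not have degree zero or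
commute with the differentials. -/
def lmap (g : N.carrier →ₗ[DiffOp k O] P.carrier) (hg : ∀ (a : A.carrier) n, g (a • n) = a • g n) :
    TensorCarrier M N →ₗ[DiffOp k O] TensorCarrier M P :=
  desc (mk M P ∘ₗ DTensor.map LinearMap.id g) fun p i j a m n ha hm _ => by
    rw [LinearMap.comp_apply, LinearMap.comp_apply, DTensor.map_tmul, DTensor.map_tmul, hg]
    exact smul_tmul_of_mem_left ha hm (g n)

variable (N) in
/-- The map `m ⊗ n ↦ g m ⊗ n`, for a `𝒟`-linear map `g` that is linear for the right actions of
`A`. -/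
def rmap (g : M.carrier →ₗ[DiffOp k O] P.carrier)
    (hg : ∀ (p i : ℕ) (a : A.carrier) (m : M.carrier) (n : N.carrier), a ∈ A.gr p → m ∈ M.gr i →
      (-1 : ℤ) ^ (p * i) • tmul (g (a • m)) n = tmul (g m) (a • n)) :
    TensorCarrier M N →ₗ[DiffOp k O] TensorCarrier P N :=
  desc (mk P N ∘ₗ DTensor.map g LinearMap.id) fun p i _ a m n ha hm _ => hg p i a m n ha hm

end TensorCarrier

/-! ### The symmetry of the tensor product -/

/-- The projection of a graded module onto the sum of the components of even degree. -/
def evenProj {R : Type*} {X : Type*} [Ring R] [AddCommGroup X] [Module R X] {G : ℕ → Submodule R X}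
    (h : DirectSum.IsInternal G) : X →ₗ[R] X :=
  DirectSum.toModule R ℕ X (fun i => if Even i then (G i).subtype else 0) ∘ₗ decompose h

lemma evenProj_of_mem {R : Type*} {X : Type*} [Ring R] [AddCommGroup X] [Module R X]
    {G : ℕ → Submodule R X} (h : DirectSum.IsInternal G) {i : ℕ} {x : X} (hx : x ∈ G i) :
    evenProj h x = if Even i then x else 0 := by
  simp only [evenProj, LinearMap.comp_apply, decompose_of_mem h hx, DirectSum.toModule_lof]
  split_ifs <;> rfl

namespace TensorCarrier

/-- The exchange of the factors of `M ⊗ N`, as a `𝒟`-linear map. -/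
def swap {X Y : Type*} [AddCommGroup X] [Module O X] [Module (DiffOp k O) X]
    [IsScalarTower O (DiffOp k O) X] [AddCommGroup Y] [Module O Y] [Module (DiffOp k O) Y]
    [IsScalarTower O (DiffOp k O) Y] : X ⊗[O] Y →ₗ[DiffOp k O] Y ⊗[O] X :=
  DTensor.mkLinear (TensorProduct.comm O X Y).toLinearMap.toAddMonoidHom
    (fun f t => map_smul (TensorProduct.comm O X Y) f t) fun θ t => by
      change TensorProduct.comm O X Y _ = _ • TensorProduct.comm O X Y _
      induction t using TensorProduct.induction_on with
      | zero => simp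
      | add x y hx hy => rw [smul_add, map_add, map_add, smul_add, hx, hy]
      | tmul m n => simp only [DTensor.ofDer_smul_tmul, map_add, TensorProduct.comm_tmul, add_comm]

lemma swap_tmul {X Y : Type*} [AddCommGroup X] [Module O X] [Module (DiffOp k O) X]
    [IsScalarTower O (DiffOp k O) X] [AddCommGroup Y] [Module O Y] [Module (DiffOp k O) Y]
    [IsScalarTower O (DiffOp k O) Y] (x : X) (y : Y) :
    swap (k := k) (x ⊗ₜ[O] y) = y ⊗ₜ[O] x := rfl

/-- The exchange of the factors with the Koszul sign, `m ⊗ n ↦ (-1) ^ (|m| |n|) n ⊗ m`. -/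
def preBraid : M.carrier ⊗[O] N.carrier →ₗ[DiffOp k O] TensorCarrier N M :=
  mk N M ∘ₗ swap ∘ₗ (DTensor.map (evenProj M.isInternal) LinearMap.id +
    DTensor.map (LinearMap.id - evenProj M.isInternal) (gsign N.isInternal))

lemma preBraid_tmul {i j : ℕ} {m : M.carrier} {n : N.carrier} (hm : m ∈ M.gr i)
    (hn : n ∈ N.gr j) : preBraid (m ⊗ₜ[O] n) = (-1 : ℤ) ^ (i * j) • tmul n m := by
  simp only [preBraid, LinearMap.comp_apply, LinearMap.add_apply, DTensor.map_tmul,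
    LinearMap.sub_apply, LinearMap.id_apply, evenProj_of_mem _ hm, gsign_of_mem _ hn]
  split_ifs with hi
  · simp only [sub_self, TensorProduct.zero_tmul, add_zero, swap_tmul]
    rw [(hi.mul_right j).neg_one_pow, one_smul]
    rfl
  · simp only [sub_zero, TensorProduct.zero_tmul, zero_add, swap_tmul]
    rw [pow_mul, (Nat.not_even_iff_odd.1 hi).neg_one_pow, ← zsmul_tmul]
    rfl

/-- The underlying map of the symmetry `M ⊗_A N ≅ N ⊗_A M`. -/
def braidLin : TensorCarrier M N →ₗ[DiffOp k O] TensorCarrier N M :=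
  desc preBraid fun p i j a m n ha hm hn => by
    rw [preBraid_tmul (M.smul_mem ha hm) hn, preBraid_tmul hm (N.smul_mem ha hn),
      ← smul_tmul_of_mem_left ha hn, smul_smul, smul_smul, ← pow_add, ← pow_add]
    congr 1
    have h : p * i + (p + i) * j + p * j = i * (p + j) + 2 * (p * j) := by ring
    rw [h, pow_add _ _ (2 * _), pow_mul _ 2, neg_one_sq, one_pow, mul_one]

lemma braidLin_tmul {i j : ℕ} {m : M.carrier} {n : N.carrier} (hm : m ∈ M.gr i)
    (hn : n ∈ N.gr j) : braidLin (tmul m n) = (-1 : ℤ) ^ (i * j) • tmul n m :=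
  preBraid_tmul hm hn

lemma braidLin_braidLin (x : TensorCarrier M N) : braidLin (braidLin x) = x := by
  refine eq_of_eq_on_tmul (f := braidLin ∘ₗ braidLin) (g := LinearMap.id)
    (fun i j m n hm hn => ?_) x
  rw [LinearMap.comp_apply, braidLin_tmul hm hn, map_zsmul, braidLin_tmul hn hm, smul_smul,
    ← pow_add, mul_comm j, ← two_mul, pow_mul, neg_one_sq, one_pow, one_smul, LinearMap.id_apply]

lemma braidLin_smul (a : A.carrier) (x : TensorCarrier M N) :
    braidLin (a • x) = a • braidLin x := by
  induction a using grading_induction A.isInternal with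
  | hadd b c hb hc => rw [add_smul, add_smul, map_add, hb, hc]
  | hmem p a ha =>
    induction x using hom_induction with
    | hadd x y hx hy => rw [smul_add, map_add, map_add, smul_add, hx, hy]
    | hmem i j m n hm hn =>
      rw [smul_tmul', braidLin_tmul (M.smul_mem ha hm) hn, braidLin_tmul hm hn,
        ← smul_tmul_of_mem_left ha hn, smul_smul, smul_comm a, smul_tmul', ← pow_add]
      congr 1
      have h : (p + i) * j + p * j = i * j + 2 * (p * j) := by ring
      rw [h, pow_add _ _ (2 * _), pow_mul _ 2, neg_one_sq, one_pow, mul_one]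

lemma braidLin_mem {n : ℕ} {x : TensorCarrier M N} (hx : x ∈ gr M N n) :
    braidLin x ∈ gr N M n := by
  refine gr_induction (p := fun x => braidLin x ∈ gr N M n) (fun r s x y hx hy h => ?_)
    (fun x y hx hy => ?_) x hx
  · rw [braidLin_tmul hx hy]
    exact zsmul_mem (tmul_mem hy hx (by omega)) _
  · rw [map_add]
    exact add_mem hx hy

lemma braidLin_d (x : TensorCarrier M N) : braidLin (d x) = d (braidLin x) := by
  refine eq_of_eq_on_tmul (f := braidLin ∘ₗ d) (g := d ∘ₗ braidLin) (fun i j m n hm hn => ?_) x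
  rw [LinearMap.comp_apply, LinearMap.comp_apply, d_tmul hm, braidLin_tmul hm hn, map_add,
    map_zsmul, map_zsmul, d_tmul hn, smul_add, smul_smul, add_comm]
  congr 1
  · cases j with
    | zero => rw [N.d_zero hn, tmul_zero, zero_tmul, map_zero, smul_zero, smul_zero]
    | succ j =>
      rw [braidLin_tmul hm (N.d_mem hn), smul_smul, ← pow_add]
      congr 2
      ring
  · cases i with
    | zero => rw [M.d_zero hm, tmul_zero, zero_tmul, map_zero, smul_zero]
    | succ i =>
      rw [braidLin_tmul (M.d_mem hm) hn, ← pow_add]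
      congr 1
      have h : (i + 1) * j + j = i * j + 2 * j := by ring
      rw [h, pow_add _ _ (2 * _), pow_mul _ 2, neg_one_sq, one_pow, mul_one]

end TensorCarrier

open TensorCarrier

variable (M N) in
/-- The symmetry `M ⊗_A N → N ⊗_A M`, as a morphism. -/
def braid : tensorObj M N ⟶ tensorObj N M where
  lin := braidLin
  map_smul := braidLin_smul
  map_mem := braidLin_mem
  map_d := braidLin_d

instance : IsIso (braid M N) :=
  ⟨braid N M, hom_ext (LinearMap.ext braidLin_braidLin), hom_ext (LinearMap.ext braidLin_braidLin)⟩

lemma braid_naturality {M' N' : DGMod A} (f : M ⟶ M') (g : N ⟶ N') :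
    tensorMap f g ≫ braid M' N' = braid M N ≫ tensorMap g f := by
  refine hom_ext (LinearMap.ext fun x => ?_)
  refine eq_of_eq_on_tmul (f := braidLin ∘ₗ tensorMapLin f g) (g := tensorMapLin g f ∘ₗ braidLin)
    (fun i j m n hm hn => ?_) x
  rw [LinearMap.comp_apply, LinearMap.comp_apply, tensorMapLin_tmul, braidLin_tmul hm hn,
    braidLin_tmul (Hom.map_mem f hm) (Hom.map_mem g hn), map_zsmul, tensorMapLin_tmul]

end DGMod

/-! ### The mapping cone -/

namespace DGAlg

variable {k : Type v} {O : Type u} [Field k] [CommRing O] [Algebra k O] (A : DGAlg k O)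

/-- The automorphism `a ↦ (-1) ^ |a| a` of `A`. -/
def sgn : A.carrier →ₗ[DiffOp k O] A.carrier := gsign A.isInternal

variable {A}

lemma sgn_of_mem {p : ℕ} {a : A.carrier} (ha : a ∈ A.gr p) : A.sgn a = (-1 : ℤ) ^ p • a :=
  gsign_of_mem _ ha

lemma sgn_one : A.sgn 1 = 1 := by
  rw [sgn_of_mem A.one_mem, pow_zero, one_smul]

lemma sgn_mul (a b : A.carrier) : A.sgn (a * b) = A.sgn a * A.sgn b := by
  induction a using grading_induction A.isInternal with
  | hadd x y hx hy => rw [add_mul, map_add, map_add, hx, hy, add_mul]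
  | hmem p a ha =>
    induction b using grading_induction A.isInternal with
    | hadd x y hx hy => rw [mul_add, map_add, map_add, hx, hy, mul_add]
    | hmem q b hb =>
      rw [sgn_of_mem ha, sgn_of_mem hb, sgn_of_mem (A.mul_mem ha hb), smul_mul_smul_comm, pow_add]

lemma sgn_osmul (f : O) (a : A.carrier) : A.sgn (f • a) = f • A.sgn a := by
  rw [← DiffOp.ofFun_smul (k := k) f a, map_smul, DiffOp.ofFun_smul]

end DGAlg

namespace DGMod

variable {k : Type v} {O : Type u} [Field k] [CommRing O] [Algebra k O] {A : DGAlg k O}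
  {M N : DGMod A}

/-- The underlying `𝒟`-module `N × M` of the mapping cone of `f : M ⟶ N`. -/
def ConeCarrier (_ : M ⟶ N) : Type u := N.carrier × M.carrier

namespace ConeCarrier

variable (f : M ⟶ N)

instance : AddCommGroup (ConeCarrier f) := inferInstanceAs (AddCommGroup (N.carrier × M.carrier))

instance : Module O (ConeCarrier f) := inferInstanceAs (Module O (N.carrier × M.carrier))

instance : Module (DiffOp k O) (ConeCarrier f) :=
  inferInstanceAs (Module (DiffOp k O) (N.carrier × M.carrier))

instance : IsScalarTower O (DiffOp k O) (ConeCarrier f) :=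
  inferInstanceAs (IsScalarTower O (DiffOp k O) (N.carrier × M.carrier))

/-- The inclusion of `N`. -/
def inl : N.carrier →ₗ[DiffOp k O] ConeCarrier f := LinearMap.inl (DiffOp k O) N.carrier M.carrier

/-- The inclusion of the shift of `M`. -/
def inr : M.carrier →ₗ[DiffOp k O] ConeCarrier f := LinearMap.inr (DiffOp k O) N.carrier M.carrier

/-- The projection to `N`. -/
def fst : ConeCarrier f →ₗ[DiffOp k O] N.carrier := LinearMap.fst (DiffOp k O) N.carrier M.carrier

/-- The projection to the shift of `M`. -/
def snd : ConeCarrier f →ₗ[DiffOp k O] M.carrier := LinearMap.snd (DiffOp k O) N.carrier M.carrier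

variable {f}

lemma fst_inl (y : N.carrier) : fst f (inl f y) = y := rfl

lemma fst_inr (x : M.carrier) : fst f (inr f x) = 0 := rfl

lemma snd_inl (y : N.carrier) : snd f (inl f y) = 0 := rfl

lemma snd_inr (x : M.carrier) : snd f (inr f x) = x := rfl

lemma ext {c c' : ConeCarrier f} (h1 : fst f c = fst f c') (h2 : snd f c = snd f c') : c = c' :=
  Prod.ext h1 h2

lemma inl_add_inr (c : ConeCarrier f) : inl f (fst f c) + inr f (snd f c) = c :=
  ext (add_zero _) (zero_add _)

variable (f)

/-- The action of `A` on the cone: on the shift of `M` it is twisted by a sign, so that the shift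
commutes with the right actions. -/
instance : Module A.carrier (ConeCarrier f) where
  smul a c := (a • c.1, A.sgn a • c.2)
  one_smul c := Prod.ext (one_smul _ c.1) (by
    change A.sgn 1 • c.2 = c.2
    rw [DGAlg.sgn_one, one_smul])
  mul_smul a b c := Prod.ext (mul_smul a b c.1) (by
    change A.sgn (a * b) • c.2 = A.sgn a • A.sgn b • c.2
    rw [DGAlg.sgn_mul, mul_smul])
  smul_zero a := Prod.ext (smul_zero a) (smul_zero (A.sgn a))
  smul_add a c c' := Prod.ext (smul_add a c.1 c'.1) (smul_add (A.sgn a) c.2 c'.2)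
  add_smul a b c := Prod.ext (add_smul a b c.1) (by
    change A.sgn (a + b) • c.2 = A.sgn a • c.2 + A.sgn b • c.2
    rw [map_add, add_smul])
  zero_smul c := Prod.ext (zero_smul _ c.1) (by
    change A.sgn 0 • c.2 = 0
    rw [map_zero, zero_smul])

variable {f}

lemma fst_smul (a : A.carrier) (c : ConeCarrier f) : fst f (a • c) = a • fst f c := rfl

lemma snd_smul (a : A.carrier) (c : ConeCarrier f) : snd f (a • c) = A.sgn a • snd f c := rfl

instance : IsScalarTower O A.carrier (ConeCarrier f) :=
  ⟨fun g a c => ext (smul_assoc g a (fst f c)) (by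
    change A.sgn (g • a) • snd f c = g • A.sgn a • snd f c
    rw [DGAlg.sgn_osmul, smul_assoc])⟩

variable (M) in
/-- The grading of the shift of `M`. -/
def shiftGr : ℕ → Submodule (DiffOp k O) M.carrier
  | 0 => ⊥
  | n + 1 => M.gr n

variable (M) in
/-- The projections onto the components of the shift of `M`. -/
def shiftProj : ℕ → M.carrier →ₗ[DiffOp k O] M.carrier
  | 0 => 0
  | n + 1 => gproj M.isInternal n

lemma shiftProj_of_mem {i : ℕ} {x : M.carrier} (hx : x ∈ shiftGr M i) (n : ℕ) :
    shiftProj M n x = if i = n then x else 0 := by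
  cases i with
  | zero =>
    obtain rfl : x = 0 := hx
    simp
  | succ i =>
    cases n with
    | zero => rfl
    | succ n =>
      change gproj M.isInternal n x = _
      rw [gproj_of_mem M.isInternal (i := i) hx]
      simp

variable (f) in
/-- The component of degree `n` of the cone is `N_n × M_{n-1}`. -/
def gr (n : ℕ) : Submodule (DiffOp k O) (ConeCarrier f) :=
  (N.gr n).comap (fst f) ⊓ (shiftGr M n).comap (snd f)

lemma isInternal : DirectSum.IsInternal (gr f) := by
  refine isInternal_of_proj
    (fun n => inl f ∘ₗ gproj N.isInternal n ∘ₗ fst f + inr f ∘ₗ shiftProj M n ∘ₗ snd f)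
    (fun i c hc n => ?_) ?_
  · have h1 := gproj_of_mem N.isInternal hc.1 n
    have h2 := shiftProj_of_mem hc.2 n
    change inl f (gproj N.isInternal n (fst f c)) + inr f (shiftProj M n (snd f c)) = _
    rw [h1, h2]
    split_ifs
    · exact inl_add_inr c
    · rw [map_zero, map_zero, add_zero]
  · rw [eq_top_iff]
    rintro c -
    rw [← inl_add_inr c]
    refine add_mem ?_ ?_
    · induction fst f c using grading_induction N.isInternal with
      | hadd x y hx hy => rw [map_add]; exact add_mem hx hy
      | hmem i y hy => exact Submodule.mem_iSup_of_mem i ⟨hy, zero_mem (shiftGr M i)⟩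
    · induction snd f c using grading_induction M.isInternal with
      | hadd x y hx hy => rw [map_add]; exact add_mem hx hy
      | hmem i y hy =>
        exact Submodule.mem_iSup_of_mem (i + 1) ⟨zero_mem (N.gr (i + 1)), hy⟩

variable (f) in
/-- The differential `(y, x) ↦ (d y + f x, - d x)` of the cone. -/
def d : ConeCarrier f →ₗ[DiffOp k O] ConeCarrier f :=
  inl f ∘ₗ (N.d ∘ₗ fst f + Hom.lin f ∘ₗ snd f) - inr f ∘ₗ M.d ∘ₗ snd f

lemma fst_d (c : ConeCarrier f) : fst f (d f c) = N.d (fst f c) + Hom.lin f (snd f c) :=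
  sub_zero _

lemma snd_d (c : ConeCarrier f) : snd f (d f c) = -M.d (snd f c) :=
  zero_sub _

end ConeCarrier

open ConeCarrier

/-- The mapping cone of a morphism. -/
def cone (f : M ⟶ N) : DGMod A where
  carrier := ConeCarrier f
  gr := ConeCarrier.gr f
  isInternal := ConeCarrier.isInternal
  smul_mem {i j a c} ha hc := by
    refine ⟨N.smul_mem ha hc.1, ?_⟩
    change A.sgn a • snd f c ∈ shiftGr M (i + j)
    have h : snd f c ∈ shiftGr M j := hc.2
    rw [DGAlg.sgn_of_mem ha, smul_assoc]
    refine zsmul_mem ?_ _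
    cases j with
    | zero =>
      have h0 : snd f c = 0 := h
      rw [h0, smul_zero]
      exact zero_mem _
    | succ j => exact M.smul_mem ha h
  der_smul θ a c := by
    refine ConeCarrier.ext (N.der_smul θ a (fst f c)) ?_
    rw [map_smul, map_add, snd_smul, snd_smul, snd_smul, map_smul, map_smul]
    exact M.der_smul θ (A.sgn a) (snd f c)
  d := ConeCarrier.d f
  d_mem {i c} hc := by
    refine ⟨?_, ?_⟩
    · change fst f (ConeCarrier.d f c) ∈ N.gr i
      rw [fst_d]
      exact add_mem (N.d_mem hc.1) (Hom.map_mem f hc.2)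
    · change snd f (ConeCarrier.d f c) ∈ shiftGr M i
      rw [snd_d]
      have h : snd f c ∈ M.gr i := hc.2
      refine neg_mem ?_
      cases i with
      | zero => exact M.d_zero h
      | succ i => exact M.d_mem h
  d_zero {c} hc := by
    have h : snd f c = 0 := hc.2
    refine ConeCarrier.ext ?_ ?_
    · rw [fst_d, N.d_zero hc.1, h, map_zero, map_zero, add_zero]
    · rw [snd_d, h, map_zero, map_zero, neg_zero]
  d_d c := by
    refine ConeCarrier.ext ?_ ?_
    · rw [fst_d, fst_d, snd_d, map_add, N.d_d, map_neg, Hom.map_d, map_zero]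
      abel
    · rw [snd_d, snd_d, map_neg, M.d_d, map_zero, neg_zero, neg_zero]
  d_smul {p a} ha c := by
    refine ConeCarrier.ext ?_ ?_
    · rw [fst_d, map_add, map_zsmul, fst_smul, fst_smul, fst_smul, snd_smul, fst_d, N.d_smul ha,
        Hom.map_smul, DGAlg.sgn_of_mem ha, smul_add, smul_add, smul_assoc]
      abel
    · rw [snd_d, map_add, map_zsmul, snd_smul, snd_smul, snd_smul, snd_d, DGAlg.sgn_of_mem ha,
        smul_assoc, map_zsmul, M.d_smul ha, smul_add, smul_assoc, smul_neg, smul_neg]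
      cases p with
      | zero => simp [A.d_zero ha]
      | succ p =>
        rw [DGAlg.sgn_of_mem (A.d_mem ha), pow_succ, smul_assoc]
        simp only [mul_neg, mul_one, neg_smul, smul_neg, smul_smul]
        abel

/-- The inclusion of `N` into the cone of `f : M ⟶ N`. -/
def coneInl (f : M ⟶ N) : N ⟶ cone f where
  lin := ConeCarrier.inl f
  map_smul a y := ConeCarrier.ext (f := f) rfl (smul_zero (A.sgn a)).symm
  map_mem {i _} hy := ⟨hy, zero_mem (shiftGr M i)⟩
  map_d y := ConeCarrier.ext
    (by
      change N.d y = ConeCarrier.fst f (ConeCarrier.d f (ConeCarrier.inl f y))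
      rw [fst_d, fst_inl, snd_inl, map_zero, add_zero])
    (by
      change (0 : M.carrier) = ConeCarrier.snd f (ConeCarrier.d f (ConeCarrier.inl f y))
      rw [snd_d, snd_inl, map_zero, neg_zero])

/-- The cone of a quasi-isomorphism is acyclic. -/
lemma acyclic_cone {f : M ⟶ N} (hf : weakEquivalences A f) : (cone f).Acyclic := by
  obtain ⟨hinj, hsurj⟩ := (weakEquivalences_iff f).1 hf
  intro (c : ConeCarrier f) (hc : ConeCarrier.d f c = 0)
  change ∃ y : ConeCarrier f, ConeCarrier.d f y = c
  have h1 : N.d (fst f c) + Hom.lin f (snd f c) = 0 := by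
    rw [← fst_d, hc, map_zero]
  have h2 : M.d (snd f c) = 0 := by
    rw [← neg_eq_zero, ← snd_d, hc, map_zero]
  obtain ⟨x', hx'⟩ := hinj _ h2 ⟨-fst f c, by
    rw [map_neg, neg_eq_iff_add_eq_zero, h1]⟩
  obtain ⟨x'', y', hx'', h3⟩ := hsurj (fst f c + Hom.lin f x') (by
    rw [map_add, ← Hom.map_d, hx', h1])
  refine ⟨inl f y' + inr f (x'' - x'), ConeCarrier.ext ?_ ?_⟩
  · rw [fst_d, map_add (fst f), map_add (snd f), fst_inl, fst_inr, snd_inl, snd_inr, add_zero,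
      zero_add, map_sub, ← add_sub_assoc, add_comm (N.d y'), ← h3, add_sub_cancel_right]
  · rw [snd_d, map_add, snd_inl, snd_inr, zero_add, map_sub, hx'', hx', zero_sub, neg_neg]

end DGMod

/-! ### The tensor product of a cone with a module -/

namespace DGMod

variable {k : Type v} {O : Type u} [Field k] [CommRing O] [Algebra k O] {A : DGAlg k O}

section ConeMaps

variable {M N : DGMod A} (f : M ⟶ N)

/-- The inclusion of the shift of `M` into the cone of `f`, a map of degree `1`. -/
def coneInr : M.carrier →ₗ[DiffOp k O] (cone f).carrier := ConeCarrier.inr f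

/-- The projection of the cone of `f` to `N`. -/
def coneFst : (cone f).carrier →ₗ[DiffOp k O] N.carrier := ConeCarrier.fst f

/-- The projection of the cone of `f` to the shift of `M`, a map of degree `-1`. -/
def coneSnd : (cone f).carrier →ₗ[DiffOp k O] M.carrier := ConeCarrier.snd f

variable {f}

lemma coneInr_mem {i : ℕ} {m : M.carrier} (hm : m ∈ M.gr i) : coneInr f m ∈ (cone f).gr (i + 1) :=
  ⟨zero_mem (N.gr (i + 1)), hm⟩

lemma coneInr_smul {p : ℕ} {a : A.carrier} (ha : a ∈ A.gr p) (m : M.carrier) :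
    coneInr f (a • m) = (-1 : ℤ) ^ p • a • coneInr f m := by
  refine ConeCarrier.ext (f := f) ?_ ?_
  · change (0 : N.carrier) = coneFst f ((-1 : ℤ) ^ p • (a • coneInr f m))
    rw [map_zsmul]
    change 0 = (-1 : ℤ) ^ p • a • (0 : N.carrier)
    rw [smul_zero, smul_zero]
  · change a • m = coneSnd f ((-1 : ℤ) ^ p • (a • coneInr f m))
    rw [map_zsmul]
    change _ = (-1 : ℤ) ^ p • A.sgn a • m
    rw [DGAlg.sgn_of_mem ha, smul_assoc, smul_smul, ← pow_add, ← two_mul, pow_mul, neg_one_sq,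
      one_pow, one_smul]

lemma coneFst_mem {i : ℕ} {c : (cone f).carrier} (hc : c ∈ (cone f).gr i) :
    coneFst f c ∈ N.gr i := hc.1

lemma coneSnd_mem {i : ℕ} {c : (cone f).carrier} (hc : c ∈ (cone f).gr (i + 1)) :
    coneSnd f c ∈ M.gr i := hc.2

lemma coneSnd_of_mem_zero {c : (cone f).carrier} (hc : c ∈ (cone f).gr 0) :
    coneSnd f c = 0 := hc.2

lemma coneSnd_smul {p : ℕ} {a : A.carrier} (ha : a ∈ A.gr p) (c : (cone f).carrier) :
    coneSnd f (a • c) = (-1 : ℤ) ^ p • a • coneSnd f c := by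
  change A.sgn a • coneSnd f c = _
  rw [DGAlg.sgn_of_mem ha, smul_assoc]

lemma coneInl_add_coneInr (c : (cone f).carrier) :
    Hom.lin (coneInl f) (coneFst f c) + coneInr f (coneSnd f c) = c :=
  ConeCarrier.inl_add_inr (f := f) c

lemma d_coneInr (m : M.carrier) :
    (cone f).d (coneInr f m) = Hom.lin (coneInl f) (Hom.lin f m) - coneInr f (M.d m) := by
  refine ConeCarrier.ext (f := f) ?_ ?_
  · change ConeCarrier.fst f (ConeCarrier.d f (ConeCarrier.inr f m)) = Hom.lin f m - 0
    rw [ConeCarrier.fst_d, ConeCarrier.fst_inr, ConeCarrier.snd_inr, map_zero, zero_add, sub_zero]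
  · change ConeCarrier.snd f (ConeCarrier.d f (ConeCarrier.inr f m)) = 0 - M.d m
    rw [ConeCarrier.snd_d, ConeCarrier.snd_inr, zero_sub]

end ConeMaps

variable [CharZero k] [Algebra.Smooth k O] {M N : DGMod A}

open TensorCarrier

section ConeTensor

variable (f : M ⟶ N) (P : DGMod A)

/-- The inclusion of `N ⊗ P` into `cone f ⊗ P`. -/
def coneTensorInl : TensorCarrier N P →ₗ[DiffOp k O] TensorCarrier (cone f) P :=
  tensorMapLin (coneInl f) (𝟙 P)

/-- The inclusion of the shift of `M ⊗ P` into `cone f ⊗ P`. -/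
def coneTensorInr : TensorCarrier M P →ₗ[DiffOp k O] TensorCarrier (cone f) P :=
  rmap P (coneInr f) fun p i a m n ha hm => by
    rw [coneInr_smul ha, zsmul_tmul, smul_smul, ← pow_add]
    exact smul_tmul_of_mem_left ha (coneInr_mem hm) n

/-- The projection of `cone f ⊗ P` onto `N ⊗ P`. -/
def coneTensorFst : TensorCarrier (cone f) P →ₗ[DiffOp k O] TensorCarrier N P :=
  rmap P (coneFst f) fun _ _ _ _ n ha hc => smul_tmul_of_mem_left ha (coneFst_mem hc) n

/-- The projection of `cone f ⊗ P` onto the shift of `M ⊗ P`. -/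
def coneTensorSnd : TensorCarrier (cone f) P →ₗ[DiffOp k O] TensorCarrier M P :=
  rmap P (coneSnd f) fun p i a c n ha hc => by
    rw [coneSnd_smul ha, zsmul_tmul]
    cases i with
    | zero =>
      rw [coneSnd_of_mem_zero hc, smul_zero, TensorCarrier.zero_tmul, TensorCarrier.zero_tmul,
        smul_zero, smul_zero]
    | succ i =>
      rw [← smul_tmul_of_mem_left ha (coneSnd_mem hc) n, smul_smul, ← pow_add]
      congr 1
      have h1 : p * (i + 1) + p = p * i + 2 * p := by ring
      rw [h1, pow_add _ _ (2 * _), pow_mul _ 2, neg_one_sq, one_pow, mul_one]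

variable {f P}

lemma coneTensorFst_inl (y : TensorCarrier N P) : coneTensorFst f P (coneTensorInl f P y) = y :=
  eq_of_eq_on_tmul (f := coneTensorFst f P ∘ₗ coneTensorInl f P) (g := LinearMap.id)
    (fun _ _ _ _ _ _ => rfl) y

lemma coneTensorSnd_inl (y : TensorCarrier N P) : coneTensorSnd f P (coneTensorInl f P y) = 0 :=
  eq_of_eq_on_tmul (f := coneTensorSnd f P ∘ₗ coneTensorInl f P) (g := 0)
    (fun _ _ _ n _ _ => TensorCarrier.zero_tmul n) y

lemma coneTensorFst_inr (x : TensorCarrier M P) : coneTensorFst f P (coneTensorInr f P x) = 0 :=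
  eq_of_eq_on_tmul (f := coneTensorFst f P ∘ₗ coneTensorInr f P) (g := 0)
    (fun _ _ _ n _ _ => TensorCarrier.zero_tmul n) x

lemma coneTensorSnd_inr (x : TensorCarrier M P) : coneTensorSnd f P (coneTensorInr f P x) = x :=
  eq_of_eq_on_tmul (f := coneTensorSnd f P ∘ₗ coneTensorInr f P) (g := LinearMap.id)
    (fun _ _ _ _ _ _ => rfl) x

lemma coneTensorInl_add_inr (c : TensorCarrier (cone f) P) :
    coneTensorInl f P (coneTensorFst f P c) + coneTensorInr f P (coneTensorSnd f P c) = c :=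
  eq_of_eq_on_tmul
    (f := coneTensorInl f P ∘ₗ coneTensorFst f P + coneTensorInr f P ∘ₗ coneTensorSnd f P)
    (g := LinearMap.id) (fun _ _ m n _ _ => by
      conv_rhs => rw [← coneInl_add_coneInr m]
      exact (TensorCarrier.add_tmul _ _ n).symm) c

lemma d_coneTensorInl (y : TensorCarrier N P) :
    TensorCarrier.d (coneTensorInl f P y) = coneTensorInl f P (TensorCarrier.d y) :=
  (tensorMapLin_d (coneInl f) (𝟙 P) y).symm

/-- The differential of the cone of `f ⊗ P`, on the shifted summand. -/
lemma d_coneTensorInr (x : TensorCarrier M P) :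
    TensorCarrier.d (coneTensorInr f P x) = coneTensorInl f P (tensorMapLin f (𝟙 P) x) -
      coneTensorInr f P (TensorCarrier.d x) := by
  refine eq_of_eq_on_tmul (f := TensorCarrier.d ∘ₗ coneTensorInr f P)
    (g := coneTensorInl f P ∘ₗ tensorMapLin f (𝟙 P) - coneTensorInr f P ∘ₗ TensorCarrier.d)
    (fun i j m n hm hn => ?_) x
  have h1 : coneTensorInr f P (TensorCarrier.d (TensorCarrier.tmul m n)) =
      TensorCarrier.tmul (coneInr f (M.d m)) n +
        (-1 : ℤ) ^ i • TensorCarrier.tmul (coneInr f m) (P.d n) := by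
    rw [d_tmul hm, map_add, map_zsmul]
    rfl
  have h2 : TensorCarrier.d (TensorCarrier.tmul (coneInr f m) n) =
      TensorCarrier.tmul (Hom.lin (coneInl f) (Hom.lin f m)) n -
        TensorCarrier.tmul (coneInr f (M.d m)) n +
        (-1 : ℤ) ^ (i + 1) • TensorCarrier.tmul (coneInr f m) (P.d n) := by
    rw [d_tmul (coneInr_mem hm), d_coneInr, sub_eq_add_neg, ← neg_one_zsmul,
      TensorCarrier.add_tmul, zsmul_tmul, neg_one_zsmul, ← sub_eq_add_neg]
  change TensorCarrier.d (TensorCarrier.tmul (coneInr f m) n) =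
    TensorCarrier.tmul (Hom.lin (coneInl f) (Hom.lin f m)) n -
      coneTensorInr f P (TensorCarrier.d (TensorCarrier.tmul m n))
  rw [h1, h2, pow_succ, mul_neg_one, neg_smul]
  abel

lemma d_eq_of_cone (c : TensorCarrier (cone f) P) :
    TensorCarrier.d c = coneTensorInl f P (TensorCarrier.d (coneTensorFst f P c) +
      tensorMapLin f (𝟙 P) (coneTensorSnd f P c)) -
      coneTensorInr f P (TensorCarrier.d (coneTensorSnd f P c)) := by
  conv_lhs => rw [← coneTensorInl_add_inr c]
  rw [map_add, d_coneTensorInl, d_coneTensorInr, map_add]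
  abel

lemma coneTensorFst_d (c : TensorCarrier (cone f) P) :
    coneTensorFst f P (TensorCarrier.d c) = TensorCarrier.d (coneTensorFst f P c) +
      tensorMapLin f (𝟙 P) (coneTensorSnd f P c) := by
  rw [d_eq_of_cone, map_sub, coneTensorFst_inl, coneTensorFst_inr, sub_zero]

lemma coneTensorSnd_d (c : TensorCarrier (cone f) P) :
    coneTensorSnd f P (TensorCarrier.d c) = -TensorCarrier.d (coneTensorSnd f P c) := by
  rw [d_eq_of_cone, map_sub, coneTensorSnd_inl, coneTensorSnd_inr, zero_sub]

variable (P) in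
/-- `cone f ⊗ P` is the cone of `f ⊗ P`; if it is acyclic, `f ⊗ P` is a quasi-isomorphism. -/
lemma weakEquivalences_tensorMap_of_acyclic_cone (h : (tensorObj (cone f) P).Acyclic) :
    weakEquivalences A (tensorMap f (𝟙 P)) := by
  have h' : ∀ c : TensorCarrier (cone f) P, TensorCarrier.d c = 0 →
    ∃ w : TensorCarrier (cone f) P, TensorCarrier.d w = c := h
  refine (weakEquivalences_iff _).2 ⟨?_, ?_⟩
  · intro (x : TensorCarrier M P) (hx : TensorCarrier.d x = 0)
    rintro ⟨(y : TensorCarrier N P), (hy : TensorCarrier.d y = tensorMapLin f (𝟙 P) x)⟩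
    change ∃ x' : TensorCarrier M P, TensorCarrier.d x' = x
    obtain ⟨w, hw⟩ := h' (coneTensorInr f P x - coneTensorInl f P y) (by
      rw [map_sub, d_coneTensorInr, d_coneTensorInl, hx, hy, map_zero, sub_zero, sub_self])
    refine ⟨-coneTensorSnd f P w, ?_⟩
    rw [map_neg, ← coneTensorSnd_d, hw, map_sub, coneTensorSnd_inr, coneTensorSnd_inl, sub_zero]
  · intro (y : TensorCarrier N P) (hy : TensorCarrier.d y = 0)
    change ∃ (x : TensorCarrier M P) (y' : TensorCarrier N P), TensorCarrier.d x = 0 ∧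
      y = tensorMapLin f (𝟙 P) x + TensorCarrier.d y'
    obtain ⟨w, hw⟩ := h' (coneTensorInl f P y) (by rw [d_coneTensorInl, hy, map_zero])
    refine ⟨coneTensorSnd f P w, coneTensorFst f P w, ?_, ?_⟩
    · rw [← neg_eq_zero, ← coneTensorSnd_d, hw, coneTensorSnd_inl]
    · rw [add_comm, ← coneTensorFst_d, hw, coneTensorFst_inl]

end ConeTensor

/-- The cone of an identity is contractible, by a contraction that survives tensor products. -/
lemma acyclic_cone_id_tensor (K P : DGMod A) : (tensorObj (cone (𝟙 K)) P).Acyclic := by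
  intro (c : TensorCarrier (cone (𝟙 K)) P) (hc : TensorCarrier.d c = 0)
  change ∃ w : TensorCarrier (cone (𝟙 K)) P, TensorCarrier.d w = c
  refine ⟨coneTensorInr (𝟙 K) P (coneTensorFst (𝟙 K) P c), ?_⟩
  have h1 : ∀ x, tensorMapLin (𝟙 K) (𝟙 P) x = x := fun x =>
    eq_of_eq_on_tmul (f := tensorMapLin (𝟙 K) (𝟙 P)) (g := LinearMap.id) (fun _ _ _ _ _ _ => rfl) x
  have h2 := coneTensorFst_d c
  rw [hc, map_zero, h1] at h2
  rw [d_coneTensorInr, h1, eq_neg_of_add_eq_zero_left h2.symm, map_neg, sub_neg_eq_add,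
    coneTensorInl_add_inr]

end DGMod

/-! ### The free module on one generator -/

namespace DGMod

variable {k : Type v} {O : Type u} [Field k] [CommRing O] [Algebra k O] {A : DGAlg k O}
  [CharZero k] [Algebra.Smooth k O]

namespace Free

/-- The projection of `A ⊗ 𝒟` onto `A_n ⊗ 𝒟`. -/
def proj (n : ℕ) : A.carrier ⊗[O] DiffOp k O →ₗ[DiffOp k O] A.carrier ⊗[O] DiffOp k O :=
  DTensor.map (gproj A.isInternal n) LinearMap.id

lemma proj_tmul (n : ℕ) (a : A.carrier) (Q : DiffOp k O) :
    proj n (a ⊗ₜ[O] Q) = gproj A.isInternal n a ⊗ₜ[O] Q := rfl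

variable (A) in
/-- The component of degree `n` of `A ⊗ 𝒟`, which is the image of `A_n ⊗ 𝒟`. -/
def gr (n : ℕ) : Submodule (DiffOp k O) (A.carrier ⊗[O] DiffOp k O) :=
  LinearMap.eqLocus (proj n) LinearMap.id

lemma tmul_mem {n : ℕ} {a : A.carrier} (ha : a ∈ A.gr n) (Q : DiffOp k O) :
    a ⊗ₜ[O] Q ∈ gr A n := by
  change proj n _ = _
  rw [proj_tmul, gproj_self _ ha]
  rfl

lemma gr_induction {p : A.carrier ⊗[O] DiffOp k O → Prop} {n : ℕ}
    (hmem : ∀ a ∈ A.gr n, ∀ Q, p (a ⊗ₜ[O] Q)) (hadd : ∀ x y, p x → p y → p (x + y))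
    {x : A.carrier ⊗[O] DiffOp k O} (hx : x ∈ gr A n) : p x := by
  have h : ∀ x, p (proj n x) := by
    intro x
    induction x using TensorProduct.induction_on with
    | zero =>
      rw [map_zero, ← TensorProduct.zero_tmul A.carrier (0 : DiffOp k O)]
      exact hmem 0 (zero_mem _) 0
    | add x y hx hy => rw [map_add]; exact hadd _ _ hx hy
    | tmul a Q => exact hmem _ (gproj_mem _ _ _) Q
  have h1 : proj n x = x := hx
  rw [← h1]
  exact h x

lemma isInternal : DirectSum.IsInternal (gr A) := by
  refine isInternal_of_proj proj (fun i x hx n => ?_) ?_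
  · refine gr_induction (p := fun x => proj n x = if i = n then x else 0) (fun a ha Q => ?_)
      (fun x y hx hy => ?_) hx
    · rw [proj_tmul, gproj_of_mem _ ha]
      split_ifs <;> simp
    · rw [map_add, hx, hy]
      split_ifs <;> simp
  · rw [eq_top_iff]
    rintro x -
    induction x using TensorProduct.induction_on with
    | zero => exact zero_mem _
    | add x y hx hy => exact add_mem hx hy
    | tmul a Q =>
      induction a using grading_induction A.isInternal with
      | hadd x y hx hy => rw [TensorProduct.add_tmul]; exact add_mem hx hy
      | hmem i a ha => exact Submodule.mem_iSup_of_mem i (tmul_mem ha Q)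

variable (A) in
/-- The differential of `A ⊗ 𝒟`. -/
def d : A.carrier ⊗[O] DiffOp k O →ₗ[DiffOp k O] A.carrier ⊗[O] DiffOp k O :=
  DTensor.map A.d LinearMap.id

lemma d_tmul (a : A.carrier) (Q : DiffOp k O) : d A (a ⊗ₜ[O] Q) = A.d a ⊗ₜ[O] Q := rfl

end Free

variable (A) in
/-- The `A`-module `A ⊗_O 𝒟`, which is free on the generator `1 ⊗ 1` of degree `0`. -/
def free : DGMod A where
  carrier := A.carrier ⊗[O] DiffOp k O
  gr := Free.gr A
  isInternal := Free.isInternal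
  smul_mem {i j a x} ha hx := by
    refine Free.gr_induction (p := fun x => a • x ∈ Free.gr A (i + j)) (fun b hb Q => ?_)
      (fun x y hx hy => ?_) hx
    · rw [TensorProduct.smul_tmul']
      exact Free.tmul_mem (A.mul_mem ha hb) Q
    · rw [smul_add]
      exact add_mem hx hy
  der_smul θ a x := by
    induction x using TensorProduct.induction_on with
    | zero => simp
    | add x y hx hy =>
      simp only [smul_add, hx, hy]
      abel
    | tmul b Q =>
      simp only [DTensor.ofDer_smul_tmul, TensorProduct.smul_tmul', smul_eq_mul, A.der_mul,
        smul_add, TensorProduct.add_tmul]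
      abel
  d := Free.d A
  d_mem {i _} hx := by
    refine Free.gr_induction (p := fun x => Free.d A x ∈ Free.gr A i) (fun b hb Q => ?_)
      (fun x y hx hy => ?_) hx
    · exact Free.tmul_mem (A.d_mem hb) Q
    · rw [map_add]
      exact add_mem hx hy
  d_zero hx := by
    refine Free.gr_induction (p := fun x => Free.d A x = 0) (fun b hb Q => ?_)
      (fun x y hx hy => ?_) hx
    · rw [Free.d_tmul, A.d_zero hb, TensorProduct.zero_tmul]
    · rw [map_add, hx, hy, add_zero]
  d_d x := by
    induction x using TensorProduct.induction_on with
    | zero => simp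
    | add x y hx hy => rw [map_add, map_add, hx, hy, add_zero]
    | tmul b Q => rw [Free.d_tmul, Free.d_tmul, A.d_d, TensorProduct.zero_tmul]
  d_smul {p a} ha x := by
    induction x using TensorProduct.induction_on with
    | zero => simp
    | add x y hx hy =>
      simp only [smul_add, map_add, hx, hy]
      abel
    | tmul b Q =>
      rw [TensorProduct.smul_tmul', Free.d_tmul, smul_eq_mul, A.d_mul ha, Free.d_tmul,
        TensorProduct.add_tmul, TensorProduct.smul_tmul', TensorProduct.smul_tmul',
        TensorProduct.smul_tmul', smul_eq_mul, smul_eq_mul]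

namespace Free

variable {M N : DGMod A}

/-- The element `a ⊗ Q` of the free module. -/
def mon (a : A.carrier) (Q : DiffOp k O) : (free A).carrier := a ⊗ₜ[O] Q

variable (A) in
/-- The generator of the free module. -/
def gen : (free A).carrier := mon 1 1

lemma gen_mem : gen A ∈ (free A).gr 0 := tmul_mem A.one_mem 1

lemma d_gen : (free A).d (gen A) = 0 := (free A).d_zero gen_mem

lemma smul_mon (a b : A.carrier) (Q : DiffOp k O) : a • mon b Q = mon (a * b) Q := rfl

lemma d_mon (a : A.carrier) (Q : DiffOp k O) : (free A).d (mon a Q) = mon (A.d a) Q := rfl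

@[elab_as_elim]
lemma mem_induction {p : (free A).carrier → Prop} {n : ℕ}
    (hmem : ∀ a ∈ A.gr n, ∀ Q, p (mon a Q)) (hadd : ∀ x y, p x → p y → p (x + y))
    (x : (free A).carrier) (hx : x ∈ (free A).gr n) : p x :=
  gr_induction (p := p) hmem hadd hx

@[elab_as_elim]
lemma hom_induction {p : (free A).carrier → Prop}
    (hmem : ∀ (i : ℕ) (a : A.carrier) (Q : DiffOp k O), a ∈ A.gr i → p (mon a Q))
    (hadd : ∀ x y, p x → p y → p (x + y)) (x : (free A).carrier) : p x :=
  grading_induction (free A).isInternal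
    (fun i _ hx => gr_induction (p := p) (fun a ha Q => hmem i a Q ha) hadd hx) hadd x

/-- The underlying `O`-linear map of `Free.ev`. -/
def evO (m : M.carrier) : A.carrier ⊗[O] DiffOp k O →ₗ[O] M.carrier :=
  TensorProduct.lift (LinearMap.mk₂ O (fun (a : A.carrier) (Q : DiffOp k O) => a • Q • m)
    (fun a b Q => add_smul a b (Q • m))
    (fun f a Q => smul_assoc f a (Q • m))
    (fun a P Q => by rw [add_smul, smul_add])
    (fun f a Q => by rw [smul_assoc, smul_comm]))

lemma evO_ofDer_smul (m : M.carrier) (θ : Derivation k O O) (x : A.carrier ⊗[O] DiffOp k O) :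
    evO m (DiffOp.ofDer θ • x) = DiffOp.ofDer θ • evO m x := by
  induction x using TensorProduct.induction_on with
  | zero => simp
  | add x y hx hy => rw [smul_add, map_add, map_add, smul_add, hx, hy]
  | tmul a Q =>
    rw [DTensor.ofDer_smul_tmul, map_add]
    change (DiffOp.ofDer θ • a) • Q • m + a • (DiffOp.ofDer θ * Q) • m =
      DiffOp.ofDer θ • a • Q • m
    rw [M.der_smul, mul_smul]

/-- The underlying `𝒟`-linear map of `Free.ev`. -/
def evLin (m : M.carrier) : A.carrier ⊗[O] DiffOp k O →ₗ[DiffOp k O] M.carrier :=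
  DTensor.mkLinear (evO m).toAddMonoidHom (map_smul (evO m)) (evO_ofDer_smul m)

/-- The linear map from the free module with value `m` at the generator, `a ⊗ Q ↦ a Q m`. It has the
degree of `m`, and it is defined for all `m`, although it is a chain map only for cycles `m`. -/
def ev (m : M.carrier) : (free A).carrier →ₗ[DiffOp k O] M.carrier := evLin m

lemma ev_mon (m : M.carrier) (a : A.carrier) (Q : DiffOp k O) : ev m (mon a Q) = a • Q • m := rfl

lemma ev_gen (m : M.carrier) : ev m (gen A) = m := by
  rw [gen, ev_mon, one_smul, one_smul]

lemma ev_smul (m : M.carrier) (a : A.carrier) (x : (free A).carrier) :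
    ev m (a • x) = a • ev m x := by
  induction x using hom_induction with
  | hadd x y hx hy => rw [smul_add, map_add, map_add, smul_add, hx, hy]
  | hmem i b Q hb => rw [smul_mon, ev_mon, ev_mon, mul_smul]

lemma ev_add (m m' : M.carrier) (x : (free A).carrier) : ev (m + m') x = ev m x + ev m' x := by
  induction x using hom_induction with
  | hadd x y hx hy => rw [map_add, map_add, map_add, hx, hy]; abel
  | hmem i b Q hb => rw [ev_mon, ev_mon, ev_mon, smul_add, smul_add]

/-- `ev` is natural for `𝒟`- and `A`-linear maps. -/
lemma ev_map (g : M.carrier →ₗ[DiffOp k O] N.carrier)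
    (hg : ∀ (a : A.carrier) m, g (a • m) = a • g m) (m : M.carrier) (x : (free A).carrier) :
    g (ev m x) = ev (g m) x := by
  induction x using hom_induction with
  | hadd x y hx hy => rw [map_add, map_add, map_add, hx, hy]
  | hmem i b Q hb => rw [ev_mon, ev_mon, hg, map_smul]

lemma ev_mem {i j : ℕ} {m : M.carrier} (hm : m ∈ M.gr j) {x : (free A).carrier}
    (hx : x ∈ (free A).gr i) : ev m x ∈ M.gr (i + j) := by
  refine mem_induction (p := fun x => ev m x ∈ M.gr (i + j)) (fun a ha Q => ?_)
    (fun x y hx hy => ?_) x hx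
  · exact M.smul_mem ha (Submodule.smul_mem _ _ hm)
  · rw [map_add]
    exact add_mem hx hy

lemma d_ev (m : M.carrier) {i : ℕ} {x : (free A).carrier} (hx : x ∈ (free A).gr i) :
    M.d (ev m x) = ev m ((free A).d x) + (-1 : ℤ) ^ i • ev (M.d m) x := by
  refine mem_induction (p := fun x => M.d (ev m x) =
    ev m ((free A).d x) + (-1 : ℤ) ^ i • ev (M.d m) x) (fun a ha Q => ?_) (fun x y hx hy => ?_) x hx
  · rw [ev_mon, M.d_smul ha, map_smul, d_mon, ev_mon, ev_mon]
  · rw [map_add, map_add, map_add, map_add, map_add, hx, hy, smul_add]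
    abel

end Free

end DGMod

/-! ### The tensor product with the free module -/

namespace DGMod

variable {k : Type v} {O : Type u} [Field k] [CommRing O] [Algebra k O] {A : DGAlg k O}
  [CharZero k] [Algebra.Smooth k O] {M N P : DGMod A}

namespace TensorCarrier

lemma osmul_tmul (f : O) (m : M.carrier) (n : N.carrier) : tmul (f • m) n = f • tmul m n := rfl

lemma tmul_osmul (f : O) (m : M.carrier) (n : N.carrier) : tmul m (f • n) = f • tmul m n := by
  rw [tmul, TensorProduct.tmul_smul, mk_osmul, tmul]

end TensorCarrier

open TensorCarrier

namespace Free

variable (N) in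
/-- The map `N ⊗ A ⊗ 𝒟 → N ⊗ P`, `n ⊗ x ↦ n ⊗ x p`. For `P = A ⊗ 𝒟` it is the right multiplication
by `p`. -/
def evTensor (p : P.carrier) : TensorCarrier N (free A) →ₗ[DiffOp k O] TensorCarrier N P :=
  lmap N (ev p) (fun a x => ev_smul p a x)

lemma evTensor_tmul (p : P.carrier) (n : N.carrier) (x : (free A).carrier) :
    evTensor N p (tmul n x) = tmul n (ev p x) := rfl

lemma evTensor_add (p p' : P.carrier) (v : TensorCarrier N (free A)) :
    evTensor N (p + p') v = evTensor N p v + evTensor N p' v :=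
  eq_of_eq_on_tmul (f := evTensor N (p + p')) (g := evTensor N p + evTensor N p')
    (fun i j n x hn hx => by
      rw [LinearMap.add_apply, evTensor_tmul, evTensor_tmul, evTensor_tmul, ev_add,
        TensorCarrier.tmul_add]) v

lemma evTensor_zero (v : TensorCarrier N (free A)) : evTensor N (0 : P.carrier) v = 0 := by
  simpa using evTensor_add (0 : P.carrier) 0 v

lemma evTensor_evTensor (b : (free A).carrier) (p : P.carrier) (v : TensorCarrier N (free A)) :
    evTensor N p (evTensor N b v) = evTensor N (ev p b) v :=
  eq_of_eq_on_tmul (f := evTensor N p ∘ₗ evTensor N b) (g := evTensor N (ev p b))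
    (fun i j n x hn hx => by
      rw [LinearMap.comp_apply, evTensor_tmul, evTensor_tmul, evTensor_tmul,
        ev_map (ev p) (fun a x => ev_smul p a x)]) v

/-- The action of `𝒟` on `A ⊗_O 𝒟` is diagonal; as derivations kill `1`, it acts on `1 ⊗ Q` through
the second factor. -/
lemma smul_mon_one (P Q : DiffOp k O) : P • mon (1 : A.carrier) Q = mon 1 (P * Q) := by
  refine DiffOp.order_induction
    (p := fun P => ∀ Q, P • mon (1 : A.carrier) Q = mon 1 (P * Q)) (fun f Q => ?_)
    (fun P P' hP hP' Q => ?_) (fun f P hP Q => ?_) (fun P θ hP Q => ?_) P Q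
  · rw [DiffOp.ofFun_smul, ← DiffOp.smul_def]
    exact (TensorProduct.tmul_smul f (1 : A.carrier) Q).symm
  · rw [add_smul, hP, hP', add_mul]
    exact (TensorProduct.tmul_add (1 : A.carrier) (P * Q) (P' * Q)).symm
  · rw [smul_assoc, hP, smul_mul_assoc]
    exact (TensorProduct.tmul_smul f (1 : A.carrier) (P * Q)).symm
  · have h : DiffOp.ofDer θ • mon (1 : A.carrier) Q = mon 1 (DiffOp.ofDer θ * Q) := by
      refine (DTensor.ofDer_smul_tmul θ (1 : A.carrier) Q).trans ?_
      have h1 : DiffOp.ofDer θ • (1 : A.carrier) = 0 := by simpa using A.der_mul θ 1 1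
      rw [h1, TensorProduct.zero_tmul, zero_add]
      rfl
    rw [mul_smul, h, hP, mul_assoc]

lemma ev_self_gen (x : (free A).carrier) : ev (gen A) x = x := by
  induction x using hom_induction with
  | hadd x y hx hy => rw [map_add, hx, hy]
  | hmem i a Q ha => rw [ev_mon, gen, smul_mon_one, smul_mon, mul_one, mul_one]

lemma evTensor_gen (v : TensorCarrier N (free A)) : evTensor N (gen A) v = v :=
  eq_of_eq_on_tmul (f := evTensor N (gen A)) (g := LinearMap.id)
    (fun i j n x hn hx => by rw [evTensor_tmul, ev_self_gen, LinearMap.id_apply]) v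

lemma evTensor_mem {i j : ℕ} {p : P.carrier} (hp : p ∈ P.gr i) {v : TensorCarrier N (free A)}
    (hv : v ∈ TensorCarrier.gr N (free A) j) : evTensor N p v ∈ TensorCarrier.gr N P (j + i) := by
  refine TensorCarrier.gr_induction (p := fun v => evTensor N p v ∈ TensorCarrier.gr N P (j + i))
    (fun r s n x hn hx h => ?_) (fun x y hx hy => ?_) v hv
  · exact TensorCarrier.tmul_mem hn (ev_mem hp hx) (by omega)
  · rw [map_add]
    exact add_mem hx hy

lemma d_evTensor (p : P.carrier) {j : ℕ} {v : TensorCarrier N (free A)}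
    (hv : v ∈ TensorCarrier.gr N (free A) j) : TensorCarrier.d (evTensor N p v) =
      evTensor N p (TensorCarrier.d v) + (-1 : ℤ) ^ j • evTensor N (P.d p) v := by
  refine TensorCarrier.gr_induction (p := fun v => TensorCarrier.d (evTensor N p v) =
      evTensor N p (TensorCarrier.d v) + (-1 : ℤ) ^ j • evTensor N (P.d p) v)
    (fun r s n x hn hx h => ?_) (fun x y hx hy => ?_) v hv
  · rw [evTensor_tmul, TensorCarrier.d_tmul hn, TensorCarrier.d_tmul hn, map_add, map_zsmul,
      evTensor_tmul, evTensor_tmul, evTensor_tmul, d_ev p hx, TensorCarrier.tmul_add, tmul_zsmul,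
      smul_add, smul_smul, ← pow_add, h, add_assoc]
  · simp only [map_add, hx, hy, smul_add]
    abel

lemma tensorMapLin_evTensor {N' : DGMod A} (f : N ⟶ N') (p : P.carrier)
    (v : TensorCarrier N (free A)) : tensorMapLin f (𝟙 P) (evTensor N p v) =
      evTensor N' p (tensorMapLin f (𝟙 (free A)) v) :=
  eq_of_eq_on_tmul (f := tensorMapLin f (𝟙 P) ∘ₗ evTensor N p)
    (g := evTensor N' p ∘ₗ tensorMapLin f (𝟙 (free A))) (fun _ _ _ _ _ _ => rfl) v

variable (N) in
/-- The `O`-linear map `a ⊗ Q ↦ (n ↦ a n ⊗ Q)`. -/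
def contractO : A.carrier ⊗[O] DiffOp k O →ₗ[O] N.carrier →ₗ[O] N.carrier ⊗[O] DiffOp k O :=
  TensorProduct.lift (LinearMap.mk₂ O
    (fun a Q => (TensorProduct.mk O N.carrier (DiffOp k O)).flip Q ∘ₗ
      DistribSMul.toLinearMap O N.carrier a)
    (fun a b Q => by ext n; simp [add_smul])
    (fun f a Q => by ext n; simp [TensorProduct.smul_tmul'])
    (fun a P Q => by ext n; simp)
    (fun f a Q => by ext n; simp))

variable (N) in
/-- The `O`-linear map `a ⊗ Q ↦ (n ↦ a n ⊗ Q)`, on the free module. -/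
def contractF : (free A).carrier →ₗ[O] N.carrier →ₗ[O] N.carrier ⊗[O] DiffOp k O := contractO N

lemma contractF_mon (a : A.carrier) (Q : DiffOp k O) (n : N.carrier) :
    contractF N (mon a Q) n = (a • n) ⊗ₜ[O] Q := rfl

lemma contractF_smul {p i : ℕ} {a : A.carrier} (ha : a ∈ A.gr p) {x : (free A).carrier}
    (hx : x ∈ (free A).gr i) (n : N.carrier) :
    (-1 : ℤ) ^ (p * i) • contractF N (a • x) n = contractF N x (a • n) := by
  refine mem_induction (p := fun x => (-1 : ℤ) ^ (p * i) • contractF N (a • x) n =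
    contractF N x (a • n)) (fun b hb Q => ?_) (fun x y hx hy => ?_) x hx
  · rw [smul_mon, contractF_mon, contractF_mon, ← mul_smul, A.mul_comm ha hb, smul_assoc,
      TensorProduct.smul_tmul']
  · rw [smul_add, map_add, map_add, LinearMap.add_apply, LinearMap.add_apply, smul_add, hx, hy]

lemma ofDer_smul_mon (θ : Derivation k O O) (a : A.carrier) (Q : DiffOp k O) :
    DiffOp.ofDer θ • mon a Q = mon (DiffOp.ofDer θ • a) Q + mon a (DiffOp.ofDer θ * Q) :=
  DTensor.ofDer_smul_tmul θ a Q

lemma lift_contractF_ofDer_smul (θ : Derivation k O O) (t : (free A).carrier ⊗[O] N.carrier) :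
    TensorProduct.lift (contractF N) (DiffOp.ofDer θ • t) =
      DiffOp.ofDer θ • TensorProduct.lift (contractF N) t := by
  induction t using TensorProduct.induction_on with
  | zero => simp
  | add x y hx hy => rw [smul_add, map_add, map_add, smul_add, hx, hy]
  | tmul x n =>
    induction x using hom_induction with
    | hadd x y hx hy => rw [TensorProduct.add_tmul, smul_add, map_add, map_add, smul_add, hx, hy]
    | hmem i a Q ha =>
      rw [DTensor.ofDer_smul_tmul, map_add, TensorProduct.lift.tmul, TensorProduct.lift.tmul,
        TensorProduct.lift.tmul, ofDer_smul_mon, map_add, LinearMap.add_apply, contractF_mon,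
        contractF_mon, contractF_mon, contractF_mon, DTensor.ofDer_smul_tmul, N.der_smul,
        TensorProduct.add_tmul, smul_eq_mul]
      abel

variable (N) in
/-- The map `(a ⊗ Q) ⊗ n ↦ a n ⊗ Q`. -/
def preContract : (free A).carrier ⊗[O] N.carrier →ₗ[DiffOp k O] N.carrier ⊗[O] DiffOp k O :=
  DTensor.mkLinear (TensorProduct.lift (contractF N)).toAddMonoidHom
    (map_smul (TensorProduct.lift (contractF N))) lift_contractF_ofDer_smul

variable (N) in
/-- The isomorphism `(A ⊗_O 𝒟) ⊗_A N → N ⊗_O 𝒟`, `(a ⊗ Q) ⊗ n ↦ a n ⊗ Q`. -/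
def contract : TensorCarrier (free A) N →ₗ[DiffOp k O] N.carrier ⊗[O] DiffOp k O :=
  desc (preContract N) fun _ _ _ _ _ n ha hx _ => contractF_smul ha hx n

lemma contract_tmul (a : A.carrier) (Q : DiffOp k O) (n : N.carrier) :
    contract N (tmul (mon a Q) n) = (a • n) ⊗ₜ[O] Q := rfl

variable (N) in
/-- The inverse of `Free.contract`, `n ⊗ Q ↦ (1 ⊗ Q) ⊗ n`. -/
def expand : N.carrier ⊗[O] DiffOp k O →ₗ[O] TensorCarrier (free A) N :=
  TensorProduct.lift (LinearMap.mk₂ O (fun n Q => tmul (mon 1 Q) n)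
    (fun n n' Q => TensorCarrier.tmul_add _ n n')
    (fun f n Q => tmul_osmul f _ n)
    (fun n P Q => by
      refine Eq.trans ?_ (TensorCarrier.add_tmul _ _ n)
      exact congrArg (fun x : (free A).carrier => tmul x n)
        (TensorProduct.tmul_add (1 : A.carrier) P Q))
    (fun f n Q => by
      refine Eq.trans ?_ (osmul_tmul f _ n)
      exact congrArg (fun x : (free A).carrier => tmul x n)
        (TensorProduct.tmul_smul f (1 : A.carrier) Q)))

lemma expand_tmul (n : N.carrier) (Q : DiffOp k O) :
    expand N (n ⊗ₜ[O] Q) = tmul (mon 1 Q) n := rfl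

lemma eq_of_eq_on_mon {Y F : Type*} [AddCommGroup Y] [FunLike F (TensorCarrier (free A) N) Y]
    [AddMonoidHomClass F (TensorCarrier (free A) N) Y] {f g : F}
    (h : ∀ (i : ℕ) (a : A.carrier) (Q : DiffOp k O) (n : N.carrier), a ∈ A.gr i →
      f (tmul (mon a Q) n) = g (tmul (mon a Q) n)) (x : TensorCarrier (free A) N) : f x = g x := by
  refine eq_of_eq_on_tmul (fun i j m n hm _ => ?_) x
  clear hm
  induction m using hom_induction with
  | hadd x y hx hy => rw [TensorCarrier.add_tmul, map_add, map_add, hx, hy]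
  | hmem i a Q ha => exact h i a Q n ha

lemma mon_mem {i : ℕ} {a : A.carrier} (ha : a ∈ A.gr i) (Q : DiffOp k O) :
    mon a Q ∈ (free A).gr i := tmul_mem ha Q

lemma expand_contract (x : TensorCarrier (free A) N) : expand N (contract N x) = x :=
  eq_of_eq_on_mon (f := (AddMonoidHomClass.toAddMonoidHom (expand N)).comp
      (AddMonoidHomClass.toAddMonoidHom (contract N)))
    (g := AddMonoidHom.id _) (fun i a Q n ha => by
      refine Eq.trans (b := expand N ((a • n) ⊗ₜ[O] Q)) rfl ?_
      rw [expand_tmul, ← smul_tmul_of_mem_zero a (mon_mem A.one_mem Q) n, smul_mon, mul_one]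
      rfl) x

lemma contract_d (x : TensorCarrier (free A) N) :
    contract N (TensorCarrier.d x) = (DTensor.toO N.d).rTensor (DiffOp k O) (contract N x) :=
  eq_of_eq_on_mon (f := contract N ∘ₗ TensorCarrier.d)
    (g := DTensor.map N.d LinearMap.id ∘ₗ contract N)
    (fun i a Q n ha => by
      rw [LinearMap.comp_apply, LinearMap.comp_apply, TensorCarrier.d_tmul (mon_mem ha Q), map_add,
        map_zsmul, d_mon, contract_tmul, contract_tmul, contract_tmul, DTensor.map_tmul,
        N.d_smul ha, TensorProduct.add_tmul, TensorProduct.smul_tmul']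
      rfl) x

lemma expand_d (t : N.carrier ⊗[O] DiffOp k O) :
    expand N ((DTensor.toO N.d).rTensor (DiffOp k O) t) = TensorCarrier.d (expand N t) := by
  induction t using TensorProduct.induction_on with
  | zero => simp
  | add x y hx hy => rw [map_add, map_add, map_add, map_add, hx, hy]
  | tmul n Q =>
    rw [expand_tmul, TensorCarrier.d_tmul (mon_mem A.one_mem Q), (free A).d_zero
      (mon_mem A.one_mem Q), TensorCarrier.zero_tmul, zero_add, pow_zero, one_smul]
    rfl

end Free

open Free

/-- The tensor product `N ⊗_A (A ⊗_O 𝒟) ≅ N ⊗_O 𝒟` is acyclic if `N` is, since `𝒟` is flat. -/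
lemma Acyclic.tensor_free (hN : N.Acyclic) : (tensorObj N (free A)).Acyclic := by
  intro (v : TensorCarrier N (free A)) (hv : TensorCarrier.d v = 0)
  change ∃ w : TensorCarrier N (free A), TensorCarrier.d w = v
  have hexact : Function.Exact (DTensor.toO N.d) (DTensor.toO N.d) := fun y =>
    ⟨fun hy => hN y hy, fun ⟨x, hx⟩ => by rw [← hx]; exact N.d_d x⟩
  obtain ⟨t, ht⟩ := (Module.Flat.rTensor_exact (DiffOp k O) hexact (contract N (braidLin v))).1
    (by rw [← contract_d, ← braidLin_d, hv, map_zero, map_zero])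
  refine ⟨braidLin (expand N t), ?_⟩
  rw [← braidLin_d, ← expand_d, ht, expand_contract, braidLin_braidLin]

end DGMod

/-! ### The dual of a module -/

namespace DGMod

variable {k : Type v} {O : Type u} [Field k] [CommRing O] [Algebra k O] {A : DGAlg k O}
  [CharZero k] [Algebra.Smooth k O] {N : DGMod A}

open TensorCarrier Free

variable (N) in
/-- The differential of `N ⊗_A (A ⊗_O 𝒟)` with the sign that makes its transpose the differential
of the dual. -/
def signedD : TensorCarrier N (free A) →ₗ[DiffOp k O] TensorCarrier N (free A) :=
  gsign (TensorCarrier.isInternal N (free A)) ∘ₗ TensorCarrier.d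

lemma signedD_of_mem {j : ℕ} {v : TensorCarrier N (free A)}
    (hv : v ∈ TensorCarrier.gr N (free A) j) :
    signedD N v = (-1 : ℤ) ^ (j + 1) • TensorCarrier.d v := by
  rw [signedD, LinearMap.comp_apply]
  cases j with
  | zero => rw [TensorCarrier.d_zero hv, map_zero, smul_zero]
  | succ j =>
    rw [gsign_of_mem _ (TensorCarrier.d_mem hv), pow_add _ _ 1, pow_succ _ j]
    simp

lemma signedD_mem {j : ℕ} {v : TensorCarrier N (free A)}
    (hv : v ∈ TensorCarrier.gr N (free A) (j + 1)) :
    signedD N v ∈ TensorCarrier.gr N (free A) j := by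
  rw [signedD_of_mem hv]
  exact zsmul_mem (TensorCarrier.d_mem hv) _

/-- Right multiplication by `b` commutes with `signedD` up to a sign and the term that involves
`d b`. This is the Leibniz rule for the action on the dual. -/
lemma signedD_evTensor {b : (free A).carrier} {p : ℕ} (hb : b ∈ (free A).gr p) {j : ℕ}
    {v : TensorCarrier N (free A)} (hv : v ∈ TensorCarrier.gr N (free A) j) :
    (-1 : ℤ) ^ p • signedD N (evTensor N b v) + evTensor N ((free A).d b) v =
      evTensor N b (signedD N v) := by
  rw [signedD_of_mem hv, signedD_of_mem (evTensor_mem hb hv), d_evTensor b hv, map_zsmul, smul_smul,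
    smul_add, smul_smul]
  have h1 : (-1 : ℤ) ^ p * (-1) ^ (j + p + 1) = (-1) ^ (j + 1) := by
    rw [← pow_add, show p + (j + p + 1) = j + 1 + 2 * p by ring, pow_add _ _ (2 * p), pow_mul _ 2,
      neg_one_sq, one_pow, mul_one]
  have h2 : (-1 : ℤ) ^ (j + 1) * (-1) ^ j = -1 := by
    rw [← pow_add, show j + 1 + j = 2 * j + 1 by ring, pow_succ, pow_mul, neg_one_sq, one_pow,
      one_mul]
  rw [h1, h2, neg_one_smul, neg_add_cancel_right]

lemma signedD_evTensor_of_cycle {b : (free A).carrier} (hb : b ∈ (free A).gr 0)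
    (v : TensorCarrier N (free A)) :
    signedD N (evTensor N b v) = evTensor N b (signedD N v) :=
  eq_of_eq_on_gr (TensorCarrier.isInternal N (free A)) (f := signedD N ∘ₗ evTensor N b)
    (g := evTensor N b ∘ₗ signedD N) (fun j v hv => by
      have h := signedD_evTensor hb hv
      rwa [pow_zero, one_smul, (free A).d_zero hb, evTensor_zero, add_zero] at h) v

variable (N) in
/-- The additive functionals on `N ⊗_A (A ⊗_O 𝒟)` with values in `ℚ / ℤ` that vanish on the
components of degree `> n` and on their boundaries. -/
def dualSubgroup (n : ℕ) : AddSubgroup (TensorCarrier N (free A) →+ AddCircle (1 : ℚ)) where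
  carrier := {ω | ∀ j, n < j → ∀ v ∈ TensorCarrier.gr N (free A) j,
    ω v = 0 ∧ ω (TensorCarrier.d v) = 0}
  zero_mem' _ _ _ _ := ⟨rfl, rfl⟩
  add_mem' h h' j hj v hv := by
    simp [h j hj v hv, h' j hj v hv]
  neg_mem' h j hj v hv := by
    simp [h j hj v hv]

variable (N) in
/-- The module underlying the dual of `N`: it consists of functionals on `N ⊗_A (A ⊗_O 𝒟)`, with the
actions of `A` and `𝒟` by right multiplication on `A ⊗_O 𝒟`. -/
def DualCarrier (n : ℕ) : Type u := dualSubgroup N n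

namespace DualCarrier

variable {n : ℕ}

instance : AddCommGroup (DualCarrier N n) := inferInstanceAs (AddCommGroup (dualSubgroup N n))

variable (N n) in
/-- The functional underlying an element of the dual. -/
def toHom : DualCarrier N n →+ (TensorCarrier N (free A) →+ AddCircle (1 : ℚ)) :=
  (dualSubgroup N n).subtype

lemma toHom_zero_of_lt (ω : DualCarrier N n) {j : ℕ} (hj : n < j) {v : TensorCarrier N (free A)}
    (hv : v ∈ TensorCarrier.gr N (free A) j) : toHom N n ω v = 0 := (ω.2 j hj v hv).1

lemma toHom_d_of_lt (ω : DualCarrier N n) {j : ℕ} (hj : n < j) {v : TensorCarrier N (free A)}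
    (hv : v ∈ TensorCarrier.gr N (free A) j) : toHom N n ω (TensorCarrier.d v) = 0 :=
  (ω.2 j hj v hv).2

lemma ext {ω ω' : DualCarrier N n} (h : ∀ j, ∀ v ∈ TensorCarrier.gr N (free A) j,
    toHom N n ω v = toHom N n ω' v) : ω = ω' :=
  Subtype.ext (AddMonoidHom.ext fun v =>
    eq_of_eq_on_gr (TensorCarrier.isInternal N (free A)) (f := toHom N n ω) (g := toHom N n ω') h v)

/-- Right multiplication by `b`, followed by a functional. -/
def act (b : (free A).carrier) (ω : DualCarrier N n) : DualCarrier N n :=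
  ⟨(toHom N n ω).comp (AddMonoidHomClass.toAddMonoidHom (evTensor N b)), fun j hj v hv => by
    change toHom N n ω (evTensor N b v) = 0 ∧ toHom N n ω (evTensor N b (TensorCarrier.d v)) = 0
    induction b using grading_induction (free A).isInternal with
    | hadd x y hx hy =>
      rw [evTensor_add, evTensor_add, map_add, map_add, hx.1, hx.2, hy.1, hy.2, add_zero]
      exact ⟨rfl, rfl⟩
    | hmem p b hb =>
      have h1 := evTensor_mem hb hv
      have h2 : toHom N n ω ((-1 : ℤ) ^ j • evTensor N ((free A).d b) v) = 0 := by
        rw [map_zsmul]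
        cases p with
        | zero => rw [(free A).d_zero hb, evTensor_zero, map_zero, smul_zero]
        | succ p =>
          rw [toHom_zero_of_lt ω (by omega) (evTensor_mem ((free A).d_mem hb) hv), smul_zero]
      refine ⟨toHom_zero_of_lt ω (by omega) h1, ?_⟩
      have h3 := toHom_d_of_lt ω (by omega) h1
      rwa [d_evTensor b hv, map_add, h2, add_zero] at h3⟩

lemma toHom_act (b : (free A).carrier) (ω : DualCarrier N n) (v : TensorCarrier N (free A)) :
    toHom N n (act b ω) v = toHom N n ω (evTensor N b v) := rfl

lemma act_act (b b' : (free A).carrier) (ω : DualCarrier N n) :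
    act b (act b' ω) = act (ev b' b) ω :=
  ext fun j v _ => by rw [toHom_act, toHom_act, toHom_act, evTensor_evTensor]

lemma act_gen (ω : DualCarrier N n) : act (gen A) ω = ω :=
  ext fun j v _ => by rw [toHom_act, evTensor_gen]

lemma act_add (b : (free A).carrier) (ω ω' : DualCarrier N n) :
    act b (ω + ω') = act b ω + act b ω' :=
  ext fun j v _ => by
    rw [toHom_act, map_add, map_add, AddMonoidHom.add_apply, AddMonoidHom.add_apply, toHom_act,
      toHom_act]

lemma act_zero (b : (free A).carrier) : act b (0 : DualCarrier N n) = 0 := by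
  simpa using act_add b (0 : DualCarrier N n) 0

lemma add_act (b b' : (free A).carrier) (ω : DualCarrier N n) :
    act (b + b') ω = act b ω + act b' ω :=
  ext fun j v _ => by
    rw [toHom_act, evTensor_add, map_add, map_add, AddMonoidHom.add_apply, toHom_act, toHom_act]

lemma zero_act (ω : DualCarrier N n) : act 0 ω = 0 := by
  simpa using add_act 0 0 ω

instance : Module (DiffOp k O) (DualCarrier N n) where
  smul P ω := act (P • gen A) ω
  one_smul ω := by
    change act ((1 : DiffOp k O) • gen A) ω = ω
    rw [one_smul, act_gen]
  mul_smul P Q ω := by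
    change act ((P * Q) • gen A) ω = act (P • gen A) (act (Q • gen A) ω)
    rw [act_act, map_smul, ev_gen, mul_smul]
  smul_zero P := act_zero _
  smul_add P ω ω' := act_add _ ω ω'
  add_smul P Q ω := by
    change act ((P + Q) • gen A) ω = act (P • gen A) ω + act (Q • gen A) ω
    rw [add_smul, add_act]
  zero_smul ω := by
    change act ((0 : DiffOp k O) • gen A) ω = 0
    rw [zero_smul, zero_act]

instance : Module O (DualCarrier N n) := Module.compHom _ (DiffOp.ofFun k O)

instance : Module A.carrier (DualCarrier N n) where
  smul a ω := act (a • gen A) ω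
  one_smul ω := by
    change act ((1 : A.carrier) • gen A) ω = ω
    rw [one_smul, act_gen]
  mul_smul a b ω := by
    change act ((a * b) • gen A) ω = act (a • gen A) (act (b • gen A) ω)
    rw [act_act, ev_smul, ev_gen, mul_smul]
  smul_zero a := act_zero _
  smul_add a ω ω' := act_add _ ω ω'
  add_smul a b ω := by
    change act ((a + b) • gen A) ω = act (a • gen A) ω + act (b • gen A) ω
    rw [add_smul, add_act]
  zero_smul ω := by
    change act ((0 : A.carrier) • gen A) ω = 0
    rw [zero_smul, zero_act]

lemma dsmul_def (P : DiffOp k O) (ω : DualCarrier N n) : P • ω = act (P • gen A) ω := rfl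

lemma asmul_def (a : A.carrier) (ω : DualCarrier N n) : a • ω = act (a • gen A) ω := rfl

lemma osmul_def (f : O) (ω : DualCarrier N n) : f • ω = DiffOp.ofFun k O f • ω := rfl

instance : IsScalarTower O (DiffOp k O) (DualCarrier N n) :=
  ⟨fun f P ω => by rw [osmul_def, DiffOp.smul_def, mul_smul]⟩

instance : IsScalarTower O A.carrier (DualCarrier N n) :=
  ⟨fun f a ω => by
    rw [osmul_def, dsmul_def, asmul_def, asmul_def, act_act, map_smul, ev_gen, DiffOp.ofFun_smul,
      smul_assoc]⟩

variable (N n) in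
/-- The component of degree `i` of the dual consists of the functionals that vanish on all
components except for the one of degree `n - i`. -/
def gr (i : ℕ) : Submodule (DiffOp k O) (DualCarrier N n) where
  carrier := {ω | ∀ j, j + i ≠ n → ∀ v ∈ TensorCarrier.gr N (free A) j, toHom N n ω v = 0}
  zero_mem' _ _ _ _ := rfl
  add_mem' h h' j hj v hv := by
    rw [map_add, AddMonoidHom.add_apply, h j hj v hv, h' j hj v hv, add_zero]
  smul_mem' P ω h j hj v hv := by
    rw [dsmul_def, toHom_act]
    exact h j hj _ (evTensor_mem (Submodule.smul_mem _ P gen_mem) hv)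

/-- The restriction of a functional to the component of degree `m`, extended by zero. -/
def component (m : ℕ) : DualCarrier N n →ₗ[DiffOp k O] DualCarrier N n where
  toFun ω := ⟨(toHom N n ω).comp
    (AddMonoidHomClass.toAddMonoidHom (gproj (TensorCarrier.isInternal N (free A)) m)),
    fun j hj v hv => by
      have h1 := gproj_of_mem (TensorCarrier.isInternal N (free A)) hv m
      have h2 := gproj_of_mem (TensorCarrier.isInternal N (free A)) hv (m + 1)
      have h3 := gproj_d (tensorObj N (free A)) m v
      change toHom N n ω (gproj (TensorCarrier.isInternal N (free A)) m v) = 0 ∧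
        toHom N n ω (gproj (TensorCarrier.isInternal N (free A)) m (TensorCarrier.d v)) = 0
      refine ⟨?_, (congrArg (toHom N n ω) h3).trans
        ((congrArg (fun x => toHom N n ω (TensorCarrier.d x)) h2).trans ?_)⟩
      · rw [h1]
        split_ifs
        · exact toHom_zero_of_lt ω hj hv
        · exact map_zero _
      · split_ifs
        · exact toHom_d_of_lt ω hj hv
        · rw [map_zero, map_zero]⟩
  map_add' ω ω' := rfl
  map_smul' P ω := ext fun j v hv => congrArg (toHom N n ω)
    (gproj_comm (TensorCarrier.isInternal N (free A)) (TensorCarrier.isInternal N (free A))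
      (evTensor N (P • gen A))
      (fun i x hx => evTensor_mem (Submodule.smul_mem _ P gen_mem) hx) m v).symm

lemma toHom_component (m : ℕ) (ω : DualCarrier N n) (v : TensorCarrier N (free A)) :
    toHom N n (component m ω) v =
      toHom N n ω (gproj (TensorCarrier.isInternal N (free A)) m v) := rfl

lemma toHom_component_of_mem (m : ℕ) (ω : DualCarrier N n) {j : ℕ} {v : TensorCarrier N (free A)}
    (hv : v ∈ TensorCarrier.gr N (free A) j) :
    toHom N n (component m ω) v = if j = m then toHom N n ω v else 0 := by
  rw [toHom_component, gproj_of_mem _ hv]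
  split_ifs <;> simp

lemma isInternal : DirectSum.IsInternal (gr N n) := by
  refine isInternal_of_proj (fun i => if i ≤ n then component (n - i) else 0)
    (fun i ω hω m => ext fun j v hv => ?_) ?_
  · have h := hω j
    by_cases hm : m ≤ n
    · rw [if_pos hm, toHom_component_of_mem _ _ hv]
      by_cases hi : i = m
      · rw [if_pos hi]
        split_ifs with hj
        · rfl
        · exact (h (by omega) v hv).symm
      · rw [if_neg hi]
        split_ifs with hj
        · exact h (by omega) v hv
        · rfl
    · rw [if_neg hm]
      split_ifs with hi
      · exact (h (by omega) v hv).symm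
      · rfl
  · rw [eq_top_iff]
    rintro ω -
    have h : ω = ∑ i ∈ Finset.range (n + 1), component i ω := ext fun j v hv => by
      rw [map_sum, AddMonoidHom.finsetSum_apply,
        Finset.sum_congr rfl fun i _ => toHom_component_of_mem i ω hv, Finset.sum_ite_eq]
      split_ifs with hj
      · rfl
      · exact toHom_zero_of_lt ω (by simpa using hj) hv
    rw [h]
    refine sum_mem fun i hi => Submodule.mem_iSup_of_mem (n - i) fun j hj v hv => ?_
    rw [toHom_component_of_mem i ω hv, if_neg]
    have := Finset.mem_range.1 hi
    omega

variable (N n) in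
/-- The differential of the dual. -/
def d : DualCarrier N n →ₗ[DiffOp k O] DualCarrier N n where
  toFun ω := ⟨(toHom N n ω).comp (AddMonoidHomClass.toAddMonoidHom (signedD N)), fun j hj v hv => by
    change toHom N n ω (signedD N v) = 0 ∧ toHom N n ω (signedD N (TensorCarrier.d v)) = 0
    rw [signedD_of_mem hv, map_zsmul, toHom_d_of_lt ω hj hv, smul_zero, signedD,
      LinearMap.comp_apply, TensorCarrier.d_d, map_zero, map_zero]
    exact ⟨rfl, rfl⟩⟩
  map_add' ω ω' := rfl
  map_smul' P ω := ext fun j v hv => congrArg (toHom N n ω)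
    (signedD_evTensor_of_cycle (Submodule.smul_mem _ P gen_mem) v).symm

lemma toHom_d (ω : DualCarrier N n) (v : TensorCarrier N (free A)) :
    toHom N n (d N n ω) v = toHom N n ω (signedD N v) := rfl

end DualCarrier

open DualCarrier

variable (N) in
/-- The dual of `N`, shifted by `n` and truncated to non-negative degrees. A morphism from `P` into
it is the same as a functional on `(N ⊗_A P)_n` that vanishes on boundaries. -/
def dual (n : ℕ) : DGMod A where
  carrier := DualCarrier N n
  gr := DualCarrier.gr N n
  isInternal := DualCarrier.isInternal
  smul_mem {i j a ω} ha hω m hm v hv := by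
    rw [asmul_def, toHom_act]
    have h : a • gen A ∈ (free A).gr (i + 0) := (free A).smul_mem ha gen_mem
    exact hω (m + (i + 0)) (by omega) _ (evTensor_mem h hv)
  der_smul θ a ω := by
    rw [asmul_def, asmul_def, asmul_def, dsmul_def, dsmul_def, act_act, act_act, map_smul, ev_gen,
      ev_smul, ev_gen, (free A).der_smul, add_act]
  d := DualCarrier.d N n
  d_mem {i ω} hω j hj v hv := by
    rw [toHom_d]
    cases j with
    | zero => rw [signedD_of_mem hv, TensorCarrier.d_zero hv, smul_zero, map_zero]
    | succ j => exact hω j (by omega) _ (signedD_mem hv)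
  d_zero {ω} hω := DualCarrier.ext fun j v hv => by
    rw [toHom_d, map_zero]
    cases j with
    | zero => rw [signedD_of_mem hv, TensorCarrier.d_zero hv, smul_zero, map_zero]; rfl
    | succ j =>
      by_cases hj : j = n
      · rw [signedD_of_mem hv, map_zsmul, toHom_d_of_lt ω (by omega) hv, smul_zero]
        rfl
      · exact hω j (by omega) _ (signedD_mem hv)
  d_d ω := DualCarrier.ext fun j v hv => by
    rw [toHom_d, toHom_d, map_zero]
    cases j with
    | zero => rw [signedD_of_mem hv, TensorCarrier.d_zero hv, smul_zero, map_zero, map_zero]; rfl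
    | succ j =>
      rw [signedD_of_mem (signedD_mem hv), signedD_of_mem hv, map_zsmul TensorCarrier.d,
        TensorCarrier.d_d, smul_zero, smul_zero, map_zero]
      rfl
  d_smul {p a} ha ω := DualCarrier.ext fun j v hv => by
    have h1 : a • gen A ∈ (free A).gr (p + 0) := (free A).smul_mem ha gen_mem
    have h2 : (free A).d (a • gen A) = A.d a • gen A := by
      rw [(free A).d_smul ha, d_gen, smul_zero, smul_zero, add_zero]
    have h3 := signedD_evTensor h1 hv
    rw [h2, add_zero] at h3
    rw [map_add, map_zsmul, AddMonoidHom.add_apply, AddMonoidHom.zsmul_apply, toHom_d, asmul_def,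
      asmul_def, asmul_def, toHom_act, toHom_act, toHom_act, toHom_d, ← h3, map_add, map_zsmul,
      add_comm]

end DGMod

namespace DGMod

variable {k : Type v} {O : Type u} [Field k] [CommRing O] [Algebra k O] {A : DGAlg k O}
  [CharZero k] [Algebra.Smooth k O] {N N' P : DGMod A}

open TensorCarrier Free DualCarrier

/-! ### Functoriality and acyclicity of the dual -/

lemma d_eq_zero_of_signedD {v : TensorCarrier N (free A)} (hv : signedD N v = 0) :
    TensorCarrier.d v = 0 := by
  have h := eq_of_eq_on_gr (TensorCarrier.isInternal N (free A))
    (f := gsign (TensorCarrier.isInternal N (free A)) ∘ₗ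
      gsign (TensorCarrier.isInternal N (free A))) (g := LinearMap.id) (fun i x hx => by
        rw [LinearMap.comp_apply, gsign_of_mem _ hx, map_zsmul, gsign_of_mem _ hx, smul_smul,
          ← mul_pow, neg_one_mul, neg_neg, one_pow, one_smul, LinearMap.id_apply])
    (TensorCarrier.d v)
  exact h.symm.trans ((congrArg (gsign (TensorCarrier.isInternal N (free A))) hv).trans
    (map_zero _))

lemma signedD_tensorMapLin (g : N ⟶ N') (v : TensorCarrier N (free A)) :
    signedD N' (tensorMapLin g (𝟙 (free A)) v) = tensorMapLin g (𝟙 (free A)) (signedD N v) :=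
  eq_of_eq_on_gr (TensorCarrier.isInternal N (free A))
    (f := signedD N' ∘ₗ tensorMapLin g (𝟙 (free A)))
    (g := tensorMapLin g (𝟙 (free A)) ∘ₗ signedD N) (fun j v hv => by
      rw [LinearMap.comp_apply, LinearMap.comp_apply, signedD_of_mem hv,
        signedD_of_mem (tensorMapLin_mem g (𝟙 (free A)) hv), map_zsmul, tensorMapLin_d]) v

/-- The transpose `ω ↦ ω ∘ (g ⊗ 1)` of a morphism `g`. -/
def dualMap (g : N ⟶ N') (n : ℕ) : dual N' n ⟶ dual N n where
  lin :=
    { toFun := fun ω => (⟨(toHom N' n ω).comp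
        (AddMonoidHomClass.toAddMonoidHom (tensorMapLin g (𝟙 (free A)))), fun j hj v hv => by
          refine ⟨toHom_zero_of_lt ω hj (tensorMapLin_mem g (𝟙 (free A)) hv), ?_⟩
          change toHom N' n ω (tensorMapLin g (𝟙 (free A)) (TensorCarrier.d v)) = 0
          rw [tensorMapLin_d]
          exact toHom_d_of_lt ω hj (tensorMapLin_mem g (𝟙 (free A)) hv)⟩ : DualCarrier N n)
      map_add' := fun ω ω' => rfl
      map_smul' := fun Q ω => DualCarrier.ext fun j v hv =>
        congrArg (toHom N' n ω) (tensorMapLin_evTensor g (Q • gen A) v).symm }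
  map_smul a ω := DualCarrier.ext fun j v hv =>
    congrArg (toHom N' n ω) (tensorMapLin_evTensor g (a • gen A) v).symm
  map_mem hω j hj v hv := hω j hj _ (tensorMapLin_mem g (𝟙 (free A)) hv)
  map_d ω := DualCarrier.ext fun j v hv => congrArg (toHom N' n ω) (signedD_tensorMapLin g v)

/-- Since `ℚ / ℤ` is divisible, a functional that vanishes on the kernel of `f` factors
through `f`. -/
lemma exists_comp_eq_of_ker_le {X Y : Type*} [AddCommGroup X] [AddCommGroup Y] (f : X →+ Y)
    (ω : X →+ AddCircle (1 : ℚ)) (h : ∀ x, f x = 0 → ω x = 0) :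
    ∃ ω' : Y →+ AddCircle (1 : ℚ), ∀ x, ω' (f x) = ω x := by
  let f' : X ⧸ f.ker →ₗ[ℤ] Y := (QuotientAddGroup.kerLift f).toIntLinearMap
  have hf' : Function.Injective f' := QuotientAddGroup.kerLift_injective f
  obtain ⟨ω', hω'⟩ := CharacterModule.dual_surjective_of_injective f' hf'
    (QuotientAddGroup.lift f.ker ω h)
  exact ⟨ω', fun x => DFunLike.congr_fun hω' (QuotientAddGroup.mk x)⟩

/-- A functional that vanishes on boundaries, hence on the kernel of the differential, extends along
the differential. -/
lemma Acyclic.dual (hN : N.Acyclic) (n : ℕ) : (dual N n).Acyclic := by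
  intro (ω : DualCarrier N n) (hω : DualCarrier.d N n ω = 0)
  change ∃ ω' : DualCarrier N n, DualCarrier.d N n ω' = ω
  have hker : ∀ v, TensorCarrier.d v = 0 → toHom N n ω v = 0 := by
    intro v hv
    obtain ⟨w, hw⟩ := hN.tensor_free v hv
    obtain rfl : TensorCarrier.d w = v := hw
    refine eq_of_eq_on_gr (TensorCarrier.isInternal N (free A))
      (f := (toHom N n ω).comp (AddMonoidHomClass.toAddMonoidHom TensorCarrier.d)) (g := 0)
      (fun j w hw => ?_) w
    have h1 : toHom N n ω (signedD N w) = 0 := by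
      rw [← toHom_d, hω]
      rfl
    rw [signedD_of_mem hw, map_zsmul] at h1
    rcases neg_one_pow_eq_or ℤ (j + 1) with h2 | h2
    · rwa [h2, one_smul] at h1
    · rwa [h2, neg_one_smul, neg_eq_zero] at h1
  obtain ⟨ω₀, hω₀⟩ := exists_comp_eq_of_ker_le
    (AddMonoidHomClass.toAddMonoidHom (signedD N)) (toHom N n ω) fun v hv =>
      hker v (d_eq_zero_of_signedD hv)
  let τ : TensorCarrier N (free A) →ₗ[DiffOp k O] TensorCarrier N (free A) :=
    ∑ m ∈ Finset.range n, gproj (TensorCarrier.isInternal N (free A)) m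
  -- the extension has to be cut off in degrees `≥ n` in order to be an element of the dual
  have hτ : ∀ (j : ℕ) (v : TensorCarrier N (free A)), v ∈ TensorCarrier.gr N (free A) j →
      τ v = if j < n then v else 0 := fun j v hv => by
    rw [LinearMap.sum_apply, Finset.sum_congr rfl fun m _ => gproj_of_mem _ hv m,
      Finset.sum_ite_eq]
    simp only [Finset.mem_range]
  refine ⟨⟨ω₀.comp (AddMonoidHomClass.toAddMonoidHom τ), fun j hj v hv => ?_⟩,
    DualCarrier.ext fun j v hv => ?_⟩
  · change ω₀ (τ v) = 0 ∧ ω₀ (τ (TensorCarrier.d v)) = 0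
    obtain ⟨j, rfl⟩ : ∃ i, j = i + 1 := ⟨j - 1, by omega⟩
    rw [hτ _ _ hv, hτ _ _ (TensorCarrier.d_mem hv), if_neg (by omega), if_neg (by omega), map_zero]
    exact ⟨rfl, rfl⟩
  · change ω₀ (τ (signedD N v)) = toHom N n ω v
    cases j with
    | zero =>
      rw [signedD_of_mem hv, TensorCarrier.d_zero hv, smul_zero, map_zero, map_zero,
        hker v (TensorCarrier.d_zero hv)]
    | succ j =>
      rw [hτ _ _ (signedD_mem hv)]
      split_ifs with h
      · exact hω₀ v
      · rw [map_zero, toHom_zero_of_lt ω (by omega) hv]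

/-! ### Extension of functionals to the cone -/

lemma coneTensorFst_mem {M N : DGMod A} {f : M ⟶ N} {j : ℕ} {c : TensorCarrier (cone f) P}
    (hc : c ∈ TensorCarrier.gr (cone f) P j) :
    coneTensorFst f P c ∈ TensorCarrier.gr N P j := by
  refine TensorCarrier.gr_induction (p := fun c => coneTensorFst f P c ∈ TensorCarrier.gr N P j)
    (fun r s x y hx hy h => ?_) (fun x y hx hy => ?_) c hc
  · exact TensorCarrier.tmul_mem (coneFst_mem hx) hy h
  · rw [map_add]; exact add_mem hx hy

lemma coneTensorSnd_mem {M N : DGMod A} {f : M ⟶ N} {j : ℕ} {c : TensorCarrier (cone f) P}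
    (hc : c ∈ TensorCarrier.gr (cone f) P (j + 1)) :
    coneTensorSnd f P c ∈ TensorCarrier.gr M P j := by
  refine TensorCarrier.gr_induction (p := fun c => coneTensorSnd f P c ∈ TensorCarrier.gr M P j)
    (fun r s x y hx hy h => ?_) (fun x y hx hy => ?_) c hc
  · change TensorCarrier.tmul (coneSnd f x) y ∈ _
    cases r with
    | zero => rw [coneSnd_of_mem_zero hx, TensorCarrier.zero_tmul]; exact zero_mem _
    | succ r => exact TensorCarrier.tmul_mem (coneSnd_mem hx) hy (by omega)
  · rw [map_add]; exact add_mem hx hy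

variable (N) in
/-- Functionals of positive degree extend from `N` to the cone of its identity. -/
lemma fibrations_dualMap_coneInl (n : ℕ) : fibrations A (dualMap (coneInl (𝟙 N)) n) := by
  intro i hi (ω : DualCarrier N n) (hω : ω ∈ DualCarrier.gr N n i)
  refine ⟨(⟨(toHom N n ω).comp (AddMonoidHomClass.toAddMonoidHom (coneTensorFst (𝟙 N) (free A))),
    fun j hj v hv => ?_⟩ : DualCarrier (cone (𝟙 N)) n), fun j hj v hv => ?_,
    DualCarrier.ext fun j v hv => ?_⟩
  · refine ⟨toHom_zero_of_lt ω hj (coneTensorFst_mem hv), ?_⟩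
    obtain ⟨j, rfl⟩ : ∃ i, j = i + 1 := ⟨j - 1, by omega⟩
    change toHom N n ω (coneTensorFst (𝟙 N) (free A) (TensorCarrier.d v)) = 0
    rw [coneTensorFst_d, map_add, toHom_d_of_lt ω hj (coneTensorFst_mem hv), zero_add]
    exact hω j (by omega) _ (tensorMapLin_mem _ _ (coneTensorSnd_mem hv))
  · exact hω j hj _ (coneTensorFst_mem hv)
  · exact congrArg (toHom N n ω) (coneTensorFst_inl v)

/-- A fibration between acyclic modules is trivial. -/
lemma Acyclic.trivialFibrations_dualMap_coneInl (hN : N.Acyclic) (n : ℕ) :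
    trivialFibrations A (dualMap (coneInl (𝟙 N)) n) :=
  ⟨fibrations_dualMap_coneInl N n, weakEquivalences_of_acyclic _
    ((acyclic_cone (weakEquivalences_of_isIso (𝟙 N))).dual n) (hN.dual n)⟩

end DGMod

namespace DGMod

variable {k : Type v} {O : Type u} [Field k] [CommRing O] [Algebra k O] {A : DGAlg k O}
  [CharZero k] [Algebra.Smooth k O] {N N' P : DGMod A}

open TensorCarrier Free DualCarrier

/-! ### Morphisms into the dual -/

/-- The morphism `p ↦ (y ⊗ x ↦ χ (y ⊗ x p))` into the dual of `N` that corresponds to a functional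
`χ` on `(N ⊗_A P)_n` that vanishes on boundaries. -/
def curry {n : ℕ} (χ : TensorCarrier N P →+ AddCircle (1 : ℚ))
    (hgr : ∀ j, j ≠ n → ∀ x ∈ TensorCarrier.gr N P j, χ x = 0)
    (hd : ∀ x, χ (TensorCarrier.d x) = 0) : P ⟶ dual N n where
  lin :=
    { toFun := fun p => (⟨χ.comp (AddMonoidHomClass.toAddMonoidHom (evTensor N p)),
        fun j hj v hv => by
          change χ (evTensor N p v) = 0 ∧ χ (evTensor N p (TensorCarrier.d v)) = 0
          induction p using grading_induction P.isInternal with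
          | hadd p q hp hq =>
            rw [evTensor_add, evTensor_add, map_add, map_add, hp.1, hp.2, hq.1, hq.2, add_zero]
            exact ⟨rfl, rfl⟩
          | hmem i p hp =>
            refine ⟨hgr _ (by omega) _ (evTensor_mem hp hv), ?_⟩
            have h1 := congrArg χ (d_evTensor p hv)
            rw [hd, map_add, map_zsmul] at h1
            have h2 : χ (evTensor N (P.d p) v) = 0 := by
              cases i with
              | zero => rw [P.d_zero hp, evTensor_zero, map_zero]
              | succ i => exact hgr _ (by omega) _ (evTensor_mem (P.d_mem hp) hv)
            rwa [h2, smul_zero, add_zero, eq_comm] at h1⟩ : DualCarrier N n)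
      map_add' := fun p q => DualCarrier.ext fun j v hv =>
        (congrArg χ (evTensor_add p q v)).trans (map_add χ _ _)
      map_smul' := fun Q p => DualCarrier.ext fun j v hv => congrArg χ (by
        change evTensor N (Q • p) v = evTensor N p (evTensor N (Q • gen A) v)
        rw [evTensor_evTensor, map_smul, ev_gen]) }
  map_smul a p := DualCarrier.ext fun j v hv => congrArg χ (by
    change evTensor N (a • p) v = evTensor N p (evTensor N (a • gen A) v)
    rw [evTensor_evTensor, ev_smul, ev_gen])
  map_mem hp j hj v hv := hgr _ hj _ (evTensor_mem hp hv)
  map_d p := DualCarrier.ext fun j v hv => by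
    change χ (evTensor N (P.d p) v) = χ (evTensor N p (signedD N v))
    have h1 := congrArg χ (d_evTensor p hv)
    rw [hd, map_add, map_zsmul] at h1
    rw [signedD_of_mem hv, map_zsmul, map_zsmul, eq_neg_of_add_eq_zero_left h1.symm, smul_neg,
      smul_smul, ← pow_add, show j + 1 + j = 2 * j + 1 by ring, pow_succ, pow_mul, neg_one_sq,
      one_pow, one_mul, neg_one_smul, neg_neg]

lemma toHom_curry {n : ℕ} (χ : TensorCarrier N P →+ AddCircle (1 : ℚ))
    (hgr : ∀ j, j ≠ n → ∀ x ∈ TensorCarrier.gr N P j, χ x = 0)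
    (hd : ∀ x, χ (TensorCarrier.d x) = 0) (p : P.carrier) (v : TensorCarrier N (free A)) :
    toHom N n (Hom.lin (curry χ hgr hd) p) v = χ (evTensor N p v) := rfl

/-- The functional `y ⊗ p ↦ l p (y ⊗ 1)` on `N ⊗_A P` that corresponds to a morphism `l` into the
dual of `N`. -/
def uncurry {n : ℕ} (l : P ⟶ dual N n) : TensorCarrier N P →+ AddCircle (1 : ℚ) :=
  descAdd (TensorProduct.liftAddHom
    (AddMonoidHom.mk' (fun y => AddMonoidHom.mk'
      (fun p => toHom N n (Hom.lin l p) (TensorCarrier.tmul y (gen A)))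
      fun p q => by rw [map_add]; rfl)
      fun y z => AddMonoidHom.ext fun p =>
        (congrArg (toHom N n (Hom.lin l p)) (TensorCarrier.add_tmul y z (gen A))).trans
          (map_add _ _ _))
    fun f y p => by
      change toHom N n (Hom.lin l p) (TensorCarrier.tmul (f • y) (gen A)) =
        toHom N n (Hom.lin l (f • p)) (TensorCarrier.tmul y (gen A))
      rw [← DiffOp.ofFun_smul (k := k) f p, map_smul]
      change _ = toHom N n (Hom.lin l p)
        (TensorCarrier.tmul y (ev (DiffOp.ofFun k O f • gen A) (gen A)))
      rw [ev_gen, DiffOp.ofFun_smul, osmul_tmul, tmul_osmul])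
    fun p i j a y q ha hy hq => by
      change (-1 : ℤ) ^ (p * i) • toHom N n (Hom.lin l q) (TensorCarrier.tmul (a • y) (gen A)) =
        toHom N n (Hom.lin l (a • q)) (TensorCarrier.tmul y (gen A))
      rw [Hom.map_smul, ← map_zsmul, TensorCarrier.smul_tmul ha hy gen_mem]
      change _ = toHom N n (Hom.lin l q) (TensorCarrier.tmul y (ev (a • gen A) (gen A)))
      rw [ev_gen]

lemma uncurry_tmul {n : ℕ} (l : P ⟶ dual N n) (y : N.carrier) (p : P.carrier) :
    uncurry l (TensorCarrier.tmul y p) =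
      toHom N n (Hom.lin l p) (TensorCarrier.tmul y (gen A)) := rfl

lemma uncurry_d {n : ℕ} (l : P ⟶ dual N n) (x : TensorCarrier N P) :
    uncurry l (TensorCarrier.d x) = 0 :=
  eq_of_eq_on_tmul
    (f := (uncurry l).comp (AddMonoidHomClass.toAddMonoidHom TensorCarrier.d)) (g := 0)
    (fun i j y p hy hp => by
      have h1 : TensorCarrier.d (TensorCarrier.tmul y (gen A)) =
          TensorCarrier.tmul (N.d y) (gen A) := by
        rw [TensorCarrier.d_tmul hy, d_gen, TensorCarrier.tmul_zero, smul_zero, add_zero]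
      have h2 : toHom N n (Hom.lin l (P.d p)) (TensorCarrier.tmul y (gen A)) =
          toHom N n (Hom.lin l p) (signedD N (TensorCarrier.tmul y (gen A))) := by
        rw [Hom.map_d]
        rfl
      change uncurry l (TensorCarrier.d (TensorCarrier.tmul y p)) = 0
      rw [TensorCarrier.d_tmul hy, map_add, map_zsmul, uncurry_tmul, uncurry_tmul, h2,
        signedD_of_mem (TensorCarrier.tmul_mem hy gen_mem rfl), add_zero, h1, map_zsmul, smul_smul,
        ← pow_add, show i + (i + 1) = 2 * i + 1 by ring, pow_succ, pow_mul, neg_one_sq,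
        one_pow, one_mul, neg_one_smul, add_neg_cancel]) x

/-- A lift of the morphism that corresponds to `χ` along the transpose of `g` yields an extension of
`χ` along `g ⊗ P`. -/
lemma uncurry_tensorMapLin (g : N ⟶ N') {n : ℕ} (l : P ⟶ dual N' n)
    (χ : TensorCarrier N P →+ AddCircle (1 : ℚ))
    (hgr : ∀ j, j ≠ n → ∀ x ∈ TensorCarrier.gr N P j, χ x = 0)
    (hd : ∀ x, χ (TensorCarrier.d x) = 0) (hl : l ≫ dualMap g n = curry χ hgr hd)
    (x : TensorCarrier N P) : uncurry l (tensorMapLin g (𝟙 P) x) = χ x :=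
  eq_of_eq_on_tmul
    (f := (uncurry l).comp (AddMonoidHomClass.toAddMonoidHom (tensorMapLin g (𝟙 P)))) (g := χ)
    (fun i j y p hy hp => by
      have h := congrArg (fun h : P ⟶ dual N n =>
        toHom N n (Hom.lin h p) (TensorCarrier.tmul y (gen A))) hl
      have h' : toHom N n (Hom.lin (curry χ hgr hd) p) (TensorCarrier.tmul y (gen A)) =
          χ (TensorCarrier.tmul y p) := by
        rw [toHom_curry, evTensor_tmul, ev_gen]
      exact h.trans h') x

/-! ### Cofibrant modules are flat -/

/-- A cycle of `N ⊗ P` that is not a boundary is detected by a functional, that is, by a morphism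
from `P` into the dual of `N`. Since `P` is cofibrant, this morphism lifts to the dual of the
contractible cone of `N`. -/
theorem Acyclic.tensor_cofibrant (hN : N.Acyclic) (hP : P.IsCofibrant) :
    (tensorObj N P).Acyclic := by
  refine acyclic_of_homogeneous fun n (z : TensorCarrier N P)
    (hz : z ∈ TensorCarrier.gr N P n) (hdz : TensorCarrier.d z = 0) => ?_
  change ∃ w : TensorCarrier N P, TensorCarrier.d w = z
  by_contra hne
  have hz0 : (QuotientAddGroup.mk z : TensorCarrier N P ⧸
      (AddMonoidHomClass.toAddMonoidHom (TensorCarrier.d (M := N) (N := P))).range) ≠ 0 := by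
    rw [Ne, QuotientAddGroup.eq_zero_iff]
    exact hne
  obtain ⟨c, hc⟩ := CharacterModule.exists_character_apply_ne_zero_of_ne_zero hz0
  let χ : TensorCarrier N P →+ AddCircle (1 : ℚ) :=
    (AddMonoidHom.comp c (QuotientAddGroup.mk' _)).comp
      (AddMonoidHomClass.toAddMonoidHom (gproj (TensorCarrier.isInternal N P) n))
  have hχ : ∀ x, χ x = c (QuotientAddGroup.mk (gproj (TensorCarrier.isInternal N P) n x)) :=
    fun _ => rfl
  have hgr : ∀ j, j ≠ n → ∀ x ∈ TensorCarrier.gr N P j, χ x = 0 := fun j hj x hx => by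
    rw [hχ, gproj_of_mem _ hx, if_neg hj]
    exact map_zero c
  have hd : ∀ x, χ (TensorCarrier.d x) = 0 := fun x => by
    rw [hχ]
    have h : gproj (TensorCarrier.isInternal N P) n (TensorCarrier.d x) =
      TensorCarrier.d (gproj (TensorCarrier.isInternal N P) (n + 1) x) :=
        gproj_d (tensorObj N P) n x
    rw [h]
    exact (congrArg c ((QuotientAddGroup.eq_zero_iff _).2
      (AddMonoidHom.mem_range.2 ⟨gproj (TensorCarrier.isInternal N P) (n + 1) x, rfl⟩))).trans
      (map_zero c)
  have hlift : HasLiftingProperty (Limits.initial.to P) (dualMap (coneInl (𝟙 N)) n) :=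
    hP _ (hN.trivialFibrations_dualMap_coneInl n)
  have sq : CommSq (Limits.initial.to _) (Limits.initial.to P) (dualMap (coneInl (𝟙 N)) n)
    (curry χ hgr hd) := ⟨Limits.initial.hom_ext _ _⟩
  have hu := uncurry_tensorMapLin (coneInl (𝟙 N)) sq.lift χ hgr hd sq.fac_right z
  obtain ⟨w, hw⟩ : ∃ w : TensorCarrier (cone (𝟙 N)) P,
      TensorCarrier.d w = tensorMapLin (coneInl (𝟙 N)) (𝟙 P) z :=
    acyclic_cone_id_tensor N P (tensorMapLin (coneInl (𝟙 N)) (𝟙 P) z) (by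
      change TensorCarrier.d _ = 0
      rw [← tensorMapLin_d, hdz, map_zero])
  rw [← hw, uncurry_d, hχ, gproj_of_mem _ hz, if_pos rfl] at hu
  exact hc hu.symm

variable {M M' : DGMod A}

/-- Tensoring with a cofibrant module preserves weak equivalences. -/
lemma IsCofibrant.tensorMap_id_right {f : M ⟶ M'} (hf : weakEquivalences A f)
    (hP : P.IsCofibrant) : weakEquivalences A (tensorMap f (𝟙 P)) :=
  weakEquivalences_tensorMap_of_acyclic_cone _ ((acyclic_cone hf).tensor_cofibrant hP)

lemma IsCofibrant.tensorMap_id_left {f : M ⟶ M'} (hf : weakEquivalences A f)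
    (hP : P.IsCofibrant) : weakEquivalences A (tensorMap (𝟙 P) f) := by
  have h := (weakEquivalences A).comp_mem _ _
    (weakEquivalences_of_isIso (braid P M)) (hP.tensorMap_id_right hf)
  rw [← braid_naturality] at h
  exact (weakEquivalences A).of_postcomp _ _ (weakEquivalences_of_isIso (braid P M')) h

end DGMod

/-! ### Natural transformations between functors on a strict localization -/

/-- A natural isomorphism between functors that invert `W` induces a unique isomorphism between
their factorizations through the strict localization at `W`. -/
lemma existsUnique_lift_iso {C D : Type*} [Category* C] [Category* D] {W : MorphismProperty C}
    {G G' : C ⥤ D} (hG : W.IsInvertedBy G) (hG' : W.IsInvertedBy G') (τ : G ⟶ G') [IsIso τ] :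
    ∃! e : Localization.Construction.lift G hG ≅ Localization.Construction.lift G' hG',
      ∀ X, e.hom.app (W.Q.obj X) = τ.app X := by
  let τ' : W.Q ⋙ Localization.Construction.lift G hG ≅
      W.Q ⋙ Localization.Construction.lift G' hG' :=
    eqToIso (Localization.Construction.fac G hG) ≪≫ asIso τ ≪≫
      eqToIso (Localization.Construction.fac G' hG').symm
  have hτ' : ∀ X, τ'.hom.app X = τ.app X := fun X => by
    simp only [τ', Iso.trans_hom, NatTrans.comp_app, eqToIso.hom, eqToHom_app, asIso_hom]
    exact (Category.id_comp _).trans (Category.comp_id _)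
  have hext : ∀ {F₁ F₂ : W.Localization ⥤ D} {α β : F₁ ⟶ F₂},
      (∀ X, α.app (W.Q.obj X) = β.app (W.Q.obj X)) → α = β := fun h =>
    Localization.Construction.natTrans_hcomp_injective (by ext X; simpa using h X)
  refine ⟨⟨Localization.Construction.natTransExtension τ'.hom,
    Localization.Construction.natTransExtension τ'.inv, hext fun X => ?_, hext fun X => ?_⟩,
    fun X => ?_, fun e he => Iso.ext (hext fun X => ?_)⟩
  · simp [Localization.Construction.natTransExtension,
      Localization.Construction.NatTransExtension.app_eq]
  · simp [Localization.Construction.natTransExtension,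
      Localization.Construction.NatTransExtension.app_eq]
  · exact (Localization.Construction.NatTransExtension.app_eq _ X).trans (hτ' X)
  · exact (he X).trans ((Localization.Construction.NatTransExtension.app_eq _ X).trans
      (hτ' X)).symm

namespace DGMod

variable {k : Type v} {O : Type u} [Field k] [CommRing O] [Algebra k O] {A : DGAlg k O}

/-! ### Cofibrant replacements -/

namespace CofTrivFibFactorization

variable (F : CofTrivFibFactorization A)

lemma isCofibrant_Q (M : DGMod A) : (F.Q.obj M).IsCofibrant := by
  have h := F.hi ((fromInitial A).obj M)
  have h' : F.i.app ((fromInitial A).obj M) = Limits.initial.to (F.Q.obj M) :=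
    Limits.initial.hom_ext _ _
  rwa [h'] at h

lemma weakEquivalences_q (M : DGMod A) : weakEquivalences A (F.q.app M) :=
  (F.hp ((fromInitial A).obj M)).2

lemma weakEquivalences_Q_map {M N : DGMod A} {f : M ⟶ N} (hf : weakEquivalences A f) :
    weakEquivalences A (F.Q.map f) := by
  have h := (weakEquivalences A).comp_mem _ _ (F.weakEquivalences_q M) hf
  have h' : F.Q.map f ≫ F.q.app N = F.q.app M ≫ f := F.q.naturality f
  rw [← h'] at h
  exact (weakEquivalences A).of_postcomp _ _ (F.weakEquivalences_q N) h

end CofTrivFibFactorization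

variable {M M' N N' : DGMod A}

lemma isIso_L_map {f : M ⟶ N} (hf : weakEquivalences A f) : IsIso ((L A).map f) :=
  (weakEquivalences A).Q_inverts f hf

lemma weakZigzag_of_weakEquivalences {f : M ⟶ N} (hf : weakEquivalences A f) : M.WeakZigzag N :=
  .rel _ _ ⟨f, hf⟩

variable [CharZero k] [Algebra.Smooth k O]

lemma tensorMap_comp {M'' N'' : DGMod A} (f : M ⟶ M') (f' : M' ⟶ M'') (g : N ⟶ N')
    (g' : N' ⟶ N'') : tensorMap (f ≫ f') (g ≫ g') = tensorMap f g ≫ tensorMap f' g' :=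
  (tensor A).map_comp ((f, g) : (M, N) ⟶ (M', N')) ((f', g') : (M', N') ⟶ (M'', N''))

/-- For cofibrant `M` and `M'` and arbitrary `N'`, the map `f ⊗ N'` is compared with `f ⊗ Q N'`. -/
lemma weakEquivalences_tensorMap_of_isCofibrant_left (F : CofTrivFibFactorization A)
    (hM : M.IsCofibrant) (hM' : M'.IsCofibrant)
    {f : M ⟶ M'} {g : N ⟶ N'} (hf : weakEquivalences A f) (hg : weakEquivalences A g) :
    weakEquivalences A (tensorMap f g) := by
  have h1 : weakEquivalences A (tensorMap f (𝟙 N')) := by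
    have h := (weakEquivalences A).comp_mem _ _ ((F.isCofibrant_Q N').tensorMap_id_right hf)
      (hM'.tensorMap_id_left (F.weakEquivalences_q N'))
    have h' := (tensorMap_comp f (𝟙 M') (𝟙 (F.Q.obj N')) (F.q.app N')).symm.trans
      ((congrArg₂ tensorMap ((Category.comp_id f).trans (Category.id_comp f).symm)
        ((Category.id_comp _).trans (Category.comp_id _).symm)).trans
      (tensorMap_comp (𝟙 M) f (F.q.app N') (𝟙 N')))
    rw [h'] at h
    exact (weakEquivalences A).of_precomp _ _ (hM.tensorMap_id_left (F.weakEquivalences_q N')) h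
  have h2 := (weakEquivalences A).comp_mem _ _ (hM.tensorMap_id_left hg) h1
  rwa [← tensorMap_comp, Category.id_comp, Category.comp_id] at h2

lemma weakEquivalences_tensorMap_of_isCofibrant_right (F : CofTrivFibFactorization A)
    (hN : N.IsCofibrant) (hN' : N'.IsCofibrant)
    {f : M ⟶ M'} {g : N ⟶ N'} (hf : weakEquivalences A f) (hg : weakEquivalences A g) :
    weakEquivalences A (tensorMap f g) := by
  have h := (weakEquivalences A).comp_mem _ _ (weakEquivalences_of_isIso (braid M N))
    (weakEquivalences_tensorMap_of_isCofibrant_left F hN hN' hg hf)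
  rw [← braid_naturality] at h
  exact (weakEquivalences A).of_postcomp _ _ (weakEquivalences_of_isIso (braid M' N')) h

lemma isIso_tensorLMap {F₁ F₂ G₁ G₂ : DGMod A ⥤ DGMod A} (α : F₁ ⟶ G₁) (β : F₂ ⟶ G₂)
    (h : ∀ M N, weakEquivalences A (tensorMap (α.app M) (β.app N))) :
    IsIso (tensorLMap α β) :=
  have (X : DGMod A × DGMod A) : IsIso ((tensorLMap α β).app X) := isIso_L_map (h X.1 X.2)
  NatIso.isIso_of_isIso_app _

/-- The derived tensor product is computed by a cofibrant replacement in the second variable and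
any weakly equivalent object in the first one. -/
lemma weakZigzag_tensorObj_of_isCofibrant (F : CofTrivFibFactorization A) {c : M ⟶ M'}
    {c' : N ⟶ N'} (hN : N.IsCofibrant) (hc : weakEquivalences A c)
    (hc' : weakEquivalences A c') :
    ((F.Q.obj M').tensorObj (F.Q.obj N')).WeakZigzag (M.tensorObj N) :=
  -- `M ⊗ N ⟶ M' ⊗ N ⟵ Q M' ⊗ N ⟶ Q M' ⊗ N' ⟵ Q M' ⊗ Q N'`
  have h1 := weakZigzag_of_weakEquivalences (hN.tensorMap_id_right hc)
  have h2 := weakZigzag_of_weakEquivalences (hN.tensorMap_id_right (F.weakEquivalences_q M'))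
  have h3 := weakZigzag_of_weakEquivalences ((F.isCofibrant_Q M').tensorMap_id_left hc')
  have h4 := weakZigzag_of_weakEquivalences
    ((F.isCofibrant_Q M').tensorMap_id_left (F.weakEquivalences_q N'))
  .trans _ _ _ h4 (.trans _ _ _ (.symm _ _ h3) (.trans _ _ _ h2 (.symm _ _ h1)))

end DGMod

end DGeom

end

theorem mainTheorem4 {k : Type v} {O : Type u} [Field k] [CharZero k] [CommRing O] [Algebra k O]
    [Algebra.Smooth k O] (A : DGeom.DGAlg k O) (F : DGeom.DGMod.CofTrivFibFactorization A) :
    -- the functors `L ∘ (Q - ⊗ Q -)`, `L ∘ (id - ⊗ Q -)` and `L ∘ (Q - ⊗ id -)` factor through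
    -- the homotopy category of `Mod(A) × Mod(A)`
    ∃ (hQQ : (DGeom.DGMod.weakEquivalences₂ A).IsInvertedBy (DGeom.DGMod.tensorL F.Q F.Q))
      (h1Q : (DGeom.DGMod.weakEquivalences₂ A).IsInvertedBy
        (DGeom.DGMod.tensorL (𝟭 (DGeom.DGMod A)) F.Q))
      (hQ1 : (DGeom.DGMod.weakEquivalences₂ A).IsInvertedBy
        (DGeom.DGMod.tensorL F.Q (𝟭 (DGeom.DGMod A)))),
      -- the whiskered transformations are isomorphisms
      IsIso (DGeom.DGMod.tensorLMap F.q (𝟙 F.Q)) ∧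
      IsIso (DGeom.DGMod.tensorLMap (𝟙 F.Q) F.q) ∧
      -- and they induce canonical isomorphisms between the factorizations
      (∃! e : DGeom.DGMod.HoLift (DGeom.DGMod.tensorL F.Q F.Q) hQQ ≅
          DGeom.DGMod.HoLift (DGeom.DGMod.tensorL (𝟭 (DGeom.DGMod A)) F.Q) h1Q,
        ∀ X : DGeom.DGMod A × DGeom.DGMod A, e.hom.app ((DGeom.DGMod.L₂ A).obj X) =
          (DGeom.DGMod.tensorLMap F.q (𝟙 F.Q)).app X) ∧
      (∃! e : DGeom.DGMod.HoLift (DGeom.DGMod.tensorL F.Q F.Q) hQQ ≅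
          DGeom.DGMod.HoLift (DGeom.DGMod.tensorL F.Q (𝟭 (DGeom.DGMod A))) hQ1,
        ∀ X : DGeom.DGMod A × DGeom.DGMod A, e.hom.app ((DGeom.DGMod.L₂ A).obj X) =
          (DGeom.DGMod.tensorLMap (𝟙 F.Q) F.q).app X) ∧
      -- zigzags of weak equivalences in `Mod(A)`
      (∀ M N : DGeom.DGMod A,
        ((F.Q.obj M).tensorObj (F.Q.obj N)).WeakZigzag ((F.Q.obj M).tensorObj N) ∧
        ((F.Q.obj M).tensorObj N).WeakZigzag (M.tensorObj (F.Q.obj N))) ∧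
      (∀ (C₁ C₂ : DGeom.DGMod.LocalCofibrantFReplacement A) (M N : DGeom.DGMod A),
        ((F.Q.obj M).tensorObj (F.Q.obj N)).WeakZigzag ((C₁.obj M).tensorObj (C₂.obj N))) ∧
      (∀ (C₁ C₂ : DGeom.DGMod.LocalCofibrantReplacement A) (M N : DGeom.DGMod A),
        ((F.Q.obj M).tensorObj (F.Q.obj N)).WeakZigzag ((C₁.obj M).tensorObj (C₂.obj N)) ∧
        ((F.Q.obj M).tensorObj (F.Q.obj N)).WeakZigzag ((F.Q.obj M).tensorObj (C₂.obj N))) := by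
  have hLeft {M M' N N' : DGeom.DGMod A} :=
    DGeom.DGMod.weakEquivalences_tensorMap_of_isCofibrant_left (M := M) (M' := M') (N := N)
      (N' := N') F
  have hq := F.weakEquivalences_q
  have hcof := F.isCofibrant_Q
  have i1 : IsIso (DGeom.DGMod.tensorLMap F.q (𝟙 F.Q)) :=
    DGeom.DGMod.isIso_tensorLMap _ _ fun M N => (hcof N).tensorMap_id_right (hq M)
  have i2 : IsIso (DGeom.DGMod.tensorLMap (𝟙 F.Q) F.q) :=
    DGeom.DGMod.isIso_tensorLMap _ _ fun M N => (hcof M).tensorMap_id_left (hq N)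
  refine ⟨fun X Y f hf => DGeom.DGMod.isIso_L_map
      (hLeft (hcof X.1) (hcof Y.1) (F.weakEquivalences_Q_map hf.1) (F.weakEquivalences_Q_map hf.2)),
    fun X Y f hf => DGeom.DGMod.isIso_L_map
      (DGeom.DGMod.weakEquivalences_tensorMap_of_isCofibrant_right F (hcof X.2) (hcof Y.2) hf.1
        (F.weakEquivalences_Q_map hf.2)),
    fun X Y f hf => DGeom.DGMod.isIso_L_map
      (hLeft (hcof X.1) (hcof Y.1) (F.weakEquivalences_Q_map hf.1) hf.2),
    i1, i2, DGeom.existsUnique_lift_iso _ _ _, DGeom.existsUnique_lift_iso _ _ _, fun M N => ?_,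
    fun C₁ C₂ M N => ?_, fun C₁ C₂ M N => ⟨?_, ?_⟩⟩
  · have h1 := DGeom.DGMod.weakZigzag_of_weakEquivalences ((hcof M).tensorMap_id_left (hq N))
    have h2 := DGeom.DGMod.weakZigzag_of_weakEquivalences ((hcof N).tensorMap_id_right (hq M))
    exact ⟨h1, .trans _ _ _ (.symm _ _ h1) h2⟩
  · exact DGeom.DGMod.weakZigzag_tensorObj_of_isCofibrant F (C₂.isCofibrant N)
      (C₁.weakEquivalence M) (C₂.weakEquivalence N)
  · exact DGeom.DGMod.weakZigzag_tensorObj_of_isCofibrant F (C₂.isCofibrant N)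
      (C₁.weakEquivalence M) (C₂.weakEquivalence N)
  · exact DGeom.DGMod.weakZigzag_tensorObj_of_isCofibrant F (C₂.isCofibrant N)
      (hq M) (C₂.weakEquivalence N)
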